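/- A rateless code is a pair of deterministic maps: an encoder that sends each word $m\in\{0,1\}^k$ ($k\in\mathbb N$) to an infinite bit sequence $\mathrm{enc}(m,1),\mathrm{enc}(m,2),\dots$, and a decoder that sends each $y\in\{0,1\}^n$ and each $k$ to a word $\mathrm{dec}(y,k)\in\{0,1\}^k$. Write $\mathrm{enc}(m,[1:n])$ for the first $n$ bits of the encoding, and $$\mathrm{err}(p,k,n)=\max_{m\in\{0,1\}^k}\Pr_{e}\bigl[\mathrm{dec}(\mathrm{enc}(m,[1:n])+e,\,k)\neq m\bigr],$$ where $e\in\{0,1\}^n$ has independent coordinates, each equal to $1$ with probability $p$. Let $H(p)=-p\log_2p-(1-p)\log_2(1-p)$. **Greedy matrix.** For each $k$, define rows $R_1,R_2,\dots\in\mathrm{GF}(2)^k$ as follows. $R_1,\dots,R_k$ are the rows of the identity matrix, and $M=\emptyset$ at the start. For $n=k,k+1,\dots$: let $W_{i,n}$ be the set of $x\in\mathrm{GF}(2)^k$ for which exactly $i$ of $R_1\cdot x,\dots,R_n\cdot x$ equal $1$; for every $1\le i\le n$ with $|W_{i,n}\setminus M|<2n^2$ add all of $W_{i,n}$ to $M$;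 then let $\widehat W_{i,n}=W_{i,n}\setminus M$, let $d$ be the least positive integer with $W_{d,n}\ne\emptyset$, and let $R_{n+1}$ be the lexicographically first $R\in\mathrm{GF}(2)^k$ such that, for all $1\le i\le n$, $$\Bigl(\tfrac12-\tfrac1{2\sqrt n}\Bigr)|\widehat W_{i,n}|\le|\{s\in\widehat W_{i,n}: s\cdot R=1\}|\le\Bigl(\tfrac12+\tfrac1{2\sqrt n}\Bigr)|\widehat W_{i,n}|,$$ and such that $|\{s\in W_{d,n}:s\cdot R=1\}|\ge\tfrac18|W_{d,n}|$ (the last condition is void for $k=0$). **Theorem.** For every $k$ and $n\ge k$ a suitable vector $R_{n+1}$ exists, so the greedy matrix is well defined. There is a rateless code $(\mathrm{enc},\mathrm{dec})$ such that: 1. it is linear, with generator matrix the greedy matrix, that is, $\mathrm{enc}(m,i)=R_i\cdot m$; it is systematic, that is, $\mathrm{enc}(m,[1:k])=m$ for $m\in\{0,1\}^k$; and $\mathrm{dec}$ is maximum-likelihood decoding, that is, $\mathrm{dec}(y,k)$ is always a word whose $n$-bit codeword is closest to $y$ in Hamming distance; 2. for every $p\in(0,\tfrac12)$ and $\delta\in(0,1-H(p))$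 there is a constant $c>0$, depending only on $p$ and $\delta$, such that $\mathrm{err}(p,k,n)\le e^{-c\,n/\log n}$ for all $k$ and all $n\ge2$ with $n\ge k/(1-H(p)-\delta)$; 3. on a random access machine with unit-cost operations ($+$, truncated $-$, $\times$, integer division, comparison, indirect addressing) on words of $O(k+\log n)$ bits, one program computes $\mathrm{enc}(m,[1:n])$ from $k$, $n$, $m\in\{0,1\}^k$, and another computes $\mathrm{dec}(y,k)$ from $k$, $n$, $y\in\{0,1\}^n$, both in time $O(nk\cdot2^{2k})$ for all $k,n\ge1$, with absolute constants. -/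

import Mathlib

open scoped BigOperators

noncomputable section

namespace Rateless

/-- Binary words of length `l`, as vectors over the field with two elements. -/
abbrev Word (l : ℕ) : Type := Fin l → ZMod 2

/-- A (deterministic) rateless code. `enc k m i` is the bit in position `i` of the infinite encoding
of the `k`-bit information word `m`, where positions are counted from `0`. `dec n k y` is the
`k`-bit information word to which the noisy codeword `y` of length `n` is decoded. -/
structure RatelessCode where
  enc : (k : ℕ) → Word k → ℕ → ZMod 2
  dec : (n k : ℕ) → Word n → Word k

namespace RatelessCode

/-- The `n`-bit prefix of the encoding of `m`. -/
def encPrefix (C : RatelessCode) {k : ℕ} (n : ℕ) (m : Word k) : Word n :=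
  fun i => C.enc k m i

/-- `G k` is a generator matrix, with rows `G k 0, G k 1, …`, of the code for `k`-bit words. In
particular the code is linear. -/
def IsGeneratedBy (C : RatelessCode) (G : (k : ℕ) → ℕ → Word k) : Prop :=
  ∀ (k : ℕ) (m : Word k) (i : ℕ), C.enc k m i = G k i ⬝ᵥ m

/-- The first `k` bits of the encoding of a `k`-bit word are the word itself. -/
def IsSystematic (C : RatelessCode) : Prop :=
  ∀ (k : ℕ) (m : Word k), C.encPrefix k m = m

/-- Maximum-likelihood decoding: a received word `y` of length `n` is decoded to an information
word whose `n`-bit codeword is closest to `y` in Hamming distance. -/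
def IsMaximumLikelihood (C : RatelessCode) : Prop :=
  ∀ (n k : ℕ) (y : Word n) (m : Word k),
    hammingDist y (C.encPrefix n (C.dec n k y)) ≤ hammingDist y (C.encPrefix n m)

end RatelessCode

/-! ### The binary symmetric channel and the error function -/

/-- The probability of the noise vector `e` over the binary symmetric channel: the coordinates are
independent, and each of them is `1` with probability `p`. -/
def bscProb (p : ℝ) {n : ℕ} (e : Word n) : ℝ :=
  ∏ i, if e i = 1 then p else 1 - p

/-- The error function: the maximum over the `k`-bit words `m` of the probability that `m` is
decoded incorrectly from its noisy `n`-bit codeword. -/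
def RatelessCode.errorProb (C : RatelessCode) (p : ℝ) (k n : ℕ) : ℝ :=
  ⨆ m : Word k, ∑ e : Word n with C.dec n k (C.encPrefix n m + e) ≠ m, bscProb p e

/-- The binary entropy function, in bits. -/
def entropy (p : ℝ) : ℝ :=
  -p * Real.logb 2 p - (1 - p) * Real.logb 2 (1 - p)

/-! ### The greedy construction of the generator matrix -/

section Greedy

variable {k : ℕ}

/-- `W_{i,n}`: the information words whose codeword, under the first `n` rows, has weight `i`. -/
def weightClass (R : ℕ → Word k) (n i : ℕ) : Finset (Word k) :=
  {x | hammingNorm (fun j : Fin n => R j ⬝ᵥ x) = i}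

/-- The words of `S` that are not orthogonal to `r`. -/
def elevated (r : Word k) (S : Finset (Word k)) : Finset (Word k) :=
  {s ∈ S | s ⬝ᵥ r = 1}

/-- `r` `ε`-splits `S`. -/
def Splits (ε : ℝ) (r : Word k) (S : Finset (Word k)) : Prop :=
  (1 / 2 - ε) * (S.card : ℝ) ≤ ((elevated r S).card : ℝ) ∧
    ((elevated r S).card : ℝ) ≤ (1 / 2 + ε) * (S.card : ℝ)

/-- `r` `ε`-elevates `S`. -/
def Elevates (ε : ℝ) (r : Word k) (S : Finset (Word k)) : Prop :=
  ε * (S.card : ℝ) ≤ ((elevated r S).card : ℝ)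

/-- The set of marked words after `t` iterations; iteration `t` (counted from `0`) has `n = k + t`
rows at its disposal and marks every weight class that has less than `2 n ^ 2` unmarked words. -/
def marked (R : ℕ → Word k) : ℕ → Finset (Word k)
  | 0 => ∅
  | t + 1 => marked R t ∪ (Finset.Icc 1 (k + t)).biUnion fun i =>
      if (weightClass R (k + t) i \ marked R t).card < 2 * (k + t) ^ 2
      then weightClass R (k + t) i else ∅

/-- `r` is a suitable next row in iteration `t`, where `n = k + t` rows are present: it
`1 / (2 √n)`-splits the unmarked part of every weight class and `1 / 8`-elevates the class of the
minimum positive weight. -/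
def Suitable (R : ℕ → Word k) (t : ℕ) (r : Word k) : Prop :=
  (∀ i ∈ Finset.Icc 1 (k + t),
    Splits (1 / (2 * √((k + t : ℕ) : ℝ))) r (weightClass R (k + t) i \ marked R (t + 1))) ∧
  ∀ d, IsLeast {d : ℕ | 0 < d ∧ (weightClass R (k + t) d).Nonempty} d →
    Elevates (1 / 8) r (weightClass R (k + t) d)

/-- Strict lexicographic order on words, `0` before `1`. -/
def LexLT (r s : Word k) : Prop :=
  ∃ j, (∀ i < j, r i = s i) ∧ r j = 0 ∧ s j = 1

/-- `R` is the (infinite) matrix computed by the greedy algorithm: the first `k` rows form the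
identity matrix, and each later row is the lexicographically first suitable vector (in particular,
a suitable vector always exists). -/
def IsGreedyMatrix (R : ℕ → Word k) : Prop :=
  (∀ i : Fin k, R i = Pi.single i 1) ∧
  ∀ t, Suitable R t (R (k + t)) ∧ ∀ r, Suitable R t r → r ≠ R (k + t) → LexLT (R (k + t)) r

end Greedy

/-! ### A random access machine with unit-cost operations on `w`-bit words -/

/-- The arithmetic operations of the machine. -/
inductive ArithOp
  | add
  | sub
  | mul
  | div

/-- Natural-number arithmetic; subtraction is truncated at `0` and division rounds down. -/
def ArithOp.eval : ArithOp → ℕ → ℕ → ℕ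
  | add, a, b => a + b
  | sub, a, b => a - b
  | mul, a, b => a * b
  | div, a, b => a / b

/-- Programs. Registers and arrays are named by numerals that are fixed in the program text, so
a program uses finitely many of each; array cells are addressed indirectly, through registers. -/
inductive Program
  /-- `r := v` -/
  | const (r v : ℕ)
  /-- `r := a op b` -/
  | arith (op : ArithOp) (r a b : ℕ)
  /-- `r := A[i]` -/
  | load (r A i : ℕ)
  /-- `A[i] := r` -/
  | store (A i r : ℕ)
  /-- `P; Q` -/
  | seq (P Q : Program)
  /-- `if a < b then P else Q` -/
  | branch (a b : ℕ) (P Q : Program)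
  /-- `while a < b do P` -/
  | loop (a b : ℕ) (P : Program)

/-- The memory of the machine: the contents of the registers and of the cells of the arrays. -/
structure MachineState where
  reg : ℕ → ℕ
  mem : ℕ → ℕ → ℕ

/-- Overwrite register `r`. -/
def MachineState.setReg (s : MachineState) (r v : ℕ) : MachineState :=
  { s with reg := Function.update s.reg r v }

/-- Overwrite the cell with address `i` of array `A`. -/
def MachineState.setMem (s : MachineState) (A i v : ℕ) : MachineState :=
  { s with mem := Function.update s.mem A (Function.update (s.mem A) i v) }

/-- `Run w P s s' t`: on the machine with `w`-bit words, program `P` started in state `s` halts in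
state `s'` after exactly `t` steps. Every elementary operation and every test takes one step. An
operation whose result does not fit into a word blocks the machine. -/
inductive Run (w : ℕ) : Program → MachineState → MachineState → ℕ → Prop
  | const (s : MachineState) (r v : ℕ) (h : v < 2 ^ w) :
      Run w (.const r v) s (s.setReg r v) 1
  | arith (s : MachineState) (op : ArithOp) (r a b : ℕ)
      (h : op.eval (s.reg a) (s.reg b) < 2 ^ w) :
      Run w (.arith op r a b) s (s.setReg r (op.eval (s.reg a) (s.reg b))) 1
  | load (s : MachineState) (r A i : ℕ) :
      Run w (.load r A i) s (s.setReg r (s.mem A (s.reg i))) 1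
  | store (s : MachineState) (A i r : ℕ) :
      Run w (.store A i r) s (s.setMem A (s.reg i) (s.reg r)) 1
  | seq {P Q : Program} {s s' s'' : MachineState} {t t' : ℕ}
      (hP : Run w P s s' t) (hQ : Run w Q s' s'' t') :
      Run w (.seq P Q) s s'' (t + t')
  | branch_true {a b : ℕ} {P Q : Program} {s s' : MachineState} {t : ℕ}
      (h : s.reg a < s.reg b) (hP : Run w P s s' t) :
      Run w (.branch a b P Q) s s' (t + 1)
  | branch_false {a b : ℕ} {P Q : Program} {s s' : MachineState} {t : ℕ}
      (h : ¬ s.reg a < s.reg b) (hQ : Run w Q s s' t) :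
      Run w (.branch a b P Q) s s' (t + 1)
  | loop_true {a b : ℕ} {P : Program} {s s' s'' : MachineState} {t t' : ℕ}
      (h : s.reg a < s.reg b) (hP : Run w P s s' t) (hL : Run w (.loop a b P) s' s'' t') :
      Run w (.loop a b P) s s'' (t + t' + 1)
  | loop_false {a b : ℕ} {P : Program} {s : MachineState} (h : ¬ s.reg a < s.reg b) :
      Run w (.loop a b P) s s 1

/-- The initial state: registers `0` and `1` hold `k` and `n`, array `0` starts with the input
bits, and everything else is `0`. -/
def initialState (k n : ℕ) {l : ℕ} (x : Word l) : MachineState where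
  reg r := if r = 0 then k else if r = 1 then n else 0
  mem A i := if h : A = 0 ∧ i < l then (x ⟨i, h.2⟩).val else 0

/-- On `w`-bit words and parameters `k`, `n`, program `P` maps the input `x` to the output `z`,
written to the beginning of array `1`, within at most `T` steps. -/
def ComputesWithin (P : Program) (w k n : ℕ) {l l' : ℕ} (x : Word l) (z : Word l') (T : ℕ) :
    Prop :=
  ∃ s t, Run w P (initialState k n x) s t ∧ t ≤ T ∧ ∀ i : Fin l', s.mem 1 i = (z i).val

/-- The `n`-bit prefixes of the encodings of `k`-bit words are computed by one program in time
`O(T k n)` on words of `O(k + log n)` bits. -/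
def RatelessCode.EncodesInTime (C : RatelessCode) (T : ℕ → ℕ → ℕ) : Prop :=
  ∃ (P : Program) (c : ℕ), ∀ k n : ℕ, 1 ≤ k → 1 ≤ n → ∀ m : Word k,
    ComputesWithin P (c * (k + Nat.log 2 n + 1)) k n m (C.encPrefix n m) (c * T k n)

/-- Noisy `n`-bit codewords are decoded to `k`-bit words by one program in time `O(T k n)` on words
of `O(k + log n)` bits. -/
def RatelessCode.DecodesInTime (C : RatelessCode) (T : ℕ → ℕ → ℕ) : Prop :=
  ∃ (P : Program) (c : ℕ), ∀ k n : ℕ, 1 ≤ k → 1 ≤ n → ∀ y : Word n,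
    ComputesWithin P (c * (k + Nat.log 2 n + 1)) k n y (C.dec n k y) (c * T k n)

end Rateless

end

/-!
For a uniformly random `r`, the second moment of the difference between the numbers of words of `S`
that are and are not orthogonal to `r` is `#S`. By Chebyshev's inequality few vectors fail to split
an unmarked class, and a union bound gives a suitable row. Splitting makes the unmarked part of the
weight spectrum evolve as for a random code, up to a factor `exp (O(√n))`, and there are only
polynomially many marked words. While all the words of minimum weight are marked, elevation removes
them within `O(log n)` rows, so the minimum distance is of order `n / log n`. In the union bound for
maximum-likelihood decoding the marked words therefore contribute `poly(n) * exp (-c n / log n)`,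
and the unmarked words contribute what they would for a random code.

For the complexity, words are numbered by their binary expansions. The program tabulates all inner
products once, keeps the weight and the mark of every word, and adds each further row in time
`O(2 ^ (2 k))` by trying all candidates in lexicographic order. A word size of `10 (k + log n + 1)`
bits accommodates every intermediate result.
-/

noncomputable section

open Finset

namespace Rateless

/-! ### Splitting and elevating vectors -/

/-- The nontrivial additive character `(-1) ^ z` of the field with two elements. -/
def bitSign : AddChar (ZMod 2) ℤ where
  toFun z := if z = 1 then -1 else 1
  map_zero_eq_one' := by decide
  map_add_eq_mul' := by decide

theorem bitSign_apply (z : ZMod 2) : bitSign z = if z = 1 then -1 else 1 := rfl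

theorem bitSign_eq_one_sub (z : ZMod 2) : bitSign z = 1 - 2 * if z = 1 then 1 else 0 := by
  revert z; decide

theorem sum_bitSign_dotProduct {ι : Type*} [Fintype ι] [DecidableEq ι] {x : ι → ZMod 2}
    (hx : x ≠ 0) : ∑ r, bitSign (x ⬝ᵥ r) = 0 := by
  obtain ⟨i, hi⟩ := Function.ne_iff.mp hx
  have hxi : x i = 1 := Fin.eq_one_of_ne_zero _ hi
  let χ : AddChar (ι → ZMod 2) ℤ :=
    bitSign.compAddMonoidHom (AddMonoidHom.mk' (x ⬝ᵥ ·) (dotProduct_add x))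
  refine AddChar.sum_eq_zero_of_ne_one (ψ := χ) (AddChar.ne_one_iff.mpr ⟨Pi.single i 1, ?_⟩)
  simp [χ, hxi, bitSign_apply]

section Splitting

variable {k : ℕ}

/-- The number of words of `S` orthogonal to `r`, minus the number of those that are not. -/
def imbalance (r : Word k) (S : Finset (Word k)) : ℤ :=
  ∑ s ∈ S, bitSign (s ⬝ᵥ r)

theorem imbalance_eq (r : Word k) (S : Finset (Word k)) :
    imbalance r S = #S - 2 * #(elevated r S) := by
  simp only [imbalance, bitSign_eq_one_sub, sum_sub_distrib, ← mul_sum, elevated, card_filter,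
    sum_const, nsmul_eq_mul, mul_one, Nat.cast_sum, Nat.cast_ite, Nat.cast_one, Nat.cast_zero]

theorem sum_imbalance_sq (S : Finset (Word k)) : ∑ r, imbalance r S ^ 2 = #S * 2 ^ k := by
  have expand (r : Word k) :
      imbalance r S ^ 2 = ∑ s ∈ S, ∑ s' ∈ S, bitSign ((s + s') ⬝ᵥ r) := by
    simp only [imbalance, sq, sum_mul_sum, add_dotProduct, AddChar.map_add_eq_mul]
  have orthogonality {s : Word k} (hs : s ∈ S) :
      ∑ s' ∈ S, ∑ r, bitSign ((s + s') ⬝ᵥ r) = 2 ^ k := by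
    rw [sum_eq_single_of_mem s hs]
    · simp [ZModModule.add_self]
    · exact fun s' _ hne => sum_bitSign_dotProduct fun h =>
        hne (eq_neg_of_add_eq_zero_right h |>.trans (ZModModule.neg_eq_self s))
  calc ∑ r, imbalance r S ^ 2
      = ∑ s ∈ S, ∑ s' ∈ S, ∑ r, bitSign ((s + s') ⬝ᵥ r) := by
        simp only [expand]
        rw [sum_comm]
        exact sum_congr rfl fun s _ => sum_comm
    _ = #S * 2 ^ k := by
        rw [sum_congr rfl fun s hs => orthogonality hs, sum_const, nsmul_eq_mul]

theorem splits_iff_abs_imbalance_le {ε : ℝ} {r : Word k} {S : Finset (Word k)} :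
    Splits ε r S ↔ |(imbalance r S : ℝ)| ≤ 2 * ε * #S := by
  rw [Splits, imbalance_eq, abs_le]
  push_cast
  constructor <;> rintro ⟨lower, upper⟩ <;> constructor <;> linarith

theorem splits_empty (ε : ℝ) (r : Word k) : Splits ε r ∅ := by
  simp [Splits, elevated]

theorem Splits.elevates {r : Word k} {S : Finset (Word k)}
    (h : Splits (3 / 8) r S) : Elevates (1 / 8) r S := by
  rw [Elevates]
  linarith [h.1]

open Classical in
theorem card_not_splits_lt {ε : ℝ} (hε : 0 ≤ ε) (S : Finset (Word k)) :
    (2 * ε) ^ 2 * #S * #{r | ¬ Splits ε r S} < 2 ^ k := by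
  rcases S.eq_empty_or_nonempty with rfl | hS
  · simp
  have hS₀ : (0 : ℝ) < #S := mod_cast hS.card_pos
  have large {r : Word k} (hr : ¬ Splits ε r S) : (2 * ε * #S) ^ 2 < (imbalance r S : ℝ) ^ 2 := by
    rw [splits_iff_abs_imbalance_le, not_le] at hr
    rw [← sq_abs (imbalance r S : ℝ)]
    gcongr
  have moment : ∑ r, (imbalance r S : ℝ) ^ 2 = #S * 2 ^ k := mod_cast sum_imbalance_sq S
  refine lt_of_mul_lt_mul_left ?_ hS₀.le
  calc #S * ((2 * ε) ^ 2 * #S * #{r | ¬ Splits ε r S})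
      = ∑ r with ¬ Splits ε r S, (2 * ε * #S) ^ 2 := by
        rw [sum_const, nsmul_eq_mul]; ring
    _ < #S * 2 ^ k := ?_
  rcases ({r | ¬ Splits ε r S} : Finset (Word k)).eq_empty_or_nonempty with h | h
  · rw [h, sum_empty]
    positivity
  · calc ∑ r with ¬ Splits ε r S, (2 * ε * #S) ^ 2
        < ∑ r with ¬ Splits ε r S, (imbalance r S : ℝ) ^ 2 :=
          sum_lt_sum_of_nonempty h fun r hr => large (mem_filter.mp hr).2
      _ ≤ ∑ r, (imbalance r S : ℝ) ^ 2 := sum_le_univ_sum_of_nonneg fun r => sq_nonneg _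
      _ = #S * 2 ^ k := moment

open Classical in
theorem two_mul_card_dotProduct_ne_one {x : Word k} (hx : x ≠ 0) :
    2 * #{r : Word k | x ⬝ᵥ r ≠ 1} = 2 ^ k := by
  have balanced : ∑ r, bitSign (x ⬝ᵥ r) = 0 := sum_bitSign_dotProduct hx
  simp only [bitSign_eq_one_sub, sum_sub_distrib, ← mul_sum, sum_boole] at balanced
  have total := card_filter_add_card_filter_not (s := univ) (fun r : Word k => x ⬝ᵥ r = 1)
  have card_word : Fintype.card (Word k) = 2 ^ k := by simp
  simp only [sum_const, card_univ, card_word, nsmul_eq_mul, mul_one] at balanced total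
  zify at total ⊢
  push_cast at balanced
  linarith

open Classical in
theorem two_mul_card_not_elevates_le {S : Finset (Word k)} (hS : 0 ∉ S) :
    2 * #{r | ¬ Elevates (1 / 8) r S} ≤ 2 ^ k := by
  rcases S.eq_empty_or_nonempty with rfl | ⟨s, hs⟩
  · simp [Elevates, elevated]
  by_cases hcard : 4 ≤ #S
  · have cheb := card_not_splits_lt (ε := 3 / 8) (by norm_num) S
    have sub : #{r | ¬ Elevates (1 / 8) r S} ≤ #{r | ¬ Splits (3 / 8) r S} :=
      card_le_card <| monotone_filter_right _ fun r _ => mt Splits.elevates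
    have hcard' : (4 : ℝ) ≤ #S := mod_cast hcard
    have : (2 * #{r | ¬ Splits (3 / 8) r S} : ℝ) ≤ 2 ^ k := by
      nlinarith [(#{r | ¬ Splits (3 / 8) r S}).cast_nonneg (α := ℝ)]
    exact (Nat.mul_le_mul_left 2 sub).trans (mod_cast this)
  · -- Elevating a single word already elevates an eighth of fewer than four words.
    have sub : #{r | ¬ Elevates (1 / 8) r S} ≤ #{r : Word k | s ⬝ᵥ r ≠ 1} := by
      refine card_le_card <| monotone_filter_right _ fun r _ hr hsr => hr ?_
      have one_le : (1 : ℝ) ≤ #(elevated r S) :=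
        mod_cast card_pos.mpr ⟨s, mem_filter.mpr ⟨hs, hsr⟩⟩
      have : (#S : ℝ) ≤ 4 := mod_cast (not_le.mp hcard).le
      rw [Elevates]
      linarith
    exact (Nat.mul_le_mul_left 2 sub).trans
      (two_mul_card_dotProduct_ne_one fun h => hS (h ▸ hs)).le

theorem zero_notMem_weightClass {R : ℕ → Word k} {n i : ℕ} (hi : 0 < i) :
    0 ∉ weightClass R n i := by
  simpa [weightClass, hammingNorm] using hi.ne

theorem disjoint_weightClass {R : ℕ → Word k} {n i j : ℕ} (h : i ≠ j) :
    Disjoint (weightClass R n i) (weightClass R n j) :=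
  disjoint_filter.mpr fun _ _ hi hj => h (hi.symm.trans hj)

theorem mem_marked_succ {R : ℕ → Word k} {t i : ℕ} {x : Word k}
    (hx : x ∈ weightClass R (k + t) i) :
    x ∈ marked R (t + 1) ↔ x ∈ marked R t ∨
      i ∈ Icc 1 (k + t) ∧ #(weightClass R (k + t) i \ marked R t) < 2 * (k + t) ^ 2 := by
  rw [marked, mem_union, mem_biUnion]
  refine or_congr_right ⟨?_, fun ⟨hi, h⟩ => ⟨i, hi, by rwa [if_pos h]⟩⟩
  rintro ⟨j, hj, hxj⟩
  split_ifs at hxj with h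
  · obtain rfl : j = i := by
      by_contra hne
      exact disjoint_left.mp (disjoint_weightClass hne) hxj hx
    exact ⟨hj, h⟩
  · exact absurd hxj (notMem_empty x)

theorem weightClass_sdiff_marked_succ (R : ℕ → Word k) (t : ℕ) {i : ℕ} (hi : i ∈ Icc 1 (k + t)) :
    weightClass R (k + t) i \ marked R (t + 1) =
      if #(weightClass R (k + t) i \ marked R t) < 2 * (k + t) ^ 2 then ∅
      else weightClass R (k + t) i \ marked R t := by
  split_ifs with h
  · exact sdiff_eq_empty_iff_subset.mpr fun x hx => (mem_marked_succ hx).mpr (.inr ⟨hi, h⟩)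
  · ext x
    simp only [mem_sdiff]
    refine and_congr_right fun hx => ?_
    rw [mem_marked_succ hx, or_iff_left (fun hc => h hc.2)]

open Classical in
theorem two_mul_card_not_splits_lt (R : ℕ → Word k) {t : ℕ} (hn : 0 < k + t) {i : ℕ}
    (hi : i ∈ Icc 1 (k + t)) :
    (2 * (k + t : ℕ) * #{r | ¬ Splits (1 / (2 * √((k + t : ℕ) : ℝ))) r
      (weightClass R (k + t) i \ marked R (t + 1))} : ℝ) < 2 ^ k := by
  rw [weightClass_sdiff_marked_succ R t hi]
  split_ifs with h
  · simp [splits_empty]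
  set S := weightClass R (k + t) i \ marked R t
  set n := k + t
  have hn' : (0 : ℝ) < n := mod_cast hn
  have eps_sq : (2 * (1 / (2 * √(n : ℝ)))) ^ 2 = 1 / n := by
    rw [show 2 * (1 / (2 * √(n : ℝ))) = 1 / √(n : ℝ) by field_simp, div_pow, one_pow,
      Real.sq_sqrt hn'.le]
  have large : (2 * n : ℝ) ≤ 1 / n * #S := by
    rw [one_div, inv_mul_eq_div, le_div_iff₀ hn', mul_assoc, ← sq]
    exact_mod_cast not_lt.mp h
  have cheb := card_not_splits_lt (ε := 1 / (2 * √(n : ℝ))) (by positivity) S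
  rw [eps_sq] at cheb
  exact (mul_le_mul_of_nonneg_right large (Nat.cast_nonneg _)).trans_lt cheb

open Classical in
theorem exists_exceptional_not_elevates (R : ℕ → Word k) (n : ℕ) :
    ∃ E : Finset (Word k), 2 * #E ≤ 2 ^ k ∧
      ∀ r ∉ E, ∀ d, IsLeast {d : ℕ | 0 < d ∧ (weightClass R n d).Nonempty} d →
        Elevates (1 / 8) r (weightClass R n d) := by
  by_cases h : ∃ d, IsLeast {d : ℕ | 0 < d ∧ (weightClass R n d).Nonempty} d
  · obtain ⟨d, hd⟩ := h
    refine ⟨_, two_mul_card_not_elevates_le (zero_notMem_weightClass (R := R) (n := n) hd.1.1),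
      fun r hr d' hd' => ?_⟩
    rw [hd'.unique hd]
    by_contra hc
    exact hr (mem_filter.mpr ⟨mem_univ r, hc⟩)
  · exact ⟨∅, by simp, fun r _ d hd => absurd ⟨d, hd⟩ h⟩

-- Union bound: fewer than `2 ^ k / (2 n)` vectors fail to split any one of the `n` classes, and at
-- most half of all vectors fail to elevate the class of minimum weight.
theorem exists_suitable (R : ℕ → Word k) (t : ℕ) : ∃ r, Suitable R t r := by
  classical
  by_contra! hno
  set n := k + t
  let F (i : ℕ) : Finset (Word k) :=
    {r | ¬ Splits (1 / (2 * √(n : ℝ))) r (weightClass R n i \ marked R (t + 1))}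
  obtain ⟨E, hE, elevates⟩ := exists_exceptional_not_elevates R n
  have cover : univ ⊆ E ∪ (Icc 1 n).biUnion F := by
    intro r _
    by_contra hr
    rw [mem_union, not_or, mem_biUnion] at hr
    refine hno r ⟨fun i hi => ?_, elevates r hr.1⟩
    by_contra hc
    exact hr.2 ⟨i, hi, mem_filter.mpr ⟨mem_univ r, hc⟩⟩
  have card_le : 2 ^ k ≤ #E + ∑ i ∈ Icc 1 n, #(F i) := by
    simpa using (card_le_card cover).trans
      ((card_union_le _ _).trans (Nat.add_le_add_left card_biUnion_le _))
  have card_le' : (2 ^ k : ℝ) ≤ #E + ∑ i ∈ Icc 1 n, (#(F i) : ℝ) := mod_cast card_le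
  have hE' : (2 * #E : ℝ) ≤ 2 ^ k := mod_cast hE
  rcases n.eq_zero_or_pos with h0 | hpos
  · have : (0 : ℝ) < 2 ^ k := by positivity
    rw [h0, Icc_eq_empty (by norm_num), sum_empty] at card_le'
    linarith
  · have sum_lt : ∑ i ∈ Icc 1 n, (2 * n * #(F i) : ℝ) < ∑ _i ∈ Icc 1 n, 2 ^ k :=
      sum_lt_sum_of_nonempty (nonempty_Icc.mpr hpos) fun i hi =>
        two_mul_card_not_splits_lt R hpos hi
    rw [← mul_sum, sum_const, Nat.card_Icc, nsmul_eq_mul, Nat.add_sub_cancel] at sum_lt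
    have hpos' : (0 : ℝ) < n := mod_cast hpos
    nlinarith [hpos']

end Splitting

/-! ### The greedy matrix -/

section Numerals

variable {k : ℕ}

/-- The binary expansion of `x` as a word of length `k`. The most significant bit comes first, so
that the lexicographic order of words is the order of the numbers that they represent. -/
def toWord (k x : ℕ) : Word k := fun j => ((x / 2 ^ (k - 1 - (j : ℕ)) : ℕ) : ZMod 2)

theorem toWord_apply_eq_one {x : ℕ} {j : Fin k} :
    toWord k x j = 1 ↔ x.testBit (k - 1 - j) = true := by
  rw [toWord, Nat.testBit_eq_decide_div_mod_eq, decide_eq_true_eq, ZMod.natCast_eq_one_iff_odd,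
    Nat.odd_iff]

theorem toWord_apply_eq_zero {x : ℕ} {j : Fin k} :
    toWord k x j = 0 ↔ x.testBit (k - 1 - j) = false := by
  rw [toWord, Nat.testBit_eq_decide_div_mod_eq, decide_eq_false_iff_not, ZMod.natCast_eq_zero_iff,
    Nat.dvd_iff_mod_eq_zero, Nat.mod_two_not_eq_one]

theorem toWord_apply_val (x : ℕ) (j : Fin k) :
    (toWord k x j).val = x / 2 ^ (k - 1 - (j : ℕ)) % 2 :=
  ZMod.val_natCast 2 _

theorem testBit_eq_of_toWord_apply_eq {a b i : ℕ} (ha : a < 2 ^ k) (hb : b < 2 ^ k)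
    (h : ∀ j : Fin k, k - 1 - j = i → toWord k a j = toWord k b j) :
    a.testBit i = b.testBit i := by
  by_cases hi : i < k
  · have hj := h ⟨k - 1 - i, by omega⟩ (by dsimp only; omega)
    rw [← show k - 1 - (k - 1 - i) = i by omega]
    exact Bool.eq_iff_iff.mpr (toWord_apply_eq_one.symm.trans
      ((Eq.congr_left hj).trans toWord_apply_eq_one))
  · have hpow : 2 ^ k ≤ 2 ^ i := Nat.pow_le_pow_right two_pos (not_lt.mp hi)
    rw [Nat.testBit_eq_false_of_lt (ha.trans_le hpow),
      Nat.testBit_eq_false_of_lt (hb.trans_le hpow)]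

theorem injOn_toWord (k : ℕ) : Set.InjOn (toWord k) (Set.Iio (2 ^ k)) := fun _ ha _ hb h =>
  Nat.eq_of_testBit_eq fun _ => testBit_eq_of_toWord_apply_eq ha hb fun j _ => congrFun h j

theorem lt_of_lexLT_toWord {a b : ℕ} (ha : a < 2 ^ k) (hb : b < 2 ^ k)
    (h : LexLT (toWord k a) (toWord k b)) : a < b := by
  obtain ⟨j, agree, zero, one⟩ := h
  refine Nat.lt_of_testBit (k - 1 - j) (toWord_apply_eq_zero.mp zero) (toWord_apply_eq_one.mp one)
    fun i hi => testBit_eq_of_toWord_apply_eq ha hb fun j' hj' => agree j' ?_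
  rw [Fin.lt_def]
  omega

theorem lexLT_or_lexLT {r s : Word k} (h : r ≠ s) : LexLT r s ∨ LexLT s r := by
  obtain ⟨j, hj, hmin⟩ :=
    WellFounded.has_min (wellFounded_lt (α := Fin k)) {i | r i ≠ s i} (Function.ne_iff.mp h)
  have agree (i) (hi : i < j) : r i = s i := by_contra fun hne => hmin i hne hi
  have bits : ∀ a b : ZMod 2, a ≠ b → (a = 0 ∧ b = 1) ∨ (b = 0 ∧ a = 1) := by decide
  exact (bits _ _ hj).imp (fun hab => ⟨j, agree, hab⟩)
    fun hba => ⟨j, fun i hi => (agree i hi).symm, hba⟩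

/-- The numbering of the words of length `k` by the numbers below `2 ^ k`. -/
def wordEquiv (k : ℕ) : Fin (2 ^ k) ≃ Word k :=
  Equiv.ofBijective (fun x => toWord k x) <|
    (Fintype.bijective_iff_injective_and_card _).mpr
      ⟨fun a b h => Fin.ext (injOn_toWord k a.2 b.2 h), by simp⟩

theorem exists_toWord (r : Word k) : ∃ x < 2 ^ k, toWord k x = r :=
  ⟨(wordEquiv k).symm r, ((wordEquiv k).symm r).2, (wordEquiv k).apply_symm_apply r⟩

theorem card_eq_sum_toWord (S : Finset (Word k)) :
    #S = ∑ x ∈ range (2 ^ k), if toWord k x ∈ S then 1 else 0 := by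
  rw [sum_range, ← filter_univ_mem S, card_filter, ← Equiv.sum_comp (wordEquiv k)]
  simp only [wordEquiv, Equiv.ofBijective_apply, mem_filter, mem_univ, true_and]

theorem toWord_eq_zero_iff {x : ℕ} (hx : x < 2 ^ k) : toWord k x = 0 ↔ x = 0 := by
  have toWord_zero : toWord k 0 = 0 := funext fun j => by simp [toWord]
  rw [← toWord_zero]
  exact (injOn_toWord k).eq_iff hx (Nat.two_pow_pos k)

theorem toWord_two_pow {i : ℕ} (hi : i < k) :
    toWord k (2 ^ (k - 1 - i)) = Pi.single ⟨i, hi⟩ 1 := by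
  funext j
  by_cases h : j = ⟨i, hi⟩
  · subst h
    rw [Pi.single_eq_same, toWord_apply_eq_one, Nat.testBit_two_pow_self]
  · have hne : (j : ℕ) ≠ i := fun hc => h (Fin.ext hc)
    rw [Pi.single_eq_of_ne h, toWord_apply_eq_zero, Nat.testBit_two_pow_of_ne (by omega)]

/-- The number of common ones of the `k`-bit binary expansions of `a` and `b`; its parity is the
inner product of the corresponding words. -/
def bitDot (k a b : ℕ) : ℕ := ∑ i ∈ range k, (a / 2 ^ i % 2) * (b / 2 ^ i % 2)

theorem bitDot_succ (m a b : ℕ) :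
    bitDot (m + 1) a b = bitDot m a b + (a / 2 ^ m % 2) * (b / 2 ^ m % 2) :=
  sum_range_succ _ _

theorem bitDot_le (m a b : ℕ) : bitDot m a b ≤ m := by
  have bit_le (i : ℕ) : (a / 2 ^ i % 2) * (b / 2 ^ i % 2) ≤ 1 :=
    Nat.mul_le_mul (Nat.le_of_lt_succ (Nat.mod_lt _ two_pos))
      (Nat.le_of_lt_succ (Nat.mod_lt _ two_pos))
  simpa [bitDot] using sum_le_card_nsmul (range m) _ 1 fun i _ => bit_le i

theorem toWord_dotProduct (k a b : ℕ) : toWord k a ⬝ᵥ toWord k b = bitDot k a b := by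
  rw [bitDot, Nat.cast_sum, ← sum_range_reflect, sum_range, dotProduct]
  refine sum_congr rfl fun j _ => ?_
  rw [Nat.cast_mul, ZMod.natCast_mod, ZMod.natCast_mod]
  rfl

theorem toWord_dotProduct_val (k a b : ℕ) :
    (toWord k a ⬝ᵥ toWord k b).val = bitDot k a b % 2 := by
  rw [toWord_dotProduct, ZMod.val_natCast]

theorem toWord_dotProduct_eq_one {a b : ℕ} :
    toWord k a ⬝ᵥ toWord k b = 1 ↔ bitDot k a b % 2 = 1 := by
  rw [toWord_dotProduct, ZMod.natCast_eq_one_iff_odd, Nat.odd_iff]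

end Numerals

section GreedyMatrix

variable {k t : ℕ} {R R' : ℕ → Word k}

theorem weightClass_congr {n : ℕ} (h : ∀ j < n, R j = R' j) (i : ℕ) :
    weightClass R n i = weightClass R' n i := by
  have codeword_eq (x : Word k) : (fun j : Fin n => R j ⬝ᵥ x) = fun j : Fin n => R' j ⬝ᵥ x :=
    funext fun j => by rw [h j j.2]
  simp only [weightClass, codeword_eq]

theorem marked_congr (h : ∀ j < k + t, R j = R' j) : marked R (t + 1) = marked R' (t + 1) := by
  have step {t : ℕ} (h : ∀ j < k + t, R j = R' j) (prev : marked R t = marked R' t) :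
      marked R (t + 1) = marked R' (t + 1) :=
    congrArg₂ (· ∪ ·) prev (biUnion_congr rfl fun i _ => by rw [prev, weightClass_congr h])
  induction t with
  | zero => exact step h rfl
  | succ t ih => exact step h (ih fun j hj => h j (by omega))

theorem suitable_congr (h : ∀ j < k + t, R j = R' j) (r : Word k) :
    Suitable R t r ↔ Suitable R' t r := by
  simp only [Suitable, weightClass_congr h, marked_congr h]

theorem exists_suitable_toWord (R : ℕ → Word k) (t : ℕ) :
    ∃ x < 2 ^ k, Suitable R t (toWord k x) := by
  obtain ⟨r, hr⟩ := exists_suitable R t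
  obtain ⟨x, hx, rfl⟩ := exists_toWord r
  exact ⟨x, hx, hr⟩

open Classical in
/-- The number of the lexicographically first suitable vector. -/
def nextIndex (R : ℕ → Word k) (t : ℕ) : ℕ := Nat.find (exists_suitable_toWord R t)

theorem nextIndex_lt (R : ℕ → Word k) (t : ℕ) : nextIndex R t < 2 ^ k := by
  classical exact (Nat.find_spec (exists_suitable_toWord R t)).1

theorem suitable_nextIndex (R : ℕ → Word k) (t : ℕ) : Suitable R t (toWord k (nextIndex R t)) := by
  classical exact (Nat.find_spec (exists_suitable_toWord R t)).2

theorem nextIndex_le {x : ℕ} (hx : x < 2 ^ k) (h : Suitable R t (toWord k x)) :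
    nextIndex R t ≤ x := by
  classical exact Nat.find_min' (exists_suitable_toWord R t) ⟨hx, h⟩

theorem nextIndex_congr (h : ∀ j < k + t, R j = R' j) : nextIndex R t = nextIndex R' t :=
  le_antisymm
    (nextIndex_le (nextIndex_lt R' t) ((suitable_congr h _).mpr (suitable_nextIndex R' t)))
    (nextIndex_le (nextIndex_lt R t) ((suitable_congr h _).mp (suitable_nextIndex R t)))

/-- The rows of the greedy matrix. Suitability of row `j` depends only on the rows above it, so the
recursion may feed zeros for the others. -/
def greedyMatrix (k j : ℕ) : Word k :=
  if h : j < k then Pi.single ⟨j, h⟩ 1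
  else toWord k (nextIndex (fun i => if _h : i < j then greedyMatrix k i else 0) (j - k))

theorem greedyMatrix_of_lt {j : ℕ} (h : j < k) : greedyMatrix k j = Pi.single ⟨j, h⟩ 1 := by
  rw [greedyMatrix, dif_pos h]

theorem greedyMatrix_add (k t : ℕ) :
    greedyMatrix k (k + t) = toWord k (nextIndex (greedyMatrix k) t) := by
  rw [greedyMatrix, dif_neg (by omega), Nat.add_sub_cancel_left]
  exact congrArg (toWord k) (nextIndex_congr fun j hj => dif_pos hj)

theorem isGreedyMatrix_greedyMatrix (k : ℕ) : IsGreedyMatrix (greedyMatrix k) := by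
  refine ⟨fun i => greedyMatrix_of_lt i.2, fun t => ?_⟩
  rw [greedyMatrix_add]
  refine ⟨suitable_nextIndex _ t, fun r hr hne => ?_⟩
  obtain ⟨x, hx, rfl⟩ := exists_toWord r
  refine (lexLT_or_lexLT hne).resolve_left fun hlt => ?_
  exact (lt_of_lexLT_toWord hx (nextIndex_lt _ t) hlt).not_ge (nextIndex_le hx hr)

end GreedyMatrix

/-! ### The weight spectrum of the greedy code -/

/-- The prefix of length `n` of the encoding of `x` under the generator matrix with rows `R`. -/
def codeword {k : ℕ} (R : ℕ → Word k) (n : ℕ) (x : Word k) : Word n := fun j => R j ⬝ᵥ x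

theorem card_hammingNorm_eq (n i : ℕ) : #{c : Word n | hammingNorm c = i} = n.choose i := by
  have eq_one_of_ne_zero (z : ZMod 2) : z ≠ 0 → 1 = z := by decide +revert
  have card_eq : #(powersetCard i (univ : Finset (Fin n))) = n.choose i := by
    rw [card_powersetCard, card_univ, Fintype.card_fin]
  rw [← card_eq]
  refine card_nbij' (fun c => univ.filter fun j => c j ≠ 0)
    (fun s j => if j ∈ s then 1 else 0) ?_ ?_ ?_ ?_
  · intro c hc
    simpa [hammingNorm] using hc
  · intro s hs
    simpa [hammingNorm] using hs
  · intro c _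
    funext j
    by_cases h : c j = 0
    · simp [h]
    · simpa [h] using eq_one_of_ne_zero _ h
  · intro s _
    simp

section Spectrum

variable {k n t i j : ℕ} {R : ℕ → Word k} {x : Word k}

theorem mem_weightClass : x ∈ weightClass R n i ↔ hammingNorm (codeword R n x) = i :=
  mem_filter_univ x

theorem mem_elevated {r : Word k} {S : Finset (Word k)} :
    x ∈ elevated r S ↔ x ∈ S ∧ r ⬝ᵥ x = 1 := by
  rw [elevated, mem_filter, dotProduct_comm]

theorem elevated_empty (r : Word k) : elevated r ∅ = ∅ := filter_empty _

theorem hammingNorm_codeword_succ (R : ℕ → Word k) (n : ℕ) (x : Word k) :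
    hammingNorm (codeword R (n + 1) x) =
      hammingNorm (codeword R n x) + if R n ⬝ᵥ x = 1 then 1 else 0 := by
  have ne_zero_iff (z : ZMod 2) : z ≠ 0 ↔ z = 1 := by decide +revert
  simp only [hammingNorm, card_filter, Fin.sum_univ_castSucc, codeword, ne_zero_iff,
    Fin.val_castSucc, Fin.val_last]

theorem hammingNorm_codeword_mono (R : ℕ → Word k) (x : Word k) :
    Monotone fun n => hammingNorm (codeword R n x) :=
  monotone_nat_of_le_succ fun n => by
    rw [hammingNorm_codeword_succ]
    exact Nat.le_add_right _ _

theorem codeword_self (hR : IsGreedyMatrix R) (x : Word k) : codeword R k x = x :=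
  funext fun j => by rw [codeword, hR.1 j, single_dotProduct, one_mul]

theorem hammingNorm_codeword_pos (hR : IsGreedyMatrix R) (hx : x ≠ 0) (hn : k ≤ n) :
    0 < hammingNorm (codeword R n x) := by
  have pos : 0 < hammingNorm (codeword R k x) := by rwa [codeword_self hR, hammingNorm_pos_iff]
  exact pos.trans_le (hammingNorm_codeword_mono R x hn)

theorem elevated_weightClass_of_lt (hmin : ∀ x ≠ 0, i < hammingNorm (codeword R n x))
    (r : Word k) : elevated r (weightClass R n i) = ∅ := by
  refine eq_empty_of_forall_notMem fun x hx => ?_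
  obtain ⟨hx, hrx⟩ := mem_elevated.mp hx
  have hx0 : x ≠ 0 := fun h => by simp [h] at hrx
  exact (hmin x hx0).ne' (mem_weightClass.mp hx)

theorem weightClass_of_lt (R : ℕ → Word k) (h : n < i) : weightClass R n i = ∅ := by
  refine eq_empty_of_forall_notMem fun x hx => ?_
  have weight_le := hammingNorm_le_card_fintype (x := codeword R n x)
  rw [mem_weightClass.mp hx, Fintype.card_fin] at weight_le
  omega

-- A word of weight `i + 1` either keeps its weight or was elevated from weight `i`.
theorem card_weightClass_succ_sdiff_le (R : ℕ → Word k) (n i : ℕ) (M : Finset (Word k)) :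
    #(weightClass R (n + 1) (i + 1) \ M) + #(elevated (R n) (weightClass R n (i + 1) \ M)) ≤
      #(weightClass R n (i + 1) \ M) + #(elevated (R n) (weightClass R n i \ M)) := by
  have hsub : weightClass R (n + 1) (i + 1) \ M ⊆
      ((weightClass R n (i + 1) \ M) \ elevated (R n) (weightClass R n (i + 1) \ M)) ∪
        elevated (R n) (weightClass R n i \ M) := by
    intro x hx
    rw [mem_sdiff, mem_weightClass, hammingNorm_codeword_succ] at hx
    simp only [mem_union, mem_sdiff, mem_elevated, mem_weightClass]
    split_ifs at hx with h
    · exact Or.inr ⟨⟨by omega, hx.2⟩, h⟩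
    · exact Or.inl ⟨hx, fun hc => h hc.2⟩
  have hle := (card_le_card hsub).trans (card_union_le _ _)
  have helevated : elevated (R n) (weightClass R n (i + 1) \ M) ⊆ weightClass R n (i + 1) \ M :=
    filter_subset _ _
  have hcard := card_le_card helevated
  rw [card_sdiff_of_subset helevated] at hle
  omega

theorem splits_unmarked (hR : IsGreedyMatrix R) (t : ℕ) (hi : 0 < i) :
    Splits (1 / (2 * √((k + t : ℕ) : ℝ))) (R (k + t))
      (weightClass R (k + t) i \ marked R (t + 1)) := by
  rcases le_or_gt i (k + t) with hle | hlt
  · exact (hR.2 t).1.1 i (mem_Icc.mpr ⟨hi, hle⟩)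
  · rw [weightClass_of_lt R hlt, empty_sdiff]
    exact splits_empty _ _

theorem card_unmarked_succ_le (hR : IsGreedyMatrix R) {b b' : ℝ} (hb' : 0 ≤ b')
    (h : #(weightClass R (k + t) (i + 1) \ marked R t) ≤ b)
    (h' : 0 < i → #(weightClass R (k + t) i \ marked R t) ≤ b') :
    #(weightClass R (k + (t + 1)) (i + 1) \ marked R (t + 1)) ≤
      (1 + 1 / √((k + t : ℕ) : ℝ)) / 2 * (b + b') := by
  have card_le (i : ℕ) : (#(weightClass R (k + t) i \ marked R (t + 1)) : ℝ) ≤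
      #(weightClass R (k + t) i \ marked R t) :=
    mod_cast card_le_card (sdiff_subset_sdiff le_rfl subset_union_left)
  have step := card_weightClass_succ_sdiff_le R (k + t) i (marked R (t + 1))
  rify at step
  have half_eq : 1 / (2 * √((k + t : ℕ) : ℝ)) = 1 / √((k + t : ℕ) : ℝ) / 2 := by ring
  set ε := 1 / √((k + t : ℕ) : ℝ)
  have hε : 0 ≤ (1 + ε) / 2 := by positivity
  have stay := (splits_unmarked hR t i.succ_pos).1
  have stay_le := mul_le_mul_of_nonneg_left ((card_le _).trans h) hε
  have rise_le : (#(elevated (R (k + t)) (weightClass R (k + t) i \ marked R (t + 1))) : ℝ) ≤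
      (1 + ε) / 2 * b' := by
    rcases Nat.eq_zero_or_pos i with rfl | hi
    · have subset : elevated (R (k + t)) (weightClass R (k + t) 0 \ marked R (t + 1)) ⊆ ∅ := by
        rw [← elevated_weightClass_of_lt
          (fun x hx => hammingNorm_codeword_pos hR hx (k.le_add_right t)) (R (k + t))]
        exact filter_subset_filter _ sdiff_subset
      rw [subset_empty.mp subset, card_empty, Nat.cast_zero]
      positivity
    · have rise := (splits_unmarked hR t hi).2
      have rise_le := mul_le_mul_of_nonneg_left ((card_le i).trans (h' hi)) hε
      rw [half_eq] at rise
      linarith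
  rw [half_eq] at stay
  rw [← Nat.add_assoc]
  linarith

theorem one_add_inv_sqrt_mul_exp_le {n : ℕ} (hn : 0 < n) :
    (1 + 1 / √(n : ℝ)) * Real.exp (3 * √(n : ℝ)) ≤ Real.exp (3 * √((n + 1 : ℕ) : ℝ)) := by
  have hn1 : (1 : ℝ) ≤ n := mod_cast hn
  have hpos : 0 < √(n : ℝ) := by positivity
  have hsq : √(n : ℝ) ^ 2 = n := Real.sq_sqrt (by positivity)
  have hsq_succ : √((n + 1 : ℕ) : ℝ) ^ 2 = n + 1 := by
    rw [Real.sq_sqrt (by positivity), Nat.cast_succ]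
  have succ_le : √((n + 1 : ℕ) : ℝ) ≤ 2 * √(n : ℝ) :=
    abs_le_of_sq_le_sq' (by rw [mul_pow, hsq, hsq_succ]; linarith) (by positivity) |>.2
  have le_succ : √(n : ℝ) ≤ √((n + 1 : ℕ) : ℝ) :=
    Real.sqrt_le_sqrt (mod_cast n.le_succ)
  have exponent_le : 1 / √(n : ℝ) + 3 * √(n : ℝ) ≤ 3 * √((n + 1 : ℕ) : ℝ) := by
    rw [← le_sub_iff_add_le, div_le_iff₀ hpos]
    nlinarith
  calc (1 + 1 / √(n : ℝ)) * Real.exp (3 * √(n : ℝ))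
      ≤ Real.exp (1 / √(n : ℝ)) * Real.exp (3 * √(n : ℝ)) := by
        rw [add_comm]
        exact mul_le_mul_of_nonneg_right (Real.add_one_le_exp _) (Real.exp_pos _).le
    _ ≤ Real.exp (3 * √((n + 1 : ℕ) : ℝ)) := by
        rw [← Real.exp_add]
        exact Real.exp_le_exp.mpr exponent_le

-- `n.choose i / 2 ^ t` is the expected size of the class if the last `t` rows are random.
theorem card_unmarked_le (hR : IsGreedyMatrix R) (hk : 0 < k) (t : ℕ) (hi : 0 < i) :
    #(weightClass R (k + t) i \ marked R t) ≤
      Real.exp (3 * √((k + t : ℕ) : ℝ)) * ((k + t).choose i / 2 ^ t) := by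
  induction t generalizing i with
  | zero =>
    have card_eq : #(weightClass R (k + 0) i \ marked R 0) = k.choose i := by
      rw [marked, sdiff_empty, add_zero, ← card_hammingNorm_eq]
      congr 1
      ext x
      rw [mem_weightClass, codeword_self hR, mem_filter_univ]
    rw [card_eq, add_zero, pow_zero, div_one]
    exact le_mul_of_one_le_left (by positivity) (Real.one_le_exp (by positivity))
  | succ t ih =>
    obtain ⟨i, rfl⟩ := Nat.exists_eq_add_of_lt hi
    rw [zero_add] at *
    refine (card_unmarked_succ_le hR (by positivity) (ih hi) ih).trans ?_
    refine Eq.trans_le ?_ (mul_le_mul_of_nonneg_right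
      (one_add_inv_sqrt_mul_exp_le (n := k + t) (by omega)) (by positivity))
    rw [← Nat.add_assoc, Nat.choose_succ_succ', Nat.cast_add (Nat.choose _ _), pow_succ]
    ring

theorem card_marked_le (R : ℕ → Word k) (t : ℕ) : #(marked R t) ≤ 2 * (k + t) ^ 4 := by
  induction t with
  | zero => simp [marked]
  | succ t ih =>
    set n := k + t
    have subset : marked R (t + 1) ⊆ marked R t ∪ (Icc 1 n).biUnion fun i =>
        if #(weightClass R n i \ marked R t) < 2 * n ^ 2
        then weightClass R n i \ marked R t else ∅ := by
      intro x hx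
      rw [marked, mem_union, mem_biUnion] at hx
      rw [mem_union, mem_biUnion]
      refine or_iff_not_imp_left.mpr fun hm => ?_
      obtain ⟨i, hi, hxi⟩ := hx.resolve_left hm
      refine ⟨i, hi, ?_⟩
      split_ifs at hxi ⊢
      · exact mem_sdiff.mpr ⟨hxi, hm⟩
      · exact hxi
    have card_new_le := card_biUnion_le_card_mul (Icc 1 n)
      (fun i => if #(weightClass R n i \ marked R t) < 2 * n ^ 2
        then weightClass R n i \ marked R t else ∅) (2 * n ^ 2) fun i _ => by
          split_ifs with h
          · exact h.le
          · simp
    calc #(marked R (t + 1)) ≤ 2 * n ^ 4 + #(Icc 1 n) * (2 * n ^ 2) :=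
          (card_le_card subset).trans ((card_union_le _ _).trans (by omega))
      _ ≤ 2 * (n + 1) ^ 4 := by
          rw [Nat.card_Icc, Nat.add_sub_cancel]
          ring_nf
          nlinarith

theorem card_weightClass_min_succ_le (hR : IsGreedyMatrix R)
    (hmin : ∀ x ≠ 0, i < hammingNorm (codeword R (k + t) x)) :
    (#(weightClass R (k + (t + 1)) (i + 1)) : ℝ) ≤ 7 / 8 * #(weightClass R (k + t) (i + 1)) := by
  have step := card_weightClass_succ_sdiff_le R (k + t) i ∅
  simp only [sdiff_empty, elevated_weightClass_of_lt hmin, card_empty, add_zero] at step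
  rify at step
  have elevates : Elevates (1 / 8) (R (k + t)) (weightClass R (k + t) (i + 1)) := by
    rcases (weightClass R (k + t) (i + 1)).eq_empty_or_nonempty with hempty | hne
    · simp [hempty, Elevates, elevated_empty]
    · refine (hR.2 t).1.2 (i + 1) ⟨⟨i.succ_pos, hne⟩, fun d ⟨hd, x, hx⟩ => ?_⟩
      rw [mem_weightClass] at hx
      have hx0 : x ≠ 0 := fun h => by simp [h, codeword, ← hx, hammingNorm] at hd
      exact hx ▸ hmin x hx0
  rw [Elevates] at elevates
  rw [← Nat.add_assoc]
  linarith

theorem card_weightClass_min_add_le (hR : IsGreedyMatrix R)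
    (hmin : ∀ x ≠ 0, i < hammingNorm (codeword R (k + t) x)) (L : ℕ) :
    (#(weightClass R (k + (t + L)) (i + 1)) : ℝ) ≤
      (7 / 8) ^ L * #(weightClass R (k + t) (i + 1)) := by
  induction L with
  | zero => simp
  | succ L ih =>
    have hmin' (x : Word k) (hx : x ≠ 0) : i < hammingNorm (codeword R (k + (t + L)) x) :=
      (hmin x hx).trans_le (hammingNorm_codeword_mono R x (by omega))
    have step := card_weightClass_min_succ_le hR hmin'
    rw [← Nat.add_assoc t, pow_succ]
    linarith

theorem min_weight_add_of_subset_marked (hR : IsGreedyMatrix R) {L : ℕ}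
    (hmin : ∀ x ≠ 0, i < hammingNorm (codeword R (k + t) x))
    (hmarked : weightClass R (k + t) (i + 1) ⊆ marked R t)
    (hL : (7 / 8 : ℝ) ^ L * (2 * ((k + t : ℕ) : ℝ) ^ 4) < 1) (hx : x ≠ 0) :
    i + 1 < hammingNorm (codeword R (k + (t + L)) x) := by
  refine lt_of_le_of_ne ((hmin x hx).trans_le (hammingNorm_codeword_mono R x (by omega)))
    fun hweight => ?_
  have card_le : (#(weightClass R (k + t) (i + 1)) : ℝ) ≤ 2 * ((k + t : ℕ) : ℝ) ^ 4 :=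
    mod_cast (card_le_card hmarked).trans (card_marked_le R t)
  have card_lt_one : (#(weightClass R (k + (t + L)) (i + 1)) : ℝ) < 1 :=
    (card_weightClass_min_add_le hR hmin L).trans_lt
      ((mul_le_mul_of_nonneg_left card_le (by positivity)).trans_lt hL)
  have card_pos : 0 < #(weightClass R (k + (t + L)) (i + 1)) :=
    card_pos.mpr ⟨x, mem_weightClass.mpr hweight.symm⟩
  exact absurd card_lt_one (not_lt.mpr (mod_cast card_pos))

theorem lt_min_weight (hR : IsGreedyMatrix R) {L J N : ℕ}
    (hmarked : ∀ j < J, weightClass R (k + (t + j * L)) (j + 1) ⊆ marked R (t + j * L))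
    (hN : k + (t + J * L) ≤ N) (hL : (7 / 8 : ℝ) ^ L * (2 * (N : ℝ) ^ 4) < 1) (hx : x ≠ 0) :
    J < hammingNorm (codeword R N x) := by
  have lt_weight (j : ℕ) (hj : j ≤ J) :
      ∀ x ≠ 0, j < hammingNorm (codeword R (k + (t + j * L)) x) := by
    induction j with
    | zero => exact fun x hx => hammingNorm_codeword_pos hR hx (by omega)
    | succ j ih =>
      have step_le : (j + 1) * L ≤ J * L := Nat.mul_le_mul_right L hj
      rw [add_one_mul] at step_le
      have hN' : ((k + (t + j * L) : ℕ) : ℝ) ≤ N := mod_cast (by omega)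
      have hL' : (7 / 8 : ℝ) ^ L * (2 * ((k + (t + j * L) : ℕ) : ℝ) ^ 4) < 1 :=
        lt_of_le_of_lt (by gcongr) hL
      intro x hx
      rw [add_one_mul, ← add_assoc t]
      exact min_weight_add_of_subset_marked hR (ih (by omega)) (hmarked j hj) hL' hx
  exact (lt_weight J le_rfl x hx).trans_le (hammingNorm_codeword_mono R x hN)

end Spectrum

/-! ### The binary symmetric channel -/

/-- The probability that the noise vector of the binary symmetric channel lies in `S`. -/
def bscPr (p : ℝ) {n : ℕ} (S : Finset (Word n)) : ℝ := ∑ e ∈ S, bscProb p e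

section Channel

variable {p : ℝ} {n : ℕ}

theorem bscProb_pos (hp : 0 < p) (hp1 : p < 1) (e : Word n) : 0 < bscProb p e :=
  prod_pos fun i _ => by split_ifs <;> linarith

theorem bscPr_nonneg (hp : 0 < p) (hp1 : p < 1) (S : Finset (Word n)) : 0 ≤ bscPr p S :=
  sum_nonneg fun e _ => (bscProb_pos hp hp1 e).le

theorem bscPr_mono (hp : 0 < p) (hp1 : p < 1) {S T : Finset (Word n)} (h : S ⊆ T) :
    bscPr p S ≤ bscPr p T :=
  sum_le_sum_of_subset_of_nonneg h fun e _ _ => (bscProb_pos hp hp1 e).le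

theorem bscPr_union_le (hp : 0 < p) (hp1 : p < 1) (S T : Finset (Word n)) :
    bscPr p (S ∪ T) ≤ bscPr p S + bscPr p T := by
  rw [bscPr, bscPr, bscPr, ← sum_union_inter]
  exact le_add_of_nonneg_right (bscPr_nonneg hp hp1 _)

theorem bscPr_biUnion_le {ι : Type*} (hp : 0 < p) (hp1 : p < 1) (I : Finset ι)
    (S : ι → Finset (Word n)) : bscPr p (I.biUnion S) ≤ ∑ i ∈ I, bscPr p (S i) := by
  classical
  induction I using Finset.induction_on with
  | empty => simp [bscPr]
  | insert i I hi ih =>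
    rw [biUnion_insert, sum_insert hi]
    exact (bscPr_union_le hp hp1 _ _).trans (add_le_add_right ih _)

theorem sum_bscProb_mul_prod (p : ℝ) (g : Fin n → ZMod 2 → ℝ) :
    ∑ e : Word n, bscProb p e * ∏ i, g i (e i) = ∏ i, ((1 - p) * g i 0 + p * g i 1) := by
  have factor (i : Fin n) : (1 - p) * g i 0 + p * g i 1 =
      ∑ z : ZMod 2, (if z = 1 then p else 1 - p) * g i z := by
    rw [show (univ : Finset (ZMod 2)) = {0, 1} from rfl, sum_pair zero_ne_one,
      if_neg zero_ne_one, if_pos rfl]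
  simp only [bscProb, ← prod_mul_distrib, factor, prod_univ_sum, Fintype.piFinset_univ]

theorem bscPr_univ (p : ℝ) (n : ℕ) : bscPr p (univ : Finset (Word n)) = 1 := by
  simpa [bscPr] using sum_bscProb_mul_prod p fun (_ : Fin n) _ => 1

theorem bscPr_le_sum_mul (hp : 0 < p) (hp1 : p < 1) {S : Finset (Word n)} {f : Word n → ℝ}
    (hf : ∀ e, 0 ≤ f e) (hS : ∀ e ∈ S, 1 ≤ f e) : bscPr p S ≤ ∑ e : Word n, bscProb p e * f e :=
  calc bscPr p S ≤ ∑ e ∈ S, bscProb p e * f e :=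
        sum_le_sum fun e he => le_mul_of_one_le_right (bscProb_pos hp hp1 e).le (hS e he)
    _ ≤ ∑ e : Word n, bscProb p e * f e :=
        sum_le_sum_of_subset_of_nonneg (subset_univ S) fun e _ _ =>
          mul_nonneg (bscProb_pos hp hp1 e).le (hf e)

theorem pow_hammingNorm (a : ℝ) (c : Word n) :
    a ^ hammingNorm c = ∏ i, if c i = 0 then 1 else a := by
  rw [prod_ite, prod_const_one, one_mul, prod_const, hammingNorm]

theorem sum_bscProb_mul_pow_mul_pow (p : ℝ) {s : ℝ} (hs : s ≠ 0) (c : Word n) :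
    ∑ e, bscProb p e * (s ^ hammingNorm e * s⁻¹ ^ hammingNorm (e + c)) =
      ((1 - p) * s⁻¹ + p * s) ^ hammingNorm c := by
  simp only [pow_hammingNorm, ← prod_mul_distrib, Pi.add_apply]
  rw [sum_bscProb_mul_prod p fun i z =>
    (if z = 0 then 1 else s) * (if z + c i = 0 then 1 else s⁻¹)]
  refine prod_congr rfl fun i _ => ?_
  have eq_zero_or_one (z : ZMod 2) : z = 0 ∨ z = 1 := by decide +revert
  have one_add_one : (1 : ZMod 2) + 1 = 0 := rfl
  rcases eq_zero_or_one (c i) with h | h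
  · simp [h, hs]
  · simp [h, one_add_one]

-- The Bhattacharyya bound: `s ^ hammingNorm e * s⁻¹ ^ hammingNorm (e + c)` is at least `1` on the
-- event, and its moment factors over the coordinates.
theorem bscPr_weight_add_le (hp : 0 < p) (hp2 : p < 1 / 2) (c : Word n) :
    bscPr p {e | hammingNorm (e + c) ≤ hammingNorm e} ≤
      (2 * √(p * (1 - p))) ^ hammingNorm c := by
  have hp0 : 0 < √p := Real.sqrt_pos.mpr hp
  set s := √(1 - p) / √p with hs
  have one_le_s : 1 ≤ s := (one_le_div hp0).mpr (Real.sqrt_le_sqrt (by linarith))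
  have s_pos : 0 < s := one_pos.trans_le one_le_s
  -- This choice of `s` minimizes the moment `(1 - p) / s + p * s`.
  have moment_eq : (1 - p) * s⁻¹ + p * s = 2 * √(p * (1 - p)) := by
    rw [hs, inv_div, Real.sqrt_mul hp.le, mul_div_left_comm, mul_div_left_comm p,
      Real.div_sqrt, Real.div_sqrt]
    ring
  rw [← moment_eq, ← sum_bscProb_mul_pow_mul_pow p s_pos.ne']
  refine bscPr_le_sum_mul hp (by linarith) (fun e => by positivity) fun e he => ?_
  rw [inv_pow, ← div_eq_mul_inv, one_le_div (by positivity)]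
  exact pow_le_pow_right₀ one_le_s ((mem_filter_univ e).mp he)

-- A Chernoff bound, from `Real.exp γ ≤ 1 + γ + γ ^ 2`.
theorem bscPr_lt_weight_le {γ : ℝ} (hp : 0 < p) (hp1 : p < 1) (hγ : 0 < γ) (hγ1 : γ ≤ 1)
    (n : ℕ) : bscPr p {e : Word n | (p + γ) * n < hammingNorm e} ≤
      Real.exp (-((1 - p) * γ ^ 2 * n)) := by
  have moment_eq : ∑ e : Word n, bscProb p e *
      (Real.exp γ ^ hammingNorm e * Real.exp (-(γ * ((p + γ) * n)))) =
      ((1 - p) + p * Real.exp γ) ^ n * Real.exp (-(γ * ((p + γ) * n))) := by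
    simp only [← mul_assoc, ← sum_mul, pow_hammingNorm]
    rw [sum_bscProb_mul_prod p fun _ z => if z = 0 then 1 else Real.exp γ]
    simp
  have factor_le : (1 - p) + p * Real.exp γ ≤ Real.exp (p * (γ + γ ^ 2)) := by
    have exp_le := (abs_le.mp (Real.abs_exp_sub_one_sub_id_le (abs_le.mpr ⟨by linarith, hγ1⟩))).2
    have le_exp := Real.add_one_le_exp (p * (γ + γ ^ 2))
    nlinarith
  calc bscPr p {e : Word n | (p + γ) * n < hammingNorm e}
      ≤ ((1 - p) + p * Real.exp γ) ^ n * Real.exp (-(γ * ((p + γ) * n))) := by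
        rw [← moment_eq]
        refine bscPr_le_sum_mul hp hp1 (fun e => by positivity) fun e he => ?_
        have weight_gt := (mem_filter_univ e).mp he
        rw [← Real.exp_nat_mul, ← Real.exp_add]
        exact Real.one_le_exp (by nlinarith)
    _ ≤ Real.exp (p * (γ + γ ^ 2)) ^ n * Real.exp (-(γ * ((p + γ) * n))) := by
        have factor_nonneg : 0 ≤ (1 - p) + p * Real.exp γ :=
          add_nonneg (by linarith) (by positivity)
        exact mul_le_mul_of_nonneg_right (pow_le_pow_left₀ factor_nonneg factor_le n)
          (Real.exp_pos _).le
    _ = Real.exp (-((1 - p) * γ ^ 2 * n)) := by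
        rw [← Real.exp_nat_mul, ← Real.exp_add]
        ring_nf

theorem bscProb_eq_exp (hp : 0 < p) (hp1 : p < 1) (e : Word n) :
    bscProb p e = Real.exp (n * Real.log (1 - p) -
      hammingNorm e * (Real.log (1 - p) - Real.log p)) := by
  have factor (z : ZMod 2) : (if z = 1 then p else 1 - p) =
      (1 - p) * if z = 0 then 1 else p / (1 - p) := by
    have eq_one_iff (z : ZMod 2) : z = 1 ↔ z ≠ 0 := by decide +revert
    have hq : 1 - p ≠ 0 := by linarith
    simp only [eq_one_iff, ne_eq, ite_not, mul_ite, mul_one, mul_div_cancel₀ _ hq]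
  have exp_log_sub : Real.exp (Real.log p - Real.log (1 - p)) = p / (1 - p) := by
    rw [Real.exp_sub, Real.exp_log hp, Real.exp_log (by linarith)]
  rw [bscProb, prod_congr rfl fun i _ => factor (e i), prod_mul_distrib, prod_const,
    card_univ, Fintype.card_fin, ← pow_hammingNorm, ← exp_log_sub, ← Real.exp_nat_mul,
    ← neg_sub (Real.log _), mul_neg, sub_eq_add_neg (n * Real.log _), Real.exp_add,
    Real.exp_nat_mul, Real.exp_log (by linarith)]

theorem entropy_mul_log_two (p : ℝ) :
    entropy p * Real.log 2 = -p * Real.log p - (1 - p) * Real.log (1 - p) := by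
  have hlog : Real.log 2 ≠ 0 := (Real.log_pos one_lt_two).ne'
  rw [entropy, Real.logb, Real.logb]
  field_simp

-- Each word of the ball has at least the probability of a word on its boundary.
theorem card_ball_le {γ : ℝ} (hp : 0 < p) (hp2 : p < 1 / 2) (n : ℕ) :
    (#{c : Word n | (hammingNorm c : ℝ) ≤ (p + γ) * n} : ℝ) ≤
      Real.exp (n * (entropy p * Real.log 2 + γ * (Real.log (1 - p) - Real.log p))) := by
  have hp1 : p < 1 := by linarith
  set B : Finset (Word n) := {c | (hammingNorm c : ℝ) ≤ (p + γ) * n}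
  set b := n * Real.log (1 - p) - (p + γ) * n * (Real.log (1 - p) - Real.log p)
  have log_ratio_nonneg : 0 ≤ Real.log (1 - p) - Real.log p :=
    sub_nonneg.mpr (Real.log_le_log hp (by linarith))
  have exp_le_bscProb (e : Word n) (he : e ∈ B) : Real.exp b ≤ bscProb p e := by
    rw [bscProb_eq_exp hp hp1]
    have weight_le := (mem_filter_univ e).mp he
    exact Real.exp_le_exp.mpr
      (sub_le_sub_left (mul_le_mul_of_nonneg_right weight_le log_ratio_nonneg) _)
  have card_mul_le : #B * Real.exp b ≤ 1 := by
    rw [← nsmul_eq_mul, ← bscPr_univ p n]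
    exact (card_nsmul_le_sum B _ _ exp_le_bscProb).trans (bscPr_mono hp hp1 (subset_univ B))
  rw [← le_div_iff₀ (Real.exp_pos _), one_div, ← Real.exp_neg] at card_mul_le
  refine card_mul_le.trans_eq (congrArg Real.exp ?_)
  rw [mul_add, entropy_mul_log_two]
  ring

/-- The probability that the weight of the noise is at most `ρ` and does not increase when `c` is
added. -/
def confusion (p ρ : ℝ) (c : Word n) : ℝ :=
  bscPr p {e | hammingNorm (e + c) ≤ hammingNorm e ∧ (hammingNorm e : ℝ) ≤ ρ}

theorem confusion_nonneg (hp : 0 < p) (hp1 : p < 1) (ρ : ℝ) (c : Word n) :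
    0 ≤ confusion p ρ c :=
  bscPr_nonneg hp hp1 _

theorem hammingNorm_comp_perm (σ : Equiv.Perm (Fin n)) (c : Word n) :
    hammingNorm (c ∘ σ) = hammingNorm c := by
  simp only [hammingNorm, card_filter]
  exact Equiv.sum_comp σ fun i => if c i ≠ 0 then 1 else 0

theorem exists_perm_of_hammingNorm_eq {c c' : Word n} (h : hammingNorm c = hammingNorm c') :
    ∃ σ : Equiv.Perm (Fin n), c' ∘ σ = c := by
  have card_support : Fintype.card {i // c i ≠ 0} = Fintype.card {i // c' i ≠ 0} := by
    rw [Fintype.card_subtype, Fintype.card_subtype]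
    exact h
  obtain ⟨σ⟩ := Fintype.card_eq.mp card_support
  refine ⟨σ.extendSubtype, funext fun i => ?_⟩
  have eq_of_ne_zero_iff (a b : ZMod 2) : (a ≠ 0 ↔ b ≠ 0) → a = b := by decide +revert
  apply eq_of_ne_zero_iff
  by_cases hi : c i ≠ 0
  · exact iff_of_true (σ.extendSubtype_mem i hi) hi
  · exact iff_of_false (σ.extendSubtype_not_mem i hi) hi

theorem confusion_eq_of_hammingNorm_eq (p ρ : ℝ) {c c' : Word n}
    (h : hammingNorm c = hammingNorm c') : confusion p ρ c = confusion p ρ c' := by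
  obtain ⟨σ, rfl⟩ := exists_perm_of_hammingNorm_eq h
  have add_comp (e : Word n) : e ∘ σ + c' ∘ σ = (e + c') ∘ σ := rfl
  refine (sum_equiv (σ.arrowCongr (Equiv.refl (ZMod 2))).symm (fun e => ?_) fun e _ => ?_).symm
  · change _ ↔ e ∘ σ ∈ _
    simp only [mem_filter_univ, add_comp, hammingNorm_comp_perm]
  · exact (Equiv.prod_comp σ fun i => if e i = 1 then p else 1 - p).symm

theorem sum_confusion_le (hp : 0 < p) (hp1 : p < 1) (ρ : ℝ) (n : ℕ) :
    ∑ c : Word n, confusion p ρ c ≤ #{c : Word n | (hammingNorm c : ℝ) ≤ ρ} := by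
  set B : Finset (Word n) := {c | (hammingNorm c : ℝ) ≤ ρ}
  have sum_word_le (e : Word n) : ∑ c : Word n,
      (if hammingNorm (e + c) ≤ hammingNorm e ∧ (hammingNorm e : ℝ) ≤ ρ then bscProb p e else 0) ≤
        #B * bscProb p e := by
    rw [← sum_filter, sum_const, nsmul_eq_mul]
    refine mul_le_mul_of_nonneg_right (Nat.cast_le.mpr ?_) (bscProb_pos hp hp1 e).le
    refine card_le_card_of_injOn (e + ·) (fun c hc => ?_) (add_right_injective e).injOn
    obtain ⟨hle, hρ⟩ := (mem_filter_univ c).mp hc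
    exact (mem_filter_univ _).mpr (le_trans (Nat.cast_le.mpr hle) hρ)
  simp only [confusion, bscPr, sum_filter]
  rw [sum_comm]
  refine (sum_le_sum fun e _ => sum_word_le e).trans_eq ?_
  rw [← mul_sum, ← bscPr, bscPr_univ, mul_one]

end Channel

/-! ### The error probability of maximum-likelihood decoding -/

section GreedyError

variable {k n t : ℕ} {R : ℕ → Word k} {p : ℝ}

theorem hammingNorm_codeword_eq_of_mem {i : ℕ} {M : Finset (Word k)} {x : Word k}
    (hx : x ∈ weightClass R n i \ M) : hammingNorm (codeword R n x) = i :=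
  mem_weightClass.mp (mem_sdiff.mp hx).1

-- The class is no larger than `exp (3 √n) / 2 ^ t` times the sphere, on which the confusion
-- probability is constant.
theorem sum_confusion_weightClass_le (hR : IsGreedyMatrix R) (hk : 0 < k) (hp : 0 < p)
    (hp1 : p < 1) (ρ : ℝ) (t : ℕ) {i : ℕ} (hi : 0 < i) :
    ∑ x ∈ weightClass R (k + t) i \ marked R t, confusion p ρ (codeword R (k + t) x) ≤
      Real.exp (3 * √((k + t : ℕ) : ℝ)) / 2 ^ t *
        ∑ c : Word (k + t) with hammingNorm c = i, confusion p ρ c := by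
  set E := Real.exp (3 * √((k + t : ℕ) : ℝ))
  rcases (weightClass R (k + t) i \ marked R t).eq_empty_or_nonempty with hempty | ⟨x₀, hx₀⟩
  · rw [hempty, sum_empty]
    exact mul_nonneg (by positivity) (sum_nonneg fun c _ => confusion_nonneg hp hp1 ρ c)
  · set φ := confusion p ρ (codeword R (k + t) x₀)
    have weight_x₀ := hammingNorm_codeword_eq_of_mem hx₀
    have confusion_class (x) (hx : x ∈ weightClass R (k + t) i \ marked R t) :
        confusion p ρ (codeword R (k + t) x) = φ :=
      confusion_eq_of_hammingNorm_eq p ρ ((hammingNorm_codeword_eq_of_mem hx).trans weight_x₀.symm)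
    have confusion_sphere (c) (hc : c ∈ ({c | hammingNorm c = i} : Finset (Word (k + t)))) :
        confusion p ρ c = φ :=
      confusion_eq_of_hammingNorm_eq p ρ (((mem_filter_univ c).mp hc).trans weight_x₀.symm)
    rw [sum_congr rfl confusion_class, sum_congr rfl confusion_sphere, sum_const, sum_const,
      card_hammingNorm_eq, nsmul_eq_mul, nsmul_eq_mul]
    calc #(weightClass R (k + t) i \ marked R t) * φ
        ≤ E * ((k + t).choose i / 2 ^ t) * φ :=
          mul_le_mul_of_nonneg_right (card_unmarked_le hR hk t hi) (confusion_nonneg hp hp1 ρ _)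
      _ = E / 2 ^ t * ((k + t).choose i * φ) := by ring

theorem sum_confusion_unmarked_le (hR : IsGreedyMatrix R) (hk : 0 < k) (hp : 0 < p)
    (hp1 : p < 1) (ρ : ℝ) (t : ℕ) :
    ∑ x with x ≠ 0 ∧ x ∉ marked R t, confusion p ρ (codeword R (k + t) x) ≤
      Real.exp (3 * √((k + t : ℕ) : ℝ)) / 2 ^ t *
        #{c : Word (k + t) | (hammingNorm c : ℝ) ≤ ρ} := by
  set n := k + t
  have weight_mem_Icc (x) (hx : x ∈ ({x | x ≠ 0 ∧ x ∉ marked R t} : Finset (Word k))) :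
      hammingNorm (codeword R n x) ∈ Icc 1 n :=
    mem_Icc.mpr ⟨hammingNorm_codeword_pos hR ((mem_filter_univ x).mp hx).1 (k.le_add_right t),
      hammingNorm_le_card_fintype.trans_eq (Fintype.card_fin n)⟩
  have fiber_subset (i : ℕ) : ({x ∈ {x | x ≠ 0 ∧ x ∉ marked R t} |
      hammingNorm (codeword R n x) = i} : Finset (Word k)) ⊆ weightClass R n i \ marked R t := by
    intro x hx
    rw [mem_filter, mem_filter_univ] at hx
    exact mem_sdiff.mpr ⟨mem_weightClass.mpr hx.2, hx.1.2⟩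
  rw [← sum_fiberwise_of_maps_to weight_mem_Icc]
  calc _ ≤ ∑ i ∈ Icc 1 n, Real.exp (3 * √(n : ℝ)) / 2 ^ t *
          ∑ c : Word n with hammingNorm c = i, confusion p ρ c :=
        sum_le_sum fun i hi => (sum_le_sum_of_subset_of_nonneg (fiber_subset i)
          fun x _ _ => confusion_nonneg hp hp1 ρ _).trans
            (sum_confusion_weightClass_le hR hk hp hp1 ρ t (mem_Icc.mp hi).1)
    _ = Real.exp (3 * √(n : ℝ)) / 2 ^ t *
          ∑ c : Word n with hammingNorm c ∈ Icc 1 n, confusion p ρ c := by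
        rw [← mul_sum, sum_fiberwise_eq_sum_filter]
    _ ≤ Real.exp (3 * √(n : ℝ)) / 2 ^ t * ∑ c : Word n, confusion p ρ c :=
        mul_le_mul_of_nonneg_left (sum_le_sum_of_subset_of_nonneg (filter_subset _ _)
          fun c _ _ => confusion_nonneg hp hp1 ρ c) (by positivity)
    _ ≤ _ := mul_le_mul_of_nonneg_left (sum_confusion_le hp hp1 ρ n) (by positivity)

theorem sum_bscPr_marked_le (hp : 0 < p) (hp2 : p < 1 / 2) (t : ℕ) {d : ℕ}
    (hd : ∀ x ≠ 0, d ≤ hammingNorm (codeword R (k + t) x)) :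
    ∑ x with x ≠ 0 ∧ x ∈ marked R t,
        bscPr p {e | hammingNorm (e + codeword R (k + t) x) ≤ hammingNorm e} ≤
      2 * ((k + t : ℕ) : ℝ) ^ 4 * (2 * √(p * (1 - p))) ^ d := by
  have base_le_one : 2 * √(p * (1 - p)) ≤ 1 := by
    have sqrt_le : √(p * (1 - p)) ≤ 1 / 2 :=
      Real.sqrt_le_iff.mpr ⟨by norm_num, by nlinarith [sq_nonneg (p - 1 / 2)]⟩
    linarith
  have term_le (x) (hx : x ∈ ({x | x ≠ 0 ∧ x ∈ marked R t} : Finset (Word k))) :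
      bscPr p {e | hammingNorm (e + codeword R (k + t) x) ≤ hammingNorm e} ≤
        (2 * √(p * (1 - p))) ^ d :=
    (bscPr_weight_add_le hp hp2 _).trans
      (pow_le_pow_of_le_one (by positivity) base_le_one (hd x ((mem_filter_univ x).mp hx).1))
  have card_le : #{x | x ≠ 0 ∧ x ∈ marked R t} ≤ 2 * (k + t) ^ 4 :=
    (card_le_card fun x hx => ((mem_filter_univ x).mp hx).2).trans (card_marked_le R t)
  refine (sum_le_card_nsmul _ _ _ term_le).trans ?_
  rw [nsmul_eq_mul]
  exact mul_le_mul_of_nonneg_right (mod_cast card_le) (by positivity)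

end GreedyError

section MaximumLikelihood

variable {C : RatelessCode} {G : (k : ℕ) → ℕ → Word k} {k n : ℕ} {p : ℝ}

theorem encPrefix_eq_codeword (hG : C.IsGeneratedBy G) (m : Word k) :
    C.encPrefix n m = codeword (G k) n m :=
  funext fun i => hG k m i

theorem codeword_sub (R : ℕ → Word k) (n : ℕ) (x y : Word k) :
    codeword R n (x - y) = codeword R n x - codeword R n y :=
  funext fun _ => dotProduct_sub _ _ _

-- The confusing word is the difference of the transmitted and the decoded word.
theorem exists_confusing_word (hG : C.IsGeneratedBy G) (hC : C.IsMaximumLikelihood)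
    {m : Word k} {e : Word n} (h : C.dec n k (C.encPrefix n m + e) ≠ m) :
    ∃ x ≠ 0, hammingNorm (e + codeword (G k) n x) ≤ hammingNorm e := by
  set y := C.encPrefix n m + e with hy
  refine ⟨m - C.dec n k y, sub_ne_zero.mpr h.symm, ?_⟩
  have noise_eq : e = y - C.encPrefix n m := by rw [hy, add_sub_cancel_left]
  have sum_eq : e + codeword (G k) n (m - C.dec n k y) = y - C.encPrefix n (C.dec n k y) := by
    rw [noise_eq, codeword_sub, encPrefix_eq_codeword hG, encPrefix_eq_codeword hG,
      sub_add_sub_cancel]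
  have closest := hC n k y m
  rw [hammingDist_comm, hammingDist_comm y, hammingDist_eq_hammingNorm,
    hammingDist_eq_hammingNorm, neg_add_eq_sub, neg_add_eq_sub] at closest
  rwa [sum_eq, noise_eq]

open Classical in
theorem decodingError_subset (hG : C.IsGeneratedBy G) (hC : C.IsMaximumLikelihood)
    (m : Word k) (ρ : ℝ) (M : Finset (Word k)) :
    ({e | C.dec n k (C.encPrefix n m + e) ≠ m} : Finset (Word n)) ⊆
      ({e | ρ < hammingNorm e} : Finset (Word n)) ∪
      ({x | x ≠ 0 ∧ x ∈ M} : Finset (Word k)).biUnion (fun x =>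
        {e | hammingNorm (e + codeword (G k) n x) ≤ hammingNorm e}) ∪
      ({x | x ≠ 0 ∧ x ∉ M} : Finset (Word k)).biUnion (fun x =>
        {e | hammingNorm (e + codeword (G k) n x) ≤ hammingNorm e ∧ (hammingNorm e : ℝ) ≤ ρ}) := by
  intro e he
  obtain ⟨x, hx0, hx⟩ := exists_confusing_word hG hC (by simpa only [mem_filter_univ] using he)
  simp only [mem_union, mem_biUnion, mem_filter_univ]
  rcases lt_or_ge ρ (hammingNorm e) with hρ | hρ
  · exact Or.inl (Or.inl hρ)
  · by_cases hM : x ∈ M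
    · exact Or.inl (Or.inr ⟨x, ⟨hx0, hM⟩, hx⟩)
    · exact Or.inr ⟨x, ⟨hx0, hM⟩, hx, hρ⟩

-- Noise of atypical weight, confusion with a marked word, and confusion with an unmarked word.
theorem errorProb_le (hG : C.IsGeneratedBy G) (hGk : IsGreedyMatrix (G k))
    (hC : C.IsMaximumLikelihood) (hk : 0 < k) {γ : ℝ} (hp : 0 < p) (hp2 : p < 1 / 2)
    (hγ : 0 < γ) (hγ1 : γ ≤ 1) (t : ℕ) {d : ℕ}
    (hd : ∀ x ≠ 0, d ≤ hammingNorm (codeword (G k) (k + t) x)) :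
    C.errorProb p k (k + t) ≤ Real.exp (-((1 - p) * γ ^ 2 * (k + t : ℕ))) +
      2 * ((k + t : ℕ) : ℝ) ^ 4 * (2 * √(p * (1 - p))) ^ d +
      Real.exp (3 * √((k + t : ℕ) : ℝ)) / 2 ^ t * Real.exp ((k + t : ℕ) *
        (entropy p * Real.log 2 + γ * (Real.log (1 - p) - Real.log p))) := by
  have hp1 : p < 1 := by linarith
  refine ciSup_le fun m => ?_
  classical
  refine (bscPr_mono hp hp1 (decodingError_subset hG hC m ((p + γ) * (k + t : ℕ))
    (marked (G k) t))).trans ?_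
  refine (bscPr_union_le hp hp1 _ _).trans (add_le_add ((bscPr_union_le hp hp1 _ _).trans
    (add_le_add (bscPr_lt_weight_le hp hp1 hγ hγ1 _) ?_)) ?_)
  · exact (bscPr_biUnion_le hp hp1 _ _).trans (sum_bscPr_marked_le hp hp2 t hd)
  · exact (bscPr_biUnion_le hp hp1 _ _).trans
      ((sum_confusion_unmarked_le hGk hk hp hp1 _ t).trans
        (mul_le_mul_of_nonneg_left (card_ball_le hp hp2 _) (by positivity)))

theorem errorProb_le_one_sub (hG : C.IsGeneratedBy G) (hGk : IsGreedyMatrix (G k))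
    (hC : C.IsMaximumLikelihood) (hp : 0 < p) (hp1 : p < 1) (hkn : k ≤ n) :
    C.errorProb p k n ≤ 1 - (1 - p) ^ n := by
  have bscProb_zero : bscProb p (0 : Word n) = (1 - p) ^ n := by simp [bscProb]
  have bscPr_erase_zero : bscPr p (univ.erase (0 : Word n)) = 1 - (1 - p) ^ n := by
    rw [bscPr, sum_erase_eq_sub (mem_univ _), ← bscPr, bscPr_univ, bscProb_zero]
  rw [← bscPr_erase_zero]
  refine ciSup_le fun m => bscPr_mono hp hp1 fun e he => mem_erase.mpr ⟨?_, mem_univ e⟩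
  rintro rfl
  obtain ⟨x, hx0, hx⟩ := exists_confusing_word hG hC (by simpa only [mem_filter_univ] using he)
  rw [zero_add, hammingNorm_zero] at hx
  exact (hammingNorm_codeword_pos hGk hx0 hkn).not_ge hx

theorem errorProb_zero_left (C : RatelessCode) (p : ℝ) (n : ℕ) : C.errorProb p 0 n = 0 := by
  simp [RatelessCode.errorProb, eq_iff_true_of_subsingleton]

end MaximumLikelihood

/-! ### The error exponent -/

section MinimumDistance

variable {k n d : ℕ} {R : ℕ → Word k} {p δ : ℝ}

theorem entropy_pos (hp : 0 < p) (hp1 : p < 1) : 0 < entropy p := by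
  have log_p : Real.log p < 0 := Real.log_neg hp hp1
  have log_q : Real.log (1 - p) < 0 := Real.log_neg (by linarith) (by linarith)
  refine pos_of_mul_pos_left ?_ (Real.log_pos one_lt_two).le
  rw [entropy_mul_log_two p]
  nlinarith

theorem exp_div_two_pow (a : ℝ) (t : ℕ) :
    Real.exp a / 2 ^ t = Real.exp (a - t * Real.log 2) := by
  rw [Real.exp_sub, Real.exp_nat_mul, Real.exp_log two_pos]

theorem choose_le_exp_entropy (hp : 0 < p) (hp2 : p < 1 / 2) (hd : (d : ℝ) ≤ p * n) :
    (n.choose d : ℝ) ≤ Real.exp (n * (entropy p * Real.log 2)) := by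
  have ball := card_ball_le (γ := 0) hp hp2 n
  rw [add_zero, zero_mul, add_zero] at ball
  rw [← card_hammingNorm_eq]
  refine le_trans (mod_cast card_le_card fun c hc => ?_) ball
  rw [mem_filter_univ] at hc ⊢
  rwa [hc]

theorem mul_sqrt_lt {a b x : ℝ} (hx : 0 < x) (h : a < √x * b) : a * √x < b * x :=
  calc a * √x < √x * b * √x := mul_lt_mul_of_pos_right h (Real.sqrt_pos.mpr hx)
    _ = b * (√x * √x) := by ring
    _ = b * x := by rw [Real.mul_self_sqrt hx.le]

theorem weightClass_subset_marked (hR : IsGreedyMatrix R) (hk : 0 < k) (hp : 0 < p)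
    (hp2 : p < 1 / 2) {t : ℕ} (hrate : (k : ℝ) ≤ (1 - entropy p - δ) * (k + t : ℕ))
    (hn : 3 < √((k + t : ℕ) : ℝ) * (δ * Real.log 2)) (hd : 0 < d)
    (hdp : (d : ℝ) ≤ p * (k + t : ℕ)) :
    weightClass R (k + t) d ⊆ marked R t := by
  set n := k + t with n_def
  have n_pos : (0 : ℝ) < n := mod_cast (show 0 < n by lia)
  have exponent_neg : 3 * √(n : ℝ) + (n * (entropy p * Real.log 2) - t * Real.log 2) < 0 := by
    have redundancy : (t : ℝ) = n - k := by rw [n_def]; push_cast; ring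
    have := mul_sqrt_lt n_pos hn
    have := mul_le_mul_of_nonneg_right hrate (Real.log_pos one_lt_two).le
    rw [redundancy]
    linarith
  have card_lt_one : (#(weightClass R n d \ marked R t) : ℝ) < 1 :=
    calc (#(weightClass R n d \ marked R t) : ℝ)
        ≤ Real.exp (3 * √(n : ℝ)) * (n.choose d / 2 ^ t) := card_unmarked_le hR hk t hd
      _ ≤ Real.exp (3 * √(n : ℝ)) * (Real.exp (n * (entropy p * Real.log 2)) / 2 ^ t) := by
          gcongr
          exact choose_le_exp_entropy hp hp2 hdp
      _ = Real.exp (3 * √(n : ℝ) + (n * (entropy p * Real.log 2) - t * Real.log 2)) := by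
          rw [exp_div_two_pow, ← Real.exp_add]
      _ < 1 := Real.exp_lt_one_iff.mpr exponent_neg
  exact sdiff_eq_empty_iff_subset.mp (card_eq_zero.mp (Nat.lt_one_iff.mp (mod_cast card_lt_one)))

theorem two_mul_pow_four_eq_exp (hn : 0 < n) :
    2 * (n : ℝ) ^ 4 = Real.exp (Real.log 2 + 4 * Real.log n) := by
  rw [Real.exp_add, Real.exp_log two_pos, mul_comm 4, Real.exp_mul,
    Real.exp_log (Nat.cast_pos.mpr hn)]
  norm_cast

theorem seven_eighths_pow_ceil_log_mul_lt_one (hn : 1 ≤ Real.log n) :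
    (7 / 8 : ℝ) ^ ⌈60 * Real.log n⌉₊ * (2 * (n : ℝ) ^ 4) < 1 := by
  have n_pos : 0 < n := Nat.pos_of_ne_zero fun h => by norm_num [h] at hn
  have base_le : (7 / 8 : ℝ) ≤ Real.exp (-(1 / 8)) := by
    linarith [Real.add_one_le_exp (-(1 / 8) : ℝ)]
  calc (7 / 8 : ℝ) ^ ⌈60 * Real.log n⌉₊ * (2 * (n : ℝ) ^ 4)
      ≤ Real.exp (-(1 / 8)) ^ ⌈60 * Real.log n⌉₊ * (2 * (n : ℝ) ^ 4) := by gcongr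
    _ = Real.exp (⌈60 * Real.log n⌉₊ * (-(1 / 8)) + (Real.log 2 + 4 * Real.log n)) := by
        rw [← Real.exp_nat_mul, two_mul_pow_four_eq_exp n_pos, ← Real.exp_add]
    _ < 1 := by
        rw [Real.exp_lt_one_iff]
        linarith [Nat.le_ceil (60 * Real.log n), Real.log_two_lt_d9]

theorem floor_mul_ceil_log_le {α : ℝ} (hα : 0 ≤ α) (hn : 1 ≤ Real.log n) :
    (⌊α * (n / Real.log n)⌋₊ : ℝ) * ⌈60 * Real.log n⌉₊ ≤ 61 * α * n := by
  have ceil_le : (⌈60 * Real.log n⌉₊ : ℝ) ≤ 61 * Real.log n := by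
    linarith [Nat.ceil_lt_add_one (show 0 ≤ 60 * Real.log n by positivity)]
  calc _ ≤ α * (n / Real.log n) * (61 * Real.log n) := by
        gcongr
        exact Nat.floor_le (by positivity)
    _ = 61 * α * n := by field_simp

-- The light classes are already marked `J * L` rows before the last one, where `J` is the floor
-- and `L = ⌈60 log n⌉`, and every further `L` rows raise the minimum weight by one.
theorem floor_lt_hammingNorm_codeword (hR : IsGreedyMatrix R) (hk : 0 < k) (hp : 0 < p)
    (hp2 : p < 1 / 2) (hδ : 0 < δ) (hδ1 : δ < 1 - entropy p) {α : ℝ} (hα : 0 ≤ α)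
    (hαδ : 61 * α ≤ δ / 2) (hαp : α ≤ p / 2) (hrate : (k : ℝ) ≤ (1 - entropy p - δ) * n)
    (hlog : 1 ≤ Real.log n) (hn : 6 < √(n : ℝ) * (δ / 2 * Real.log 2)) {x : Word k}
    (hx : x ≠ 0) :
    ⌊α * (n / Real.log n)⌋₊ < hammingNorm (codeword R n x) := by
  set J := ⌊α * (n / Real.log n)⌋₊
  set L := ⌈60 * Real.log n⌉₊
  have entropy_pos := entropy_pos hp (by linarith)
  have n_pos : (0 : ℝ) < n :=
    Nat.cast_pos.mpr (Nat.pos_of_ne_zero fun h => by norm_num [h] at hlog)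
  have J_le : (J : ℝ) ≤ p / 2 * n :=
    calc (J : ℝ) ≤ α * (n / Real.log n) := Nat.floor_le (by positivity)
      _ ≤ p / 2 * n := by gcongr; exact div_le_self n_pos.le hlog
  have JL_le : ((J * L : ℕ) : ℝ) ≤ δ / 2 * n := by
    rw [Nat.cast_mul]
    exact (floor_mul_ceil_log_le hα hlog).trans (mul_le_mul_of_nonneg_right hαδ n_pos.le)
  have k_add_JL_le : k + J * L ≤ n := by
    have : (k : ℝ) + (J * L : ℕ) ≤ n := by nlinarith
    exact_mod_cast this
  obtain ⟨t, n_eq⟩ := Nat.exists_eq_add_of_le k_add_JL_le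
  refine lt_min_weight hR (t := t) (L := L) (fun j hj => ?_) (by lia)
    (seven_eighths_pow_ceil_log_mul_lt_one hlog) hx
  have early : (1 - δ / 2) * n ≤ ((k + (t + j * L) : ℕ) : ℝ) := by
    have : (n : ℝ) ≤ (k + (t + j * L) : ℕ) + (J * L : ℕ) := mod_cast (by lia)
    linarith
  have half_le : (n : ℝ) / 2 ≤ ((k + (t + j * L) : ℕ) : ℝ) := by nlinarith
  have half_sqrt_le : √(n : ℝ) / 2 ≤ √((k + (t + j * L) : ℕ) : ℝ) := by
    apply Real.le_sqrt_of_sq_le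
    rw [div_pow, Real.sq_sqrt n_pos.le]
    linarith
  refine weightClass_subset_marked hR hk hp hp2 (δ := δ / 2) (hrate.trans ?_) ?_ j.succ_pos ?_
  · calc (1 - entropy p - δ) * n ≤ (1 - entropy p - δ / 2) * ((1 - δ / 2) * n) := by
          rw [← mul_assoc]
          exact mul_le_mul_of_nonneg_right (by nlinarith) n_pos.le
      _ ≤ _ := mul_le_mul_of_nonneg_left early (by linarith)
  · have := mul_le_mul_of_nonneg_right half_sqrt_le
      (mul_pos (half_pos hδ) (Real.log_pos one_lt_two)).le
    linarith
  · calc ((j + 1 : ℕ) : ℝ) ≤ J := mod_cast hj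
      _ ≤ p * ((n : ℝ) / 2) := by linarith
      _ ≤ _ := mul_le_mul_of_nonneg_left half_le hp.le

end MinimumDistance

section Exponent

variable {C : RatelessCode} {G : (k : ℕ) → ℕ → Word k} {k n : ℕ} {p δ : ℝ}

theorem two_mul_pow_four_mul_pow_floor_le {β : ℝ} (hβ : 0 < β) (hβ1 : β ≤ 1) (hn : 0 < n)
    (u : ℝ) : 2 * (n : ℝ) ^ 4 * β ^ (⌊u⌋₊ + 1) ≤
      Real.exp (Real.log 2 + 4 * Real.log n + Real.log β * u) := by
  rw [two_mul_pow_four_eq_exp hn, Real.exp_add _ (Real.log β * u)]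
  refine mul_le_mul_of_nonneg_left ?_ (Real.exp_pos _).le
  rw [← Real.exp_log (pow_pos hβ _), Real.log_pow, mul_comm, Nat.cast_succ]
  exact Real.exp_le_exp.mpr (mul_le_mul_of_nonpos_left (Nat.lt_floor_add_one u).le
    (Real.log_nonpos hβ.le hβ1))

theorem exp_sqrt_div_two_pow_mul_exp_le {t : ℕ} {H a : ℝ}
    (hrate : (k : ℝ) ≤ (1 - H - δ) * (k + t : ℕ)) :
    Real.exp (3 * √((k + t : ℕ) : ℝ)) / 2 ^ t *
        Real.exp ((k + t : ℕ) * (H * Real.log 2 + a)) ≤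
      Real.exp (3 * √((k + t : ℕ) : ℝ) - (δ * Real.log 2 - a) * (k + t : ℕ)) := by
  rw [exp_div_two_pow, ← Real.exp_add]
  refine Real.exp_le_exp.mpr ?_
  have := mul_le_mul_of_nonneg_right hrate (Real.log_pos one_lt_two).le
  push_cast at this ⊢
  linarith

theorem errorProb_le_add_exp (hG : C.IsGeneratedBy G) (hgreedy : ∀ k, IsGreedyMatrix (G k))
    (hC : C.IsMaximumLikelihood) (hp : 0 < p) (hp2 : p < 1 / 2) (hδ : 0 < δ)
    (hδ1 : δ < 1 - entropy p) {α γ β : ℝ} (hα : 0 ≤ α) (hαδ : 61 * α ≤ δ / 2)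
    (hαp : α ≤ p / 2) (hγ : 0 < γ) (hγ1 : γ ≤ 1)
    (hγδ : γ * (Real.log (1 - p) - Real.log p) ≤ δ / 2 * Real.log 2) (hβ : β = 2 * √(p * (1 - p)))
    (hβ0 : 0 < β) (hβ1 : β ≤ 1) (hrate : (k : ℝ) ≤ (1 - entropy p - δ) * n) (hlog : 1 ≤ Real.log n)
    (hn : 6 < √(n : ℝ) * (δ / 2 * Real.log 2)) :
    C.errorProb p k n ≤ Real.exp (-((1 - p) * γ ^ 2 * n)) +
      Real.exp (Real.log 2 + 4 * Real.log n + Real.log β * α * (n / Real.log n)) +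
      Real.exp (3 * √(n : ℝ) - δ / 2 * Real.log 2 * n) := by
  rcases Nat.eq_zero_or_pos k with rfl | hk
  · rw [errorProb_zero_left]
    positivity
  have k_le : k ≤ n := by
    have : (k : ℝ) ≤ n := by nlinarith [entropy_pos hp (by linarith), Nat.cast_nonneg (α := ℝ) n]
    exact_mod_cast this
  obtain ⟨t, rfl⟩ := Nat.exists_eq_add_of_le k_le
  refine (errorProb_le hG (hgreedy k) hC hk hp hp2 hγ hγ1 t fun x hx =>
    floor_lt_hammingNorm_codeword (hgreedy k) hk hp hp2 hδ hδ1 hα hαδ hαp hrate hlog hn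
      hx).trans ?_
  rw [← hβ, mul_assoc (Real.log β)]
  refine add_le_add (add_le_add_right (two_mul_pow_four_mul_pow_floor_le hβ0 hβ1 (by lia) _) _)
    ((exp_sqrt_div_two_pow_mul_exp_le hrate).trans (Real.exp_le_exp.mpr ?_))
  gcongr
  linarith

theorem eventually_log_sq_le_and_lt_sqrt {c : ℝ} (hc : 0 < c) :
    ∀ᶠ n : ℕ in Filter.atTop,
      7 * Real.log n ^ 2 ≤ c * n ∧ 6 < √(n : ℝ) * c ∧ 1 ≤ Real.log n := by
  have log_sq := tendsto_natCast_atTop_atTop.eventually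
    ((Real.isLittleO_pow_log_id_atTop (n := 2)).bound (show 0 < c / 7 by positivity))
  have sqrt := (Real.tendsto_sqrt_atTop.comp
    tendsto_natCast_atTop_atTop).eventually_gt_atTop (6 / c)
  have log := (Real.tendsto_log_atTop.comp
    tendsto_natCast_atTop_atTop).eventually_ge_atTop (1 : ℝ)
  filter_upwards [log_sq, sqrt, log] with n hlog_sq hsqrt hlog
  rw [Real.norm_of_nonneg (by positivity), id, Real.norm_of_nonneg (by positivity)] at hlog_sq
  exact ⟨by linarith, (div_lt_iff₀ hc).mp hsqrt, hlog⟩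

theorem exp_add_exp_add_exp_le {a b c y : ℝ} (ha : a ≤ -y - Real.log 3)
    (hb : b ≤ -y - Real.log 3) (hc : c ≤ -y - Real.log 3) :
    Real.exp a + Real.exp b + Real.exp c ≤ Real.exp (-y) := by
  have third : Real.exp (-y - Real.log 3) = Real.exp (-y) / 3 := by
    rw [Real.exp_sub, Real.exp_log (by norm_num)]
  linarith [Real.exp_le_exp.mpr ha, Real.exp_le_exp.mpr hb, Real.exp_le_exp.mpr hc]

theorem sum_exp_le_exp_div_log {a b c d : ℝ} (hc : 0 < c) (ha : 2 * c ≤ a) (hb : 2 * c ≤ -b)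
    (hd : 2 * c ≤ d) (hn : 0 < n) (hlog_sq : 7 * Real.log n ^ 2 ≤ c * n)
    (hsqrt : 6 < √(n : ℝ) * c) (hlog : 1 ≤ Real.log n) :
    Real.exp (-(a * n)) + Real.exp (Real.log 2 + 4 * Real.log n + b * (n / Real.log n)) +
      Real.exp (3 * √(n : ℝ) - d * n) ≤ Real.exp (-(c * (n / Real.log n))) := by
  have n_pos : (0 : ℝ) < n := Nat.cast_pos.mpr hn
  set u := (n : ℝ) / Real.log n with u_def
  have u_pos : 0 < u := div_pos n_pos (by linarith)
  have u_le : c * u ≤ c * n := mul_le_mul_of_nonneg_left (div_le_self n_pos.le hlog) hc.le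
  have log_le : 7 * Real.log n ≤ c * u := by
    rw [u_def, mul_div_assoc', le_div_iff₀ (by linarith)]
    linarith
  have log_three_le : Real.log 3 ≤ 2 := by
    linarith [Real.log_le_sub_one_of_pos (show (0 : ℝ) < 3 by norm_num)]
  refine exp_add_exp_add_exp_le ?_ ?_ ?_
  · linarith [mul_le_mul_of_nonneg_right ha n_pos.le]
  · linarith [mul_le_mul_of_nonneg_right hb u_pos.le, Real.log_two_lt_d9]
  · linarith [mul_le_mul_of_nonneg_right hd n_pos.le, mul_sqrt_lt n_pos hsqrt]

theorem exists_pos_le_min₃ {a b c : ℝ} (ha : 0 < a) (hb : 0 < b) (hc : 0 < c) :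
    ∃ r > 0, 2 * r ≤ a ∧ 2 * r ≤ b ∧ 2 * r ≤ c := by
  refine ⟨min a (min b c) / 2, half_pos (lt_min ha (lt_min hb hc)), ?_⟩
  rw [mul_div_cancel₀ _ two_ne_zero]
  exact ⟨min_le_left .., (min_le_right ..).trans (min_le_left ..),
    (min_le_right ..).trans (min_le_right ..)⟩

theorem two_mul_sqrt_mul_one_sub_lt_one (hp2 : p < 1 / 2) : 2 * √(p * (1 - p)) < 1 := by
  have : √(p * (1 - p)) < 1 / 2 :=
    (Real.sqrt_lt' (by norm_num)).mpr (by nlinarith [mul_self_pos.mpr (sub_ne_zero.mpr hp2.ne)])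
  linarith

theorem eventually_errorProb_le (hG : C.IsGeneratedBy G) (hgreedy : ∀ k, IsGreedyMatrix (G k))
    (hC : C.IsMaximumLikelihood) (hp : 0 < p) (hp2 : p < 1 / 2) (hδ : 0 < δ)
    (hδ1 : δ < 1 - entropy p) :
    ∃ c > 0, ∀ᶠ n : ℕ in Filter.atTop, ∀ k : ℕ, (k : ℝ) ≤ (1 - entropy p - δ) * n →
      C.errorProb p k n ≤ Real.exp (-(c * (n / Real.log n))) := by
  have entropy_pos := entropy_pos hp (by linarith)
  set ℓ := Real.log (1 - p) - Real.log p
  have ℓ_pos : 0 < ℓ := sub_pos.mpr (Real.log_lt_log hp (by linarith))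
  set γ := min 1 (δ / 2 * Real.log 2 / ℓ)
  have γ_pos : 0 < γ := lt_min one_pos (by positivity)
  have γ_mul_le : γ * ℓ ≤ δ / 2 * Real.log 2 := (le_div_iff₀ ℓ_pos).mp (min_le_right _ _)
  set β := 2 * √(p * (1 - p)) with β_def
  have β_pos : 0 < β := mul_pos two_pos (Real.sqrt_pos.mpr (mul_pos hp (by linarith)))
  have β_lt_one : β < 1 := two_mul_sqrt_mul_one_sub_lt_one hp2
  obtain ⟨α, α_def⟩ : ∃ α, α = δ * p / 160 := ⟨_, rfl⟩
  have α_pos : 0 < α := by rw [α_def]; positivity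
  have noise_pos : 0 < (1 - p) * γ ^ 2 := mul_pos (by linarith) (by positivity)
  have marked_pos : 0 < -(Real.log β * α) :=
    neg_pos.mpr (mul_neg_of_neg_of_pos (Real.log_neg β_pos β_lt_one) α_pos)
  have unmarked_pos : 0 < δ / 2 * Real.log 2 := by positivity
  obtain ⟨c, c_pos, c_le_noise, c_le_marked, c_le_unmarked⟩ :=
    exists_pos_le_min₃ noise_pos marked_pos unmarked_pos
  refine ⟨c, c_pos, ?_⟩
  filter_upwards [eventually_log_sq_le_and_lt_sqrt c_pos, Filter.eventually_gt_atTop 0]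
    with n ⟨log_sq, sqrt, log⟩ hn k hrate
  have sqrt_gt : 6 < √(n : ℝ) * (δ / 2 * Real.log 2) :=
    sqrt.trans_le (mul_le_mul_of_nonneg_left (by linarith) (Real.sqrt_nonneg _))
  exact (errorProb_le_add_exp hG hgreedy hC hp hp2 hδ hδ1 α_pos.le (by nlinarith) (by nlinarith)
    γ_pos (min_le_left _ _) γ_mul_le β_def β_pos β_lt_one.le hrate log sqrt_gt).trans
      (sum_exp_le_exp_div_log c_pos c_le_noise c_le_marked c_le_unmarked hn log_sq sqrt log)

theorem exists_errorProb_le_of_lt (hG : C.IsGeneratedBy G) (hgreedy : ∀ k, IsGreedyMatrix (G k))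
    (hC : C.IsMaximumLikelihood) (hp : 0 < p) (hp1 : p < 1) (n₀ : ℕ) :
    ∃ c > 0, ∀ k n : ℕ, 2 ≤ n → n < n₀ → k ≤ n →
      C.errorProb p k n ≤ Real.exp (-(c * (n / Real.log n))) := by
  rcases Nat.eq_zero_or_pos n₀ with rfl | hn₀
  · exact ⟨1, one_pos, fun _ _ _ h => absurd h (Nat.not_lt_zero _)⟩
  have log_two_pos : 0 < Real.log 2 := Real.log_pos one_lt_two
  have pow_pos : 0 < (1 - p) ^ n₀ := pow_pos (by linarith) _
  have pow_lt_one : (1 - p) ^ n₀ < 1 := pow_lt_one₀ (by linarith) (by linarith) hn₀.ne'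
  have log_neg : Real.log (1 - (1 - p) ^ n₀) < 0 := Real.log_neg (by linarith) (by linarith)
  have n₀_pos : (0 : ℝ) < n₀ := Nat.cast_pos.mpr hn₀
  refine ⟨-Real.log (1 - (1 - p) ^ n₀) / (n₀ / Real.log 2),
    div_pos (neg_pos.mpr log_neg) (by positivity), fun k n hn hlt hkn => ?_⟩
  calc C.errorProb p k n ≤ 1 - (1 - p) ^ n := errorProb_le_one_sub hG (hgreedy k) hC hp hp1 hkn
    _ ≤ 1 - (1 - p) ^ n₀ :=
        sub_le_sub_left (pow_le_pow_of_le_one (by linarith) (by linarith) hlt.le) _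
    _ = Real.exp (- -Real.log (1 - (1 - p) ^ n₀)) := by rw [neg_neg, Real.exp_log (by linarith)]
    _ ≤ _ := by
        refine Real.exp_le_exp.mpr (neg_le_neg ?_)
        rw [div_mul_eq_mul_div, div_le_iff₀ (by positivity)]
        exact mul_le_mul_of_nonneg_left (div_le_div₀ n₀_pos.le (mod_cast hlt.le) log_two_pos
          (Real.log_le_log two_pos (mod_cast hn))) (neg_pos.mpr log_neg).le

theorem errorProb_exponent (hG : C.IsGeneratedBy G) (hgreedy : ∀ k, IsGreedyMatrix (G k))
    (hC : C.IsMaximumLikelihood) (hp : 0 < p) (hp2 : p < 1 / 2) (hδ : 0 < δ)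
    (hδ1 : δ < 1 - entropy p) :
    ∃ c : ℝ, 0 < c ∧ ∀ k n : ℕ, 2 ≤ n → (k : ℝ) / (1 - entropy p - δ) ≤ (n : ℝ) →
      C.errorProb p k n ≤ Real.exp (-(c * ((n : ℝ) / Real.log n))) := by
  obtain ⟨c₁, c₁_pos, large⟩ := eventually_errorProb_le hG hgreedy hC hp hp2 hδ hδ1
  obtain ⟨n₀, large⟩ := Filter.eventually_atTop.mp large
  obtain ⟨c₂, c₂_pos, small⟩ :=
    exists_errorProb_le_of_lt hG hgreedy hC hp (by linarith) n₀
  refine ⟨min c₁ c₂, lt_min c₁_pos c₂_pos, fun k n hn hkn => ?_⟩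
  have exp_mono {c : ℝ} (hc : min c₁ c₂ ≤ c) :
      Real.exp (-(c * (n / Real.log n))) ≤ Real.exp (-(min c₁ c₂ * (n / Real.log n))) :=
    Real.exp_le_exp.mpr (neg_le_neg (mul_le_mul_of_nonneg_right hc (by positivity)))
  have rate : (k : ℝ) ≤ (1 - entropy p - δ) * n := by
    rwa [div_le_iff₀' (by linarith)] at hkn
  rcases le_or_gt n₀ n with hn₀ | hn₀
  · exact (large n hn₀ k rate).trans (exp_mono (min_le_left _ _))
  · have k_le : (k : ℝ) ≤ n := by
      nlinarith [entropy_pos hp (by linarith), Nat.cast_nonneg (α := ℝ) n]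
    exact (small k n hn hn₀ (mod_cast k_le)).trans (exp_mono (min_le_right _ _))

end Exponent

/-! ### Reasoning about programs -/

/-- The registers that a program may overwrite. -/
def Program.regs : Program → List ℕ
  | .const r _ => [r]
  | .arith _ r _ _ => [r]
  | .load r _ _ => [r]
  | .store _ _ _ => []
  | .seq P Q => P.regs ++ Q.regs
  | .branch _ _ P Q => P.regs ++ Q.regs
  | .loop _ _ P => P.regs

/-- The arrays that a program may overwrite. -/
def Program.arrays : Program → List ℕ
  | .const _ _ => []
  | .arith _ _ _ _ => []
  | .load _ _ _ => []
  | .store A _ _ => [A]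
  | .seq P Q => P.arrays ++ Q.arrays
  | .branch _ _ P Q => P.arrays ++ Q.arrays
  | .loop _ _ P => P.arrays

/-- The states `s` and `s'` agree on everything that `P` does not overwrite. -/
structure Frame (P : Program) (s s' : MachineState) : Prop where
  reg : ∀ r, r ∉ P.regs → s'.reg r = s.reg r
  mem : ∀ A, A ∉ P.arrays → s'.mem A = s.mem A

section Frame

variable {P Q : Program} {s s' s'' : MachineState}

theorem Frame.refl (P : Program) (s : MachineState) : Frame P s s :=
  ⟨fun _ _ => rfl, fun _ _ => rfl⟩

theorem Frame.trans (h : Frame P s s') (h' : Frame P s' s'') : Frame P s s'' :=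
  ⟨fun r hr => (h'.reg r hr).trans (h.reg r hr), fun A hA => (h'.mem A hA).trans (h.mem A hA)⟩

theorem Frame.mono (h : Frame P s s') (hregs : P.regs ⊆ Q.regs)
    (harrays : P.arrays ⊆ Q.arrays) : Frame Q s s' :=
  ⟨fun r hr => h.reg r (mt (@hregs r) hr), fun A hA => h.mem A (mt (@harrays A) hA)⟩

end Frame

section MachineState

variable (s : MachineState)

@[simp] theorem MachineState.setReg_reg (r v r' : ℕ) :
    (s.setReg r v).reg r' = if r' = r then v else s.reg r' := by
  simp [MachineState.setReg, Function.update_apply]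

@[simp] theorem MachineState.setReg_mem (r v : ℕ) : (s.setReg r v).mem = s.mem := rfl

@[simp] theorem MachineState.setMem_reg (A i v : ℕ) : (s.setMem A i v).reg = s.reg := rfl

@[simp] theorem MachineState.setMem_mem (A i v A' : ℕ) :
    (s.setMem A i v).mem A' = if A' = A then Function.update (s.mem A) i v else s.mem A' := by
  simp [MachineState.setMem, Function.update_apply]

theorem Frame.setReg {P : Program} {r : ℕ} (hr : r ∈ P.regs) (v : ℕ) :
    Frame P s (s.setReg r v) :=
  ⟨fun r' hr' => by rw [MachineState.setReg_reg, if_neg (by rintro rfl; exact hr' hr)],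
    fun _ _ => rfl⟩

theorem Frame.setMem {P : Program} {A : ℕ} (hA : A ∈ P.arrays) (i v : ℕ) :
    Frame P s (s.setMem A i v) :=
  ⟨fun _ _ => rfl, fun A' hA' => by
    rw [MachineState.setMem_mem, if_neg (by rintro rfl; exact hA' hA)]⟩

end MachineState

theorem Run.frame {w : ℕ} {P : Program} {s s' : MachineState} {t : ℕ} (h : Run w P s s' t) :
    Frame P s s' := by
  induction h with
  | const s r v => exact .setReg s (List.mem_singleton_self r) v
  | arith s op r => exact .setReg s (List.mem_singleton_self r) _
  | load s r => exact .setReg s (List.mem_singleton_self r) _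
  | store s A => exact .setMem s (List.mem_singleton_self A) _ _
  | seq _ _ ihP ihQ =>
    exact (ihP.mono (List.subset_append_left _ _) (List.subset_append_left _ _)).trans
      (ihQ.mono (List.subset_append_right _ _) (List.subset_append_right _ _))
  | branch_true _ _ ih =>
    exact ih.mono (List.subset_append_left _ _) (List.subset_append_left _ _)
  | branch_false _ _ ih =>
    exact ih.mono (List.subset_append_right _ _) (List.subset_append_right _ _)
  | loop_true _ _ _ ihP ihL => exact .trans ⟨ihP.reg, ihP.mem⟩ ihL
  | loop_false => exact Frame.refl _ _

/-- Total correctness with running time, as a weakest precondition: program `P`, started in state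
`s`, halts, and its final state and running time satisfy `Q`. -/
def WP (w : ℕ) (P : Program) (s : MachineState) (Q : MachineState → ℕ → Prop) : Prop :=
  ∃ s' t, Run w P s s' t ∧ Q s' t

/-- `for i < b do P`, where register `2` holds the number one. -/
def Program.forLoop (i b : ℕ) (P : Program) : Program :=
  .seq (.const i 0) (.loop i b (.seq P (.arith .add i i 2)))

/-- A single step that changes only an auxiliary register. -/
def Program.skip : Program := .const 31 0

/-- `P; Q; …` -/
def Program.block : List Program → Program
  | [] => .skip
  | [P] => P
  | P :: Q :: L => .seq P (Program.block (Q :: L))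

attribute [simp] Program.block ArithOp.eval

section WP

variable {w : ℕ} {s : MachineState} {P P' : Program} {Q Q' : MachineState → ℕ → Prop}

theorem WP.mono (h : WP w P s Q) (hQ : ∀ s' t, Q s' t → Q' s' t) : WP w P s Q' := by
  obtain ⟨s', t, hrun, hQs'⟩ := h
  exact ⟨s', t, hrun, hQ _ _ hQs'⟩

theorem WP.frame (h : WP w P s Q) : WP w P s fun s' t => Q s' t ∧ Frame P s s' := by
  obtain ⟨s', t, hrun, hQ⟩ := h
  exact ⟨s', t, hrun, hQ, hrun.frame⟩

@[simp] theorem wp_const {r v : ℕ} : WP w (.const r v) s Q ↔ v < 2 ^ w ∧ Q (s.setReg r v) 1 := by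
  constructor
  · rintro ⟨s', t, hrun, hQ⟩
    cases hrun with
    | const _ _ _ h => exact ⟨h, hQ⟩
  · rintro ⟨h, hQ⟩
    exact ⟨_, _, .const s r v h, hQ⟩

@[simp] theorem wp_arith {op : ArithOp} {r a b : ℕ} : WP w (.arith op r a b) s Q ↔
    op.eval (s.reg a) (s.reg b) < 2 ^ w ∧ Q (s.setReg r (op.eval (s.reg a) (s.reg b))) 1 := by
  constructor
  · rintro ⟨s', t, hrun, hQ⟩
    cases hrun with
    | arith _ _ _ _ _ h => exact ⟨h, hQ⟩
  · rintro ⟨h, hQ⟩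
    exact ⟨_, _, .arith s op r a b h, hQ⟩

@[simp] theorem wp_load {r A i : ℕ} :
    WP w (.load r A i) s Q ↔ Q (s.setReg r (s.mem A (s.reg i))) 1 := by
  constructor
  · rintro ⟨s', t, hrun, hQ⟩
    cases hrun
    exact hQ
  · exact fun hQ => ⟨_, _, .load s r A i, hQ⟩

@[simp] theorem wp_store {A i r : ℕ} :
    WP w (.store A i r) s Q ↔ Q (s.setMem A (s.reg i) (s.reg r)) 1 := by
  constructor
  · rintro ⟨s', t, hrun, hQ⟩
    cases hrun
    exact hQ
  · exact fun hQ => ⟨_, _, .store s A i r, hQ⟩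

@[simp] theorem wp_seq : WP w (.seq P P') s Q ↔
    WP w P s fun s₁ t₁ => WP w P' s₁ fun s₂ t₂ => Q s₂ (t₁ + t₂) := by
  constructor
  · rintro ⟨s', t, hrun, hQ⟩
    cases hrun with
    | seq hP hP' => exact ⟨_, _, hP, _, _, hP', hQ⟩
  · rintro ⟨s₁, t₁, hP, s₂, t₂, hP', hQ⟩
    exact ⟨_, _, .seq hP hP', hQ⟩

@[simp] theorem wp_branch {a b : ℕ} : WP w (.branch a b P P') s Q ↔
    if s.reg a < s.reg b then WP w P s fun s' t => Q s' (t + 1)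
    else WP w P' s fun s' t => Q s' (t + 1) := by
  constructor
  · rintro ⟨s', t, hrun, hQ⟩
    cases hrun with
    | branch_true h hP => rw [if_pos h]; exact ⟨_, _, hP, hQ⟩
    | branch_false h hP' => rw [if_neg h]; exact ⟨_, _, hP', hQ⟩
  · intro h
    split_ifs at h with hab
    · obtain ⟨s', t, hP, hQ⟩ := h
      exact ⟨_, _, .branch_true hab hP, hQ⟩
    · obtain ⟨s', t, hP', hQ⟩ := h
      exact ⟨_, _, .branch_false hab hP', hQ⟩

@[simp] theorem wp_skip : WP w .skip s Q ↔ Q (s.setReg 31 0) 1 := by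
  rw [Program.skip, wp_const]
  exact and_iff_right (by positivity)

theorem wp_loop {a b T j : ℕ} (J : ℕ → MachineState → Prop)
    (hguard : ∀ j s, J j s → (s.reg a < s.reg b ↔ 0 < j))
    (hbody : ∀ j s, J (j + 1) s → WP w P s fun s' t => t ≤ T ∧ J j s') (h : J j s) :
    WP w (.loop a b P) s fun s' t => t ≤ j * (T + 1) + 1 ∧ J 0 s' := by
  induction j generalizing s with
  | zero => exact ⟨s, 1, .loop_false (by simp [hguard 0 s h]), by lia, h⟩
  | succ j ih =>
    obtain ⟨s₁, t₁, hP, ht₁, hJ⟩ := hbody j s h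
    obtain ⟨s₂, t₂, hloop, ht₂, hJ₀⟩ := ih hJ
    exact ⟨s₂, _, .loop_true (by simp [hguard _ s h]) hP hloop, by lia, hJ₀⟩

theorem wp_for {i b N T : ℕ} (I : ℕ → MachineState → Prop)
    (hreg : i ∉ P.regs ∧ b ∉ P.regs ∧ 2 ∉ P.regs ∧ i ≠ b ∧ i ≠ 2)
    (hone : s.reg 2 = 1) (hb : s.reg b = N) (hw : N < 2 ^ w)
    (hI : ∀ m s v, I m s → I m (s.setReg i v)) (hI0 : I 0 s)
    (hstep : ∀ m < N, ∀ s₁, Frame (.forLoop i b P) s s₁ → s₁.reg i = m → I m s₁ →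
      WP w P s₁ fun s₂ t => t ≤ T ∧ I (m + 1) s₂) :
    WP w (.forLoop i b P) s fun s' t =>
      t ≤ N * (T + 2) + 2 ∧ I N s' ∧ Frame (.forLoop i b P) s s' := by
  obtain ⟨hi, hbP, h2, hib, hi2⟩ := hreg
  have hi_mem : i ∈ (Program.forLoop i b P).regs := by simp [Program.forLoop, Program.regs]
  have frame_body {s₁ s₂} (h : Frame P s₁ s₂) : Frame (.forLoop i b P) s₁ s₂ :=
    h.mono (fun r hr => by simp [Program.forLoop, Program.regs, hr])
      (fun A hA => by simp [Program.forLoop, Program.arrays, hA])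
  have fixed {s₁} (h : Frame (.forLoop i b P) s s₁) : s₁.reg b = N ∧ s₁.reg 2 = 1 :=
    ⟨(h.reg b (by simp [Program.forLoop, Program.regs, hbP, hib.symm])).trans hb,
      (h.reg 2 (by simp [Program.forLoop, Program.regs, h2, hi2.symm])).trans hone⟩
  have hloop : WP w (.loop i b (.seq P (.arith .add i i 2))) (s.setReg i 0) fun s' t =>
      t ≤ N * (T + 1 + 1) + 1 ∧ ∃ m, m + 0 = N ∧ Frame (.forLoop i b P) s s' ∧
        s'.reg i = m ∧ I m s' := by
    refine wp_loop (fun j s₁ => ∃ m, m + j = N ∧ Frame (.forLoop i b P) s s₁ ∧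
      s₁.reg i = m ∧ I m s₁) ?_ ?_ ⟨0, by simp, .setReg s hi_mem 0, by simp, hI _ _ _ hI0⟩
    · rintro j s₁ ⟨m, hmj, hframe, him, -⟩
      rw [him, (fixed hframe).1]
      lia
    · rintro j s₁ ⟨m, hmj, hframe, him, hIm⟩
      refine wp_seq.mpr ((hstep m (by lia) s₁ hframe him hIm).frame.mono ?_)
      rintro s₂ t ⟨⟨ht, hIm⟩, hframeP⟩
      have hframe₂ := hframe.trans (frame_body hframeP)
      have hnext : ArithOp.add.eval (s₂.reg i) (s₂.reg 2) = m + 1 := by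
        rw [hframeP.reg i hi, him, (fixed hframe₂).2, ArithOp.eval]
      rw [wp_arith, hnext]
      exact ⟨by lia, by lia, m + 1, by lia, hframe₂.trans (.setReg s₂ hi_mem _), by simp,
        hI _ _ _ hIm⟩
  rw [Program.forLoop, wp_seq, wp_const]
  refine ⟨by positivity, hloop.mono ?_⟩
  rintro s' t ⟨ht, m, rfl, hframe, -, hIm⟩
  exact ⟨by lia, hIm, hframe⟩

end WP

/-! ### The greedy step as a program -/

/-- `P` overwrites neither the registers `0` to `6` nor the array `7`, which hold the data shared
by all programs below; see `Context`. -/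
abbrev Program.KeepsContext (P : Program) : Prop := (∀ r < 7, r ∉ P.regs) ∧ 7 ∉ P.arrays

/-- The conventions that hold throughout the programs below: `k` and `n` are in registers `0` and
`1`, registers `2` to `6` hold constants, array `7` is a table of inner products, and the word size
suffices. -/
structure Context (k n w : ℕ) (s : MachineState) : Prop where
  reg0 : s.reg 0 = k
  reg1 : s.reg 1 = n
  reg2 : s.reg 2 = 1
  reg3 : s.reg 3 = 2 ^ k
  reg4 : s.reg 4 = 2
  reg5 : s.reg 5 = 8
  reg6 : s.reg 6 = 0
  table : ∀ a < 2 ^ k, ∀ b < 2 ^ k, s.mem 7 (a * 2 ^ k + b) = bitDot k a b % 2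
  fits : 64 * ((2 ^ k * 2 ^ k) * ((n + 1) * (n + 1))) ≤ 2 ^ w

namespace Context

variable {k n w : ℕ} {s s' : MachineState} {P : Program}

theorem of_frame (h : Context k n w s) (hf : Frame P s s') (hP : P.KeepsContext) :
    Context k n w s' where
  reg0 := (hf.reg 0 (hP.1 0 (by norm_num))).trans h.reg0
  reg1 := (hf.reg 1 (hP.1 1 (by norm_num))).trans h.reg1
  reg2 := (hf.reg 2 (hP.1 2 (by norm_num))).trans h.reg2
  reg3 := (hf.reg 3 (hP.1 3 (by norm_num))).trans h.reg3
  reg4 := (hf.reg 4 (hP.1 4 (by norm_num))).trans h.reg4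
  reg5 := (hf.reg 5 (hP.1 5 (by norm_num))).trans h.reg5
  reg6 := (hf.reg 6 (hP.1 6 (by norm_num))).trans h.reg6
  table := by rw [hf.mem 7 hP.2]; exact h.table
  fits := h.fits

theorem setReg (h : Context k n w s) {r : ℕ} (hr : 7 ≤ r) (v : ℕ) :
    Context k n w (s.setReg r v) :=
  h.of_frame (P := .const r v) (.setReg s (List.mem_singleton_self r) v)
    ⟨fun r' hr' => by simp only [Program.regs, List.mem_singleton]; lia, List.not_mem_nil⟩

theorem fits_of_le (h : Context k n w s) {a b : ℕ} (ha : a ≤ 2 ^ k * 2 ^ k)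
    (hb : b ≤ (n + 1) * (n + 1)) : 64 * (a * b) ≤ 2 ^ w :=
  (Nat.mul_le_mul_left 64 (Nat.mul_le_mul ha hb)).trans h.fits

theorem words_fit (h : Context k n w s) : 64 * 2 ^ k ≤ 2 ^ w := by
  simpa using h.fits_of_le (Nat.le_mul_of_pos_left (2 ^ k) (by positivity))
    (show 1 ≤ (n + 1) * (n + 1) by lia)

theorem pairs_fit (h : Context k n w s) : 64 * (2 ^ k * 2 ^ k) ≤ 2 ^ w := by
  simpa using h.fits_of_le le_rfl (show 1 ≤ (n + 1) * (n + 1) by lia)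

theorem sq_fits (h : Context k n w s) : 64 * ((n + 1) * (n + 1)) ≤ 2 ^ w := by
  simpa using h.fits_of_le (show 1 ≤ 2 ^ k * 2 ^ k from Nat.one_le_iff_ne_zero.mpr (by positivity))
    le_rfl

theorem wp_forWords (h : Context k n w s) {i T : ℕ} (I : ℕ → MachineState → Prop)
    (hP : (Program.forLoop i 3 P).KeepsContext ∧ i ∉ P.regs)
    (hI : ∀ m s v, I m s → I m (s.setReg i v)) (hI0 : I 0 s)
    (hstep : ∀ m < 2 ^ k, ∀ s₁, Frame (.forLoop i 3 P) s s₁ → Context k n w s₁ → s₁.reg i = m →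
      I m s₁ → WP w P s₁ fun s₂ t => t ≤ T ∧ I (m + 1) s₂) :
    WP w (.forLoop i 3 P) s fun s' t => t ≤ 2 ^ k * (T + 2) + 2 ∧ I (2 ^ k) s' := by
  have hkeeps : ∀ r < 7, r ≠ i ∧ r ∉ P.regs := fun r hr => by
    simpa [Program.forLoop, Program.regs, and_comm, or_imp, forall_and, not_or]
      using hP.1.1 r hr
  refine (wp_for I ⟨hP.2, (hkeeps 3 (by lia)).2, (hkeeps 2 (by lia)).2,
    (hkeeps 3 (by lia)).1.symm, (hkeeps 2 (by lia)).1.symm⟩ h.reg2 h.reg3 ?_ hI hI0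
    fun m hm s₁ hf him hIm => hstep m hm s₁ hf (h.of_frame hf hP.1) him hIm).mono
    fun s' t hs' => ⟨hs'.1, hs'.2.1⟩
  have := h.words_fit
  have := Nat.one_le_two_pow (n := k)
  lia

end Context

section WeightSum

variable {wt f : ℕ → ℕ} {m : ℕ}

/-- The sum of `f` over the numbers below `m` of weight `c`, where `wt` is the table of weights. The
tables kept by the programs below have this form, for the numerals `0, …, m - 1` of words. -/
def weightSum (m : ℕ) (wt f : ℕ → ℕ) (c : ℕ) : ℕ :=
  ∑ x ∈ range m, if wt x = c then f x else 0

theorem weightSum_zero (wt f : ℕ → ℕ) : weightSum 0 wt f = 0 := rfl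

theorem weightSum_succ (m : ℕ) (wt f : ℕ → ℕ) (c : ℕ) :
    weightSum (m + 1) wt f c = weightSum m wt f c + if wt m = c then f m else 0 :=
  sum_range_succ _ _

theorem weightSum_succ_of_eq_zero (hf : f m = 0) : weightSum (m + 1) wt f = weightSum m wt f := by
  ext c
  simp [weightSum_succ, hf]

theorem update_weightSum (m : ℕ) (wt f : ℕ → ℕ) :
    Function.update (weightSum m wt f) (wt m) (weightSum m wt f (wt m) + f m) =
      weightSum (m + 1) wt f := by
  ext c
  rw [Function.update_apply, weightSum_succ]
  by_cases h : wt m = c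
  · simp [h]
  · simp [h, Ne.symm h]

theorem weightSum_le (m : ℕ) (wt : ℕ → ℕ) (hf : ∀ x, f x ≤ 1) (c : ℕ) :
    weightSum m wt f c ≤ m := by
  refine (sum_le_card_nsmul _ _ 1 fun x _ => ?_).trans (by simp)
  split_ifs
  exacts [hf x, zero_le_one]

theorem weightSum_eq_zero {c : ℕ} (h : ∀ x < m, wt x ≠ c) : weightSum m wt f c = 0 :=
  sum_eq_zero fun x hx => if_neg (h x (mem_range.mp hx))

/-- The restriction of `f` to the numerals that are not marked in the table `mk`. -/
def unmarked (mk f : ℕ → ℕ) (x : ℕ) : ℕ := if mk x = 0 then f x else 0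

theorem unmarked_of_eq_zero {mk : ℕ → ℕ} {x : ℕ} (h : mk x = 0) (f : ℕ → ℕ) :
    unmarked mk f x = f x := if_pos h

theorem unmarked_of_ne_zero {mk : ℕ → ℕ} {x : ℕ} (h : mk x ≠ 0) (f : ℕ → ℕ) :
    unmarked mk f x = 0 := if_neg h

theorem unmarked_le {mk : ℕ → ℕ} (hf : ∀ x, f x ≤ 1) (x : ℕ) : unmarked mk f x ≤ 1 := by
  rw [unmarked]
  split_ifs
  exacts [hf x, zero_le_one]

/-- The inner product over the field with two elements, on numerals. -/
def dotBit (k r x : ℕ) : ℕ := bitDot k r x % 2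

theorem dotBit_le (k r x : ℕ) : dotBit k r x ≤ 1 := Nat.lt_succ_iff.mp (Nat.mod_lt _ two_pos)

end WeightSum

/-- The data of the greedy algorithm on the machine: `N` rows are present, and the arrays `2`, `3`,
`4` and `6` contain, for each numeral, its weight `wt` and its mark `mk`, and, for each weight,
a number `cnt` of words and a number `elev` of elevated words. -/
structure Tables (k n w N : ℕ) (wt mk cnt elev : ℕ → ℕ) (s : MachineState) : Prop
    extends Context k n w s where
  rows : s.reg 20 = N
  rows_le : N ≤ n
  weights : s.mem 2 = wt
  marks : s.mem 3 = mk
  counts : s.mem 4 = cnt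
  elevs : s.mem 6 = elev

section GreedyStep

variable {k n w N d r : ℕ} {wt mk cnt elev : ℕ → ℕ} {s s' : MachineState} {P : Program}

theorem Tables.of_frame (h : Tables k n w N wt mk cnt elev s) (hf : Frame P s s')
    (hP : P.KeepsContext ∧ 20 ∉ P.regs ∧ 2 ∉ P.arrays) :
    Tables k n w N wt (s'.mem 3) (s'.mem 4) (s'.mem 6) s' where
  toContext := h.toContext.of_frame hf hP.1
  rows := (hf.reg 20 hP.2.1).trans h.rows
  rows_le := h.rows_le
  weights := (hf.mem 2 hP.2.2).trans h.weights
  marks := rfl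
  counts := rfl
  elevs := rfl

theorem Tables.of_frame_of_disjoint (h : Tables k n w N wt mk cnt elev s) (hf : Frame P s s')
    (hP : P.KeepsContext ∧ 20 ∉ P.regs ∧ ∀ A ∈ [2, 3, 4, 6], A ∉ P.arrays) :
    Tables k n w N wt mk cnt elev s' := by
  have h' := h.of_frame hf ⟨hP.1, hP.2.1, hP.2.2 2 (by simp)⟩
  rwa [hf.mem 3 (hP.2.2 3 (by simp)), hf.mem 4 (hP.2.2 4 (by simp)),
    hf.mem 6 (hP.2.2 6 (by simp)), h.marks, h.counts, h.elevs] at h'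

theorem Tables.setReg (h : Tables k n w N wt mk cnt elev s) (hr : 7 ≤ r ∧ r ≠ 20) (v : ℕ) :
    Tables k n w N wt mk cnt elev (s.setReg r v) where
  toContext := h.toContext.setReg hr.1 v
  rows := by simpa [hr.2.symm] using h.rows
  rows_le := h.rows_le
  weights := h.weights
  marks := h.marks
  counts := h.counts
  elevs := h.elevs

/-- Count, for every weight, the unmarked words. -/
def countUnmarked : Program :=
  .forLoop 10 3 <| .block [.load 11 2 10, .load 12 3 10,
    .branch 12 2 (.block [.load 13 4 11, .arith .add 13 13 2, .store 4 11 13]) .skip]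

theorem wp_countUnmarked (h : Tables k n w N wt mk 0 elev s) :
    WP w countUnmarked s fun s' t => t ≤ 2 ^ k * 32 + 2 ∧
      Tables k n w N wt mk (weightSum (2 ^ k) wt (unmarked mk 1)) elev s' := by
  refine (h.wp_forWords (T := 30) (fun m s' => s'.mem 4 = weightSum m wt (unmarked mk 1))
    (by decide) (fun _ _ _ h => h) h.counts ?_).frame.mono ?_
  · intro m hm s₁ hf hc hi hcnt
    have hwt := (hf.mem 2 (by decide)).trans h.weights
    have hmk := (hf.mem 3 (by decide)).trans h.marks
    have hle := weightSum_le (f := unmarked mk 1) m wt (unmarked_le fun _ => le_rfl) (wt m)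
    have hfit := hc.words_fit
    simp only [Program.block, wp_seq, wp_load, wp_arith, wp_store, wp_branch, wp_skip,
      MachineState.setReg_reg, MachineState.setReg_mem, MachineState.setMem_mem, ArithOp.eval,
      ↓reduceIte, Nat.reduceEqDiff, hi, hwt, hmk, hc.reg2, hcnt, Nat.lt_one_iff]
    split_ifs with hm0
    · have hone : unmarked mk 1 m = 1 := unmarked_of_eq_zero hm0 1
      refine ⟨by lia, by lia, ?_⟩
      rw [← update_weightSum, hone]
    · exact ⟨by lia, (weightSum_succ_of_eq_zero (unmarked_of_ne_zero hm0 1)).symm⟩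
  · rintro s' t ⟨⟨ht, hcnt⟩, hf⟩
    have h' := h.of_frame hf (by decide)
    rw [hf.mem 3 (by decide), h.marks, hcnt, hf.mem 6 (by decide), h.elevs] at h'
    exact ⟨ht, h'⟩

/-- The marks after marking the words of all weights with less than `2 * N ^ 2` unmarked words,
whose numbers are given by `cnt`. -/
def nextMarks (k N : ℕ) (wt mk cnt : ℕ → ℕ) (x : ℕ) : ℕ :=
  if x < 2 ^ k ∧ cnt (wt x) < 2 * N ^ 2 then 1 else mk x

/-- Mark all weight classes with few unmarked words. -/
def markClasses : Program :=
  .block [.arith .mul 14 20 20, .arith .add 14 14 14, .forLoop 10 3 <|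
    .block [.load 11 2 10, .load 13 4 11, .branch 13 14 (.store 3 10 2) .skip]]

theorem wp_markClasses (h : Tables k n w N wt mk cnt elev s) :
    WP w markClasses s fun s' t => t ≤ 2 ^ k * 32 + 4 ∧
      Tables k n w N wt (nextMarks k N wt mk cnt) cnt elev s' := by
  have hNN : N * N ≤ (n + 1) * (n + 1) := Nat.mul_le_mul (by have := h.rows_le; lia)
    (by have := h.rows_le; lia)
  have hfit := h.sq_fits
  suffices WP w markClasses s fun s' t => t ≤ 2 ^ k * 32 + 4 ∧
      s'.mem 3 = nextMarks k N wt mk cnt by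
    refine this.frame.mono fun s' t ⟨⟨ht, hmk⟩, hf⟩ => ⟨ht, ?_⟩
    have h' := h.of_frame hf (by decide)
    rwa [hmk, hf.mem 4 (by decide), h.counts, hf.mem 6 (by decide), h.elevs] at h'
  simp only [markClasses, Program.block, wp_seq, wp_arith, MachineState.setReg_reg, ArithOp.eval,
    ↓reduceIte, h.rows]
  refine ⟨by lia, by lia, ?_⟩
  have hc := (h.setReg (r := 14) (by lia) (N * N)).setReg (r := 14) (by lia) (N * N + N * N)
  refine (hc.wp_forWords (T := 30) (fun m s' => s'.mem 3 = fun x =>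
    if x < m ∧ cnt (wt x) < 2 * N ^ 2 then 1 else mk x)
    (by decide) (fun _ _ _ h => h) (by simp [h.marks]) ?_).mono
    fun s' t hs' => ⟨by lia, hs'.2⟩
  intro m _ s₁ hf hc₁ hi hmk
  have hwt := (hf.mem 2 (by decide)).trans h.weights
  have hcnt := (hf.mem 4 (by decide)).trans h.counts
  have hbound := hf.reg 14 (by decide)
  simp only [MachineState.setReg_reg, ↓reduceIte] at hbound
  simp only [wp_seq, wp_load, wp_store, wp_branch, wp_skip,
    MachineState.setReg_reg, MachineState.setReg_mem, MachineState.setMem_mem,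
    ↓reduceIte, Nat.reduceEqDiff, hi, hwt, hmk, hc₁.reg2, hcnt, hbound]
  rw [show N * N + N * N = 2 * N ^ 2 by ring]
  split_ifs with hlt
  · refine ⟨by lia, funext fun x => ?_⟩
    grind [Function.update_apply]
  · refine ⟨by lia, funext fun x => ?_⟩
    grind

/-- `d` is the minimum positive weight of a word, or `N + 1` if there is no word of positive weight
(which happens only for `k = 0`). -/
def IsMinWeight (k N : ℕ) (wt : ℕ → ℕ) (d : ℕ) : Prop :=
  0 < d ∧ (∀ x < 2 ^ k, 0 < wt x → d ≤ wt x) ∧ (d = N + 1 ∨ ∃ x < 2 ^ k, wt x = d)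

/-- Find the minimum positive weight. -/
def findMinWeight : Program :=
  .block [.arith .add 15 20 2, .forLoop 10 3 <| .block [.load 11 2 10,
    .branch 11 15 (.branch 6 11 (.arith .add 15 11 6) .skip) .skip]]

theorem wp_findMinWeight (h : Tables k n w N wt mk cnt elev s) :
    WP w findMinWeight s fun s' t => t ≤ 2 ^ k * 32 + 4 ∧
      Tables k n w N wt mk cnt elev s' ∧ IsMinWeight k N wt (s'.reg 15) := by
  suffices WP w findMinWeight s fun s' t => t ≤ 2 ^ k * 32 + 4 ∧
      IsMinWeight k N wt (s'.reg 15) by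
    exact this.frame.mono fun s' t ⟨⟨ht, hd⟩, hf⟩ =>
      ⟨ht, h.of_frame_of_disjoint hf (by decide), hd⟩
  have hNn := h.rows_le
  have hfit : 64 * (1 * (n + 1)) ≤ 2 ^ w :=
    h.fits_of_le (Nat.one_le_iff_ne_zero.mpr (by positivity)) (by nlinarith)
  simp only [findMinWeight, Program.block, wp_seq, wp_arith, ArithOp.eval, h.rows, h.reg2]
  refine ⟨by lia, ?_⟩
  refine ((h.setReg (r := 15) (by lia) (N + 1)).wp_forWords (T := 30)
    (fun m s' => 0 < s'.reg 15 ∧ s'.reg 15 ≤ N + 1 ∧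
      (∀ x < m, 0 < wt x → s'.reg 15 ≤ wt x) ∧
      (s'.reg 15 = N + 1 ∨ ∃ x < m, wt x = s'.reg 15))
    (by decide) (fun _ _ _ h => by simpa using h) (by simp) ?_).mono
    fun s' t ⟨_, hpos, _, hmin⟩ => ⟨by lia, hpos, hmin⟩
  intro m _ s₁ hf hc₁ hi ⟨hpos, hle, hmin, hattained⟩
  have hwt := (hf.mem 2 (by decide)).trans h.weights
  have hattained' : s₁.reg 15 = N + 1 ∨ ∃ x < m + 1, wt x = s₁.reg 15 :=
    hattained.imp_right fun ⟨x, hx, hxd⟩ => ⟨x, by lia, hxd⟩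
  simp only [wp_seq, wp_load, wp_arith, wp_branch, wp_skip, MachineState.setReg_reg,
    ArithOp.eval, ↓reduceIte, Nat.reduceEqDiff, hi, hwt, hc₁.reg6, Nat.add_zero]
  split_ifs with hlt hx0
  · exact ⟨by lia, by lia, hx0, by lia, by grind, .inr ⟨m, by lia, rfl⟩⟩
  · exact ⟨by lia, hpos, hle, by grind, hattained'⟩
  · exact ⟨by lia, hpos, hle, by grind, hattained'⟩

/-- Count the words of minimum positive weight. -/
def countMinWeight : Program :=
  .block [.const 16 0, .forLoop 10 3 <| .block [.load 11 2 10,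
    .branch 11 15 .skip (.branch 15 11 .skip (.arith .add 16 16 2))]]

theorem wp_countMinWeight (h : Tables k n w N wt mk cnt elev s) (hd : s.reg 15 = d) :
    WP w countMinWeight s fun s' t => t ≤ 2 ^ k * 32 + 4 ∧
      Tables k n w N wt mk cnt elev s' ∧ s'.reg 15 = d ∧
      s'.reg 16 = weightSum (2 ^ k) wt 1 d := by
  suffices WP w countMinWeight s fun s' t => t ≤ 2 ^ k * 32 + 4 ∧
      s'.reg 16 = weightSum (2 ^ k) wt 1 d by
    exact this.frame.mono fun s' t ⟨⟨ht, hsum⟩, hf⟩ =>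
      ⟨ht, h.of_frame_of_disjoint hf (by decide), (hf.reg 15 (by decide)).trans hd, hsum⟩
  simp only [countMinWeight, Program.block, wp_seq, wp_const]
  refine ⟨by positivity, ((h.setReg (r := 16) (by lia) 0).wp_forWords (T := 30)
    (fun m s' => s'.reg 16 = weightSum m wt 1 d) (by decide) (fun _ _ _ h => by simpa using h)
    (by simp [weightSum_zero]) ?_).mono fun s' t hs' => ⟨by lia, hs'.2⟩⟩
  intro m hm s₁ hf hc₁ hi hsum
  have hwt := (hf.mem 2 (by decide)).trans h.weights
  have hd₁ := (hf.reg 15 (by decide)).trans hd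
  have hle := weightSum_le (f := 1) m wt (fun _ => le_rfl) d
  have hfit := h.words_fit
  simp only [wp_seq, wp_load, wp_arith, wp_branch, wp_skip,
    MachineState.setReg_reg, ArithOp.eval, ↓reduceIte, Nat.reduceEqDiff, hi, hwt, hc₁.reg2, hd₁,
    hsum, weightSum_succ, Pi.one_apply]
  split_ifs <;> lia

/-- Add the word whose numeral is in register `10` to the counts of elevated words: to the count
for its weight if it is unmarked, and to the count in register `24` if its weight is minimal. -/
def tallyWord : Program :=
  .block [.load 11 2 10, .load 12 3 10, .arith .add 13 30 10, .load 13 7 13,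
    .branch 12 2 (.block [.load 14 6 11, .arith .add 14 14 13, .store 6 11 14]) .skip,
    .branch 11 15 .skip (.branch 15 11 .skip (.arith .add 24 24 13))]

theorem wp_tallyWord {m : ℕ} (hc : Context k n w s) (hwt : s.mem 2 = wt) (hmk : s.mem 3 = mk)
    (hd : s.reg 15 = d) (hoffset : s.reg 30 = r * 2 ^ k) (hrk : r < 2 ^ k) (hm : s.reg 10 = m)
    (hmk_lt : m < 2 ^ k) (helev : s.mem 6 = weightSum m wt (unmarked mk (dotBit k r)))
    (hsum : s.reg 24 = weightSum m wt (dotBit k r) d) :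
    WP w tallyWord s fun s' t => t ≤ 30 ∧
      s'.mem 6 = weightSum (m + 1) wt (unmarked mk (dotBit k r)) ∧
      s'.reg 24 = weightSum (m + 1) wt (dotBit k r) d := by
  have hdot : s.mem 7 (r * 2 ^ k + m) = dotBit k r m := hc.table r hrk m hmk_lt
  have hpairs := hc.pairs_fit
  have haddr : r * 2 ^ k + m < 2 ^ k * 2 ^ k := by nlinarith
  have hwords := hc.words_fit
  have hbit := dotBit_le k r m
  have helev_le := weightSum_le m wt (unmarked_le (mk := mk) (dotBit_le k r)) (wt m)
  have hsum_le := weightSum_le m wt (dotBit_le k r) d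
  simp only [tallyWord, Program.block, wp_seq, wp_load, wp_arith, wp_store, wp_branch, wp_skip,
    MachineState.setReg_reg, MachineState.setReg_mem, MachineState.setMem_mem,
    MachineState.setMem_reg, ArithOp.eval, ↓reduceIte, Nat.reduceEqDiff, hm, hwt, hmk, hc.reg2,
    hd, hoffset, hdot, helev, hsum, Nat.lt_one_iff, weightSum_succ]
  refine ⟨by lia, ?_⟩
  by_cases hm0 : mk m = 0
  · have hval : unmarked mk (dotBit k r) m = dotBit k r m := unmarked_of_eq_zero hm0 _
    rw [if_pos hm0, ← update_weightSum, hval]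
    refine ⟨by lia, ?_⟩
    split_ifs <;> lia
  · rw [if_neg hm0, weightSum_succ_of_eq_zero (unmarked_of_ne_zero hm0 _)]
    split_ifs <;> lia

/-- Count, for every weight, the unmarked words that are elevated by the candidate in register
`23`, and count the elevated words of minimum positive weight. -/
def tally : Program :=
  .block [.const 24 0, .arith .mul 30 23 3, .forLoop 10 3 tallyWord]

theorem wp_tally (h : Tables k n w N wt mk cnt 0 s) (hr : s.reg 23 = r) (hrk : r < 2 ^ k)
    (hd : s.reg 15 = d) :
    WP w tally s fun s' t => t ≤ 2 ^ k * 32 + 5 ∧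
      Tables k n w N wt mk cnt (weightSum (2 ^ k) wt (unmarked mk (dotBit k r))) s' ∧
      s'.reg 24 = weightSum (2 ^ k) wt (dotBit k r) d := by
  suffices WP w tally s fun s' t => t ≤ 2 ^ k * 32 + 5 ∧
      s'.mem 6 = weightSum (2 ^ k) wt (unmarked mk (dotBit k r)) ∧
      s'.reg 24 = weightSum (2 ^ k) wt (dotBit k r) d by
    refine this.frame.mono fun s' t ⟨⟨ht, helev, hsum⟩, hf⟩ => ⟨ht, ?_, hsum⟩
    have h' := h.of_frame hf (by decide)
    rwa [hf.mem 3 (by decide), h.marks, hf.mem 4 (by decide), h.counts, helev] at h'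
  have hoffset : r * 2 ^ k < 2 ^ w := by
    have := h.pairs_fit
    have := Nat.mul_lt_mul_of_pos_right hrk (show 0 < 2 ^ k by positivity)
    lia
  have hc := (h.setReg (r := 24) (by lia) 0).setReg (r := 30) (by lia) (r * 2 ^ k)
  simp only [tally, Program.block, wp_seq, wp_const, wp_arith, ArithOp.eval,
    MachineState.setReg_reg, ↓reduceIte, Nat.reduceEqDiff, hr, h.reg3]
  refine ⟨by positivity, hoffset, (hc.wp_forWords (T := 30) (fun m s' =>
      s'.mem 6 = weightSum m wt (unmarked mk (dotBit k r)) ∧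
      s'.reg 24 = weightSum m wt (dotBit k r) d)
    (by decide) (fun _ _ _ h => by simpa using h) (by simp [weightSum_zero, h.elevs]) ?_).mono
    fun s' t hs' => ⟨by lia, hs'.2⟩⟩
  exact fun m hm s₁ hf hc₁ hi ⟨helev, hsum⟩ =>
    wp_tallyWord hc₁ ((hf.mem 2 (by decide)).trans h.weights)
      ((hf.mem 3 (by decide)).trans h.marks) ((hf.reg 15 (by decide)).trans hd)
      (by rw [hf.reg 30 (by decide)]; simp) hrk hi hm helev hsum

/-- The absolute value of `c - 2 * e`, written with truncated subtraction. -/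
def gap (c e : ℕ) : ℕ := c - (e + e) + (e + e - c)

/-- The condition for `e` elevated words among `c` words to be a `1 / (2 √N)`-split, in integer
arithmetic. -/
def Balanced (N c e : ℕ) : Prop := gap c e * gap c e * N ≤ c * c

/-- Clear the flag in register `25` if the word whose numeral is in register `10` is unmarked and
its class is not split. -/
def checkSplit : Program :=
  .block [.load 12 3 10, .branch 12 2 (.block [
    .load 11 2 10, .load 13 4 11, .load 14 6 11, .arith .add 14 14 14, .arith .sub 17 13 14,
    .arith .sub 18 14 13, .arith .add 17 17 18, .arith .mul 17 17 17, .arith .mul 17 17 20,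
    .arith .mul 18 13 13, .branch 18 17 (.const 25 0) .skip]) .skip]

open Classical in
theorem wp_checkSplit {m : ℕ} (h : Tables k n w N wt mk cnt elev s) (hm : s.reg 10 = m)
    (hcnt : ∀ c, cnt c ≤ 2 ^ k) (helev : ∀ c, elev c ≤ 2 ^ k) :
    WP w checkSplit s fun s' t => t ≤ 30 ∧
      s'.reg 25 = if mk m = 0 → Balanced N (cnt (wt m)) (elev (wt m)) then s.reg 25 else 0 := by
  have hc := hcnt (wt m)
  have he := helev (wt m)
  have hpairs := h.pairs_fit
  have hwords := h.words_fit
  have hgap : gap (cnt (wt m)) (elev (wt m)) ≤ 2 * 2 ^ k := by rw [gap]; lia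
  have hsq : 64 * (cnt (wt m) * cnt (wt m)) ≤ 2 ^ w := by
    simpa using h.fits_of_le (Nat.mul_le_mul hc hc) (show 1 ≤ (n + 1) * (n + 1) by lia)
  have hgap_sq : gap (cnt (wt m)) (elev (wt m)) * gap (cnt (wt m)) (elev (wt m)) ≤
      4 * (2 ^ k * 2 ^ k) := (Nat.mul_le_mul hgap hgap).trans (by lia)
  have hgap_sq_mul : gap (cnt (wt m)) (elev (wt m)) * gap (cnt (wt m)) (elev (wt m)) * N ≤
      4 * (2 ^ k * 2 ^ k * (n + 1)) :=
    (Nat.mul_le_mul hgap_sq (h.rows_le.trans n.le_succ)).trans (by lia)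
  have hfit := h.fits_of_le le_rfl (Nat.le_mul_of_pos_left (n + 1) n.succ_pos)
  have hpos : 0 < 2 ^ w := by positivity
  have hgap_def : cnt (wt m) - (elev (wt m) + elev (wt m)) +
      (elev (wt m) + elev (wt m) - cnt (wt m)) = gap (cnt (wt m)) (elev (wt m)) := rfl
  simp only [checkSplit, Program.block, wp_seq, wp_load, wp_arith, wp_const, wp_branch, wp_skip,
    MachineState.setReg_reg, MachineState.setReg_mem, ArithOp.eval, ↓reduceIte, Nat.reduceEqDiff,
    hm, h.weights, h.marks, h.counts, h.elevs, h.reg2, h.rows, Nat.lt_one_iff, hgap_def]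
  by_cases hm0 : mk m = 0
  · rw [if_pos hm0]
    refine ⟨by lia, by lia, by lia, by lia, by lia, by lia, by lia, ?_⟩
    simp only [hm0, forall_const, Balanced]
    split_ifs <;> lia
  · rw [if_neg hm0, if_pos (fun h0 => absurd h0 hm0)]
    exact ⟨by lia, rfl⟩

/-- Put `1` in register `25` if the class of every unmarked word is split, and `0` otherwise. -/
def checkSplits : Program :=
  .block [.const 25 1, .forLoop 10 3 checkSplit]

theorem wp_checkSplits (h : Tables k n w N wt mk cnt elev s)
    (hcnt : ∀ c, cnt c ≤ 2 ^ k) (helev : ∀ c, elev c ≤ 2 ^ k) :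
    WP w checkSplits s fun s' t => t ≤ 2 ^ k * 32 + 5 ∧ Tables k n w N wt mk cnt elev s' ∧
      s'.reg 25 ≤ 1 ∧ (s'.reg 25 = 1 ↔
        ∀ x < 2 ^ k, mk x = 0 → Balanced N (cnt (wt x)) (elev (wt x))) := by
  suffices WP w checkSplits s fun s' t => t ≤ 2 ^ k * 32 + 5 ∧ s'.reg 25 ≤ 1 ∧
      (s'.reg 25 = 1 ↔ ∀ x < 2 ^ k, mk x = 0 → Balanced N (cnt (wt x)) (elev (wt x))) by
    exact this.frame.mono fun s' t ⟨⟨ht, hflag⟩, hf⟩ =>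
      ⟨ht, h.of_frame_of_disjoint hf (by decide), hflag⟩
  have hfit : 1 < 2 ^ w := by
    have := h.words_fit
    have := Nat.one_le_two_pow (n := k)
    lia
  simp only [checkSplits, Program.block, wp_seq, wp_const]
  refine ⟨hfit, ((h.setReg (r := 25) (by lia) 1).wp_forWords (T := 30)
    (fun m s' => s'.reg 25 ≤ 1 ∧ (s'.reg 25 = 1 ↔
      ∀ x < m, mk x = 0 → Balanced N (cnt (wt x)) (elev (wt x))))
    (by decide) (fun _ _ _ h => by simpa using h) (by simp) ?_).mono
    fun s' t hs' => ⟨by lia, hs'.2⟩⟩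
  intro m _ s₁ hf _ hi ⟨hle, hflag⟩
  have h₁ := (h.setReg (r := 25) (by lia) 1).of_frame_of_disjoint hf (by decide)
  refine (wp_checkSplit h₁ hi hcnt helev).mono fun s₂ t ⟨ht, hnew⟩ => ⟨ht, ?_⟩
  rw [Nat.forall_lt_succ_right, ← hflag, hnew]
  split_ifs with hsplit
  · exact ⟨hle, (and_iff_left hsplit).symm⟩
  · exact ⟨zero_le_one, by simp [hsplit]⟩

/-- Set the entries of array `A` for all weights to zero. -/
def clear (A : ℕ) : Program :=
  .forLoop 10 3 <| .block [.load 11 2 10, .store A 11 6]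

theorem wp_clear {A : ℕ} (hc : Context k n w s) (hwt : s.mem 2 = wt) (hA : A ≠ 2 ∧ A ≠ 7)
    (hzero : ∀ c, (∀ x < 2 ^ k, wt x ≠ c) → s.mem A c = 0) :
    WP w (clear A) s fun s' t => t ≤ 2 ^ k * 32 + 2 ∧ s'.mem A = 0 := by
  refine (hc.wp_forWords (T := 30) (fun m s' => ∀ c, (∀ x < 2 ^ k, m ≤ x → wt x ≠ c) →
      s'.mem A c = 0)
    (by
      simp only [Program.KeepsContext, Program.regs, Program.arrays, Program.forLoop,
        Program.block, List.mem_cons, List.mem_append, List.not_mem_nil, or_false, false_or]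
      lia)
    (fun _ _ _ h => h) (by simpa using hzero) ?_).mono
    fun s' t hs' => ⟨hs'.1, funext fun c => hs'.2 c (by lia)⟩
  intro m _ s₁ hf hc₁ hi hcleared
  have hwt₁ := (hf.mem 2 (by
    simp [Program.arrays, Program.forLoop, Program.block, hA.1.symm])).trans hwt
  simp only [Program.block, wp_seq, wp_load, wp_store, MachineState.setReg_reg,
    MachineState.setReg_mem, MachineState.setMem_mem, ↓reduceIte, Nat.reduceEqDiff, hi, hwt₁,
    hc₁.reg6]
  refine ⟨by lia, fun c hc' => ?_⟩
  by_cases hcm : c = wt m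
  · rw [hcm, Function.update_self]
  · rw [Function.update_of_ne hcm]
    refine hcleared c fun x hx hmx => ?_
    rcases hmx.eq_or_lt with rfl | hlt
    exacts [Ne.symm hcm, hc' x hx hlt]

/-- The candidate with numeral `r` passes the test, according to the tables of weights, marks and
counts, where `d` is the minimum positive weight. -/
def Passes (k N d : ℕ) (wt mk cnt : ℕ → ℕ) (r : ℕ) : Prop :=
  (∀ x < 2 ^ k, mk x = 0 →
    Balanced N (cnt (wt x)) (weightSum (2 ^ k) wt (unmarked mk (dotBit k r)) (wt x))) ∧
  weightSum (2 ^ k) wt 1 d ≤ weightSum (2 ^ k) wt (dotBit k r) d * 8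

/-- Store the candidate in register `23` in register `21` if the flag in register `25` is set and
register `24` contains at least an eighth of register `16`. -/
def acceptCandidate : Program :=
  .block [.arith .mul 24 24 5,
    .branch 24 16 .skip (.branch 25 2 .skip (.arith .add 21 23 6))]

theorem wp_acceptCandidate {a : ℕ} (h : Tables k n w N wt mk cnt elev s) (hr : s.reg 23 = r)
    (hrk : r < 2 ^ k) (ha : s.reg 24 = a) (hak : a ≤ 2 ^ k) (hflag : s.reg 25 ≤ 1) :
    WP w acceptCandidate s fun s' t => t ≤ 5 ∧ Tables k n w N wt mk cnt elev s' ∧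
      s'.reg 21 = if s.reg 25 = 1 ∧ s.reg 16 ≤ a * 8 then r else s.reg 21 := by
  suffices WP w acceptCandidate s fun s' t => t ≤ 5 ∧
      s'.reg 21 = if s.reg 25 = 1 ∧ s.reg 16 ≤ a * 8 then r else s.reg 21 by
    exact this.frame.mono fun s' t ⟨⟨ht, haccept⟩, hf⟩ =>
      ⟨ht, h.of_frame_of_disjoint hf (by decide), haccept⟩
  have hfit := h.words_fit
  simp only [acceptCandidate, Program.block, Program.skip, wp_seq, wp_const, wp_arith, wp_branch,
    ArithOp.eval, MachineState.setReg_reg, ↓reduceIte, Nat.reduceEqDiff, h.reg2, h.reg5, h.reg6,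
    hr, ha]
  split_ifs <;> lia

/-- Test the candidate with numeral `2 ^ k - 1 - i`, where `i` is in register `22`, and store it in
register `21` if it passes. -/
def testCandidate : Program :=
  .block [.arith .sub 23 3 2, .arith .sub 23 23 22, tally, checkSplits, clear 6, acceptCandidate]

open Classical in
theorem wp_testCandidate {i : ℕ} (h : Tables k n w N wt mk cnt 0 s) (hi : s.reg 22 = i)
    (hik : i < 2 ^ k) (hcnt : ∀ c, cnt c ≤ 2 ^ k) (hd : s.reg 15 = d)
    (hsum : s.reg 16 = weightSum (2 ^ k) wt 1 d) :
    WP w testCandidate s fun s' t => t ≤ 2 ^ k * 96 + 30 ∧ Tables k n w N wt mk cnt 0 s' ∧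
      s'.reg 21 = if Passes k N d wt mk cnt (2 ^ k - 1 - i) then 2 ^ k - 1 - i else s.reg 21 := by
  have hfit := h.words_fit
  obtain ⟨r, hr⟩ : ∃ r, r = 2 ^ k - 1 - i := ⟨_, rfl⟩
  have hrk : r < 2 ^ k := by lia
  simp only [testCandidate, Program.block, wp_seq, wp_arith, ArithOp.eval, MachineState.setReg_reg,
    ↓reduceIte, Nat.reduceEqDiff, h.reg2, h.reg3, hi, ← hr]
  refine ⟨by lia, by lia, ?_⟩
  have h₀ := (h.setReg (r := 23) (by lia) (2 ^ k - 1)).setReg (r := 23) (by lia) r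
  refine (wp_tally h₀ (by simp) hrk (by simpa using hd)).frame.mono ?_
  rintro s₁ t₁ ⟨⟨ht₁, h₁, helevated⟩, hf₁⟩
  refine (wp_checkSplits h₁ hcnt (weightSum_le _ _ (unmarked_le (dotBit_le k r)))).frame.mono ?_
  rintro s₂ t₂ ⟨⟨ht₂, h₂, hflag_le, hflag⟩, hf₂⟩
  refine (wp_clear (A := 6) h₂.toContext h₂.weights (by lia) fun c hc => ?_).frame.mono ?_
  · rw [h₂.elevs, weightSum_eq_zero hc]
  rintro s₃ t₃ ⟨⟨ht₃, hclear⟩, hf₃⟩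
  have h₃ := h₂.of_frame hf₃ (by decide)
  rw [hf₃.mem 3 (by decide), hf₃.mem 4 (by decide), h₂.marks, h₂.counts, hclear] at h₃
  have hflag₃ : s₃.reg 25 = s₂.reg 25 := hf₃.reg 25 (by decide)
  have hkept : ∀ q ∈ [16, 21, 23], s₃.reg q = ((s.setReg 23 (2 ^ k - 1)).setReg 23 r).reg q :=
    fun q hq => by
      fin_cases hq <;> exact (hf₃.reg _ (by decide)).trans <|
        (hf₂.reg _ (by decide)).trans (hf₁.reg _ (by decide))
  refine (wp_acceptCandidate h₃ (hkept 23 (by decide)) hrk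
    (((hf₃.reg 24 (by decide)).trans (hf₂.reg 24 (by decide))).trans helevated)
    (weightSum_le _ _ (dotBit_le k r) d) (hflag₃.trans_le hflag_le)).mono ?_
  rintro s₄ t₄ ⟨ht₄, h₄, haccept⟩
  have hpasses : s₃.reg 25 = 1 ∧ s₃.reg 16 ≤ weightSum (2 ^ k) wt (dotBit k r) d * 8 ↔
      Passes k N d wt mk cnt r := by
    rw [hflag₃, hflag, (hkept 16 (by decide)).trans hsum, Passes]
  exact ⟨by lia, h₄, haccept.trans (if_congr hpasses (by simp) (hkept 21 (by decide)))⟩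

/-- Going down from `K`, the minimum of the elements of `p` is the last one found. -/
theorem isLeast_of_search {K m a b : ℕ} {p : ℕ → Prop} (hm : m < K)
    (ha : {r | r < K ∧ K ≤ r + m ∧ p r}.Nonempty → IsLeast {r | r < K ∧ K ≤ r + m ∧ p r} a)
    (hb : p (K - 1 - m) → b = K - 1 - m) (hb' : ¬ p (K - 1 - m) → b = a)
    (hne : {r | r < K ∧ K ≤ r + (m + 1) ∧ p r}.Nonempty) :
    IsLeast {r | r < K ∧ K ≤ r + (m + 1) ∧ p r} b := by
  by_cases hp : p (K - 1 - m)
  · rw [hb hp]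
    exact ⟨⟨by lia, by lia, hp⟩, fun r hr => by have := hr.2.1; lia⟩
  · have hset : {r | r < K ∧ K ≤ r + (m + 1) ∧ p r} = {r | r < K ∧ K ≤ r + m ∧ p r} := by
      ext r
      refine ⟨fun ⟨hrK, hrm, hpr⟩ => ⟨hrK, ?_, hpr⟩, fun ⟨hrK, hrm, hpr⟩ => ⟨hrK, by lia, hpr⟩⟩
      by_contra hlt
      exact hp (by rwa [show K - 1 - m = r by lia])
    rw [hb' hp, hset]
    exact ha (hset ▸ hne)

/-- Find the first candidate that passes the test. -/
def search : Program := .forLoop 22 3 testCandidate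

theorem wp_search (h : Tables k n w N wt mk cnt 0 s) (hcnt : ∀ c, cnt c ≤ 2 ^ k)
    (hd : s.reg 15 = d) (hsum : s.reg 16 = weightSum (2 ^ k) wt 1 d) :
    WP w search s fun s' t => t ≤ 2 ^ k * (2 ^ k * 96 + 32) + 2 ∧
      Tables k n w N wt mk cnt 0 s' ∧ ({r | r < 2 ^ k ∧ Passes k N d wt mk cnt r}.Nonempty →
        IsLeast {r | r < 2 ^ k ∧ Passes k N d wt mk cnt r} (s'.reg 21)) := by
  set p := Passes k N d wt mk cnt
  refine (h.wp_forWords (T := 2 ^ k * 96 + 30) (fun m s' => Tables k n w N wt mk cnt 0 s' ∧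
      ({r | r < 2 ^ k ∧ 2 ^ k ≤ r + m ∧ p r}.Nonempty →
        IsLeast {r | r < 2 ^ k ∧ 2 ^ k ≤ r + m ∧ p r} (s'.reg 21)))
    (by decide) (fun m s v hs => ⟨hs.1.setReg (by lia) v, by simpa using hs.2⟩)
    ⟨h, fun ⟨r, hr, hr', _⟩ => by lia⟩ ?_).mono ?_
  · intro m hm s₁ hf _ hi ⟨h₁, hleast⟩
    refine (wp_testCandidate h₁ hi hm hcnt ((hf.reg 15 (by decide)).trans hd)
      ((hf.reg 16 (by decide)).trans hsum)).mono ?_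
    rintro s₂ t ⟨ht, h₂, hresult⟩
    exact ⟨ht, h₂, isLeast_of_search hm hleast (fun hpm => by rw [hresult, if_pos hpm])
      fun hpm => by rw [hresult, if_neg hpm]⟩
  · rintro s' t ⟨ht, h', hleast⟩
    have hset : {r | r < 2 ^ k ∧ 2 ^ k ≤ r + 2 ^ k ∧ p r} = {r | r < 2 ^ k ∧ p r} := by
      ext r
      simp
    exact ⟨by lia, h', hset ▸ hleast⟩

/-- One iteration of the greedy algorithm: the numeral of the new row is left in register `21`. -/
def greedyStep : Program :=
  .block [countUnmarked, markClasses, findMinWeight, countMinWeight, search, clear 4]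

theorem wp_greedyStep (h : Tables k n w N wt mk 0 0 s)
    (hcnt : cnt = weightSum (2 ^ k) wt (unmarked mk 1)) :
    WP w greedyStep s fun s' t => t ≤ 2 ^ k * 2 ^ k * 400 ∧
      Tables k n w N wt (nextMarks k N wt mk cnt) 0 0 s' ∧ ∃ d, IsMinWeight k N wt d ∧
        ({r | r < 2 ^ k ∧ Passes k N d wt (nextMarks k N wt mk cnt) cnt r}.Nonempty →
          IsLeast {r | r < 2 ^ k ∧ Passes k N d wt (nextMarks k N wt mk cnt) cnt r}
            (s'.reg 21)) := by
  simp only [greedyStep, Program.block, wp_seq]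
  refine (wp_countUnmarked h).mono ?_
  rintro s₁ t₁ ⟨ht₁, h₁⟩
  rw [← hcnt] at h₁
  refine (wp_markClasses h₁).mono ?_
  rintro s₂ t₂ ⟨ht₂, h₂⟩
  refine (wp_findMinWeight h₂).mono ?_
  rintro s₃ t₃ ⟨ht₃, h₃, hmin⟩
  refine (wp_countMinWeight h₃ rfl).mono ?_
  rintro s₄ t₄ ⟨ht₄, h₄, hd, hsum⟩
  have hcnt_le : ∀ c, cnt c ≤ 2 ^ k := by
    rw [hcnt]
    exact weightSum_le _ _ (unmarked_le fun _ => le_rfl)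
  refine (wp_search h₄ hcnt_le hd hsum).mono ?_
  rintro s₅ t₅ ⟨ht₅, h₅, hleast⟩
  refine (wp_clear (A := 4) h₅.toContext h₅.weights (by lia) fun c hc => ?_).frame.mono ?_
  · rw [h₅.counts, hcnt, weightSum_eq_zero hc]
  rintro s₆ t₆ ⟨⟨ht₆, hclear⟩, hf₆⟩
  have h₆ := h₅.of_frame hf₆ (by decide)
  rw [hf₆.mem 3 (by decide), hf₆.mem 6 (by decide), h₅.marks, h₅.elevs, hclear] at h₆
  refine ⟨?_, h₆, s₃.reg 15, hmin, by rwa [hf₆.reg 21 (by decide)]⟩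
  have := Nat.one_le_two_pow (n := k)
  nlinarith

end GreedyStep

/-! ### The tables of the program represent the state of the greedy algorithm -/

/-- The tables `wt` and `mk` contain, for all numerals, the weights under the first `N` rows of `R`
and the marks after `t` iterations. The zero word counts as marked, since its weight `0` takes no
part in the construction. -/
structure Represents {k : ℕ} (R : ℕ → Word k) (N t : ℕ) (wt mk : ℕ → ℕ) : Prop where
  weight : ∀ x < 2 ^ k, wt x = hammingNorm (codeword R N (toWord k x))
  mark : ∀ x < 2 ^ k, mk x = 0 ↔ x ≠ 0 ∧ toWord k x ∉ marked R t

section Represents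

variable {k N t x i d r : ℕ} {R : ℕ → Word k} {wt mk f : ℕ → ℕ}

theorem card_eq_weightSum {S : Finset (Word k)} (hf : ∀ x, f x ≤ 1)
    (hS : ∀ x < 2 ^ k, toWord k x ∈ S ↔ wt x = i ∧ f x = 1) : #S = weightSum (2 ^ k) wt f i := by
  rw [card_eq_sum_toWord, weightSum]
  refine sum_congr rfl fun x hx => ?_
  rw [if_congr (hS x (mem_range.mp hx)) rfl rfl, ite_and]
  have := hf x
  split_ifs <;> lia

theorem unmarked_eq_one_iff : unmarked mk f x = 1 ↔ mk x = 0 ∧ f x = 1 := by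
  rw [unmarked]
  split_ifs with h <;> simp [h]

namespace Represents

theorem mem_weightClass (h : Represents R N t wt mk) (hx : x < 2 ^ k) :
    toWord k x ∈ weightClass R N i ↔ wt x = i := by
  rw [Rateless.mem_weightClass, h.weight x hx]

theorem weight_le (h : Represents R N t wt mk) (hx : x < 2 ^ k) : wt x ≤ N := by
  rw [h.weight x hx]
  exact hammingNorm_le_card_fintype.trans_eq (Fintype.card_fin N)

theorem weight_pos_iff (h : Represents R N t wt mk) (hR : IsGreedyMatrix R) (hN : k ≤ N)
    (hx : x < 2 ^ k) : 0 < wt x ↔ x ≠ 0 := by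
  rw [h.weight x hx, ← (toWord_eq_zero_iff hx).ne]
  refine ⟨fun hpos h0 => ?_, fun hx0 => hammingNorm_codeword_pos hR hx0 hN⟩
  simp [h0, codeword, hammingNorm] at hpos

theorem mem_sdiff_marked (h : Represents R N t wt mk) (hR : IsGreedyMatrix R) (hN : k ≤ N)
    (hi : 0 < i) (hx : x < 2 ^ k) :
    toWord k x ∈ weightClass R N i \ marked R t ↔ wt x = i ∧ mk x = 0 := by
  rw [mem_sdiff, h.mem_weightClass hx, h.mark x hx]
  exact and_congr_right fun hw => by rw [and_iff_right ((h.weight_pos_iff hR hN hx).mp (hw ▸ hi))]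

theorem card_sdiff_marked (h : Represents R N t wt mk) (hR : IsGreedyMatrix R) (hN : k ≤ N)
    (hi : 0 < i) :
    #(weightClass R N i \ marked R t) = weightSum (2 ^ k) wt (unmarked mk 1) i :=
  card_eq_weightSum (unmarked_le fun _ => le_rfl) fun x hx => by
    simp only [h.mem_sdiff_marked hR hN hi hx, unmarked_eq_one_iff, Pi.one_apply, and_true]

theorem card_elevated_sdiff_marked (h : Represents R N t wt mk) (hR : IsGreedyMatrix R)
    (hN : k ≤ N) (hi : 0 < i) (r : ℕ) :
    #(elevated (toWord k r) (weightClass R N i \ marked R t)) =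
      weightSum (2 ^ k) wt (unmarked mk (dotBit k r)) i :=
  card_eq_weightSum (unmarked_le (dotBit_le k r)) fun x hx => by
    rw [mem_elevated, h.mem_sdiff_marked hR hN hi hx, unmarked_eq_one_iff,
      toWord_dotProduct_eq_one, and_assoc, dotBit]

theorem card_weightClass (h : Represents R N t wt mk) (i : ℕ) :
    #(weightClass R N i) = weightSum (2 ^ k) wt 1 i :=
  card_eq_weightSum (fun _ => le_rfl) fun x hx => by
    simp only [h.mem_weightClass hx, Pi.one_apply, and_true]

theorem card_elevated_weightClass (h : Represents R N t wt mk) (r i : ℕ) :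
    #(elevated (toWord k r) (weightClass R N i)) = weightSum (2 ^ k) wt (dotBit k r) i :=
  card_eq_weightSum (dotBit_le k r) fun x hx => by
    rw [mem_elevated, h.mem_weightClass hx, toWord_dotProduct_eq_one, dotBit]

theorem mark_succ (h : Represents R (k + t) t wt mk) (hR : IsGreedyMatrix R) :
    Represents R (k + t) (t + 1) wt
      (nextMarks k (k + t) wt mk (weightSum (2 ^ k) wt (unmarked mk 1))) where
  weight := h.weight
  mark x hx := by
    rw [nextMarks, mem_marked_succ ((h.mem_weightClass hx).mpr rfl)]
    have hmark := h.mark x hx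
    have hpos := h.weight_pos_iff hR (by lia) hx
    have hle := h.weight_le hx
    rw [mem_Icc]
    by_cases hx0 : x = 0
    · split_ifs <;> simp_all
    · rw [h.card_sdiff_marked hR (by lia) (hpos.mpr hx0)]
      grind

theorem isLeast_of_isMinWeight (h : Represents R N t wt mk) (hR : IsGreedyMatrix R) (hN : k ≤ N)
    (hk : 0 < k) (hd : IsMinWeight k N wt d) :
    IsLeast {d : ℕ | 0 < d ∧ (weightClass R N d).Nonempty} d := by
  obtain ⟨hpos, hmin, hattained⟩ := hd
  have hone : 1 < 2 ^ k := Nat.one_lt_two_pow hk.ne'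
  have hdle : d ≤ N :=
    (hmin 1 hone ((h.weight_pos_iff hR hN hone).mpr one_ne_zero)).trans (h.weight_le hone)
  obtain ⟨x, hx, hxd⟩ := hattained.resolve_left (by lia)
  refine ⟨⟨hpos, _, (h.mem_weightClass hx).mpr hxd⟩, ?_⟩
  rintro d' ⟨hd', y, hy⟩
  obtain ⟨x', hx', rfl⟩ := exists_toWord y
  rw [h.mem_weightClass hx'] at hy
  exact hy ▸ hmin x' hx' (hy ▸ hd')

end Represents

theorem gap_cast (c e : ℕ) : (gap c e : ℝ) = |(c : ℝ) - 2 * e| := by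
  rw [gap]
  rcases le_total (e + e) c with hle | hle
  · rw [Nat.sub_eq_zero_of_le hle, add_zero, Nat.cast_sub hle, Nat.cast_add, ← two_mul,
      abs_of_nonneg (by rw [two_mul, sub_nonneg]; exact_mod_cast hle)]
  · rw [Nat.sub_eq_zero_of_le hle, zero_add, Nat.cast_sub hle, Nat.cast_add, ← two_mul,
      abs_of_nonpos (by rw [two_mul, sub_nonpos]; exact_mod_cast hle), neg_sub]

theorem balanced_iff_splits (hN : 0 < N) {r : Word k} {S : Finset (Word k)} :
    Balanced N #S #(elevated r S) ↔ Splits (1 / (2 * √(N : ℝ))) r S := by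
  have hsqrt : 0 < √(N : ℝ) := Real.sqrt_pos.mpr (by exact_mod_cast hN)
  calc Balanced N #S #(elevated r S)
      ↔ (gap #S #(elevated r S) * √N : ℝ) ^ 2 ≤ (#S : ℝ) ^ 2 := by
        rw [mul_pow, Real.sq_sqrt N.cast_nonneg, sq, sq, Balanced]
        exact_mod_cast Iff.rfl
    _ ↔ (gap #S #(elevated r S) : ℝ) ≤ #S / √N := by
        rw [sq_le_sq₀ (by positivity) (by positivity), le_div_iff₀ hsqrt]
    _ ↔ Splits (1 / (2 * √(N : ℝ))) r S := by
        rw [splits_iff_abs_imbalance_le, imbalance_eq, gap_cast]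
        push_cast
        rw [show 2 * (1 / (2 * √(N : ℝ))) * #S = #S / √N by field_simp]

theorem elevates_eighth_iff {r : Word k} {S : Finset (Word k)} :
    Elevates (1 / 8) r S ↔ #S ≤ #(elevated r S) * 8 := by
  rw [Elevates, ← @Nat.cast_le ℝ, Nat.cast_mul, Nat.cast_ofNat]
  constructor <;> intro <;> linarith

namespace Represents

/-- Of the two marked sets involved, the counts use the old one and the test the new one; by
`weightClass_sdiff_marked_succ` this makes no difference as long as the class is not marked. -/
theorem splits_iff_balanced (h : Represents R (k + t) t wt mk) (hR : IsGreedyMatrix R)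
    (hk : 0 < k) (hx : x < 2 ^ k) {mk' : ℕ → ℕ} (h' : Represents R (k + t) (t + 1) wt mk')
    (hmk' : mk' x = 0) :
    Splits (1 / (2 * √((k + t : ℕ) : ℝ))) (toWord k r)
        (weightClass R (k + t) (wt x) \ marked R (t + 1)) ↔
      Balanced (k + t) (weightSum (2 ^ k) wt (unmarked mk 1) (wt x))
        (weightSum (2 ^ k) wt (unmarked mk' (dotBit k r)) (wt x)) := by
  have hpos := (h.weight_pos_iff hR (by lia) hx).mpr ((h'.mark x hx).mp hmk').1
  have hmem := (h'.mem_sdiff_marked hR (by lia) hpos hx).mpr ⟨rfl, hmk'⟩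
  have hsame := weightClass_sdiff_marked_succ R t (mem_Icc.mpr ⟨hpos, h.weight_le hx⟩)
  rw [if_neg fun hlt => by simp [hsame, hlt] at hmem] at hsame
  rw [← balanced_iff_splits (by lia), h'.card_elevated_sdiff_marked hR (by lia) hpos, hsame,
    h.card_sdiff_marked hR (by lia) hpos]

theorem passes_iff (h : Represents R (k + t) t wt mk) (hR : IsGreedyMatrix R) (hk : 0 < k)
    {cnt : ℕ → ℕ} (hcnt : cnt = weightSum (2 ^ k) wt (unmarked mk 1))
    (hd : IsMinWeight k (k + t) wt d) :
    Passes k (k + t) d wt (nextMarks k (k + t) wt mk cnt) cnt r ↔ Suitable R t (toWord k r) := by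
  subst hcnt
  have h' := h.mark_succ hR
  refine and_congr ⟨fun hpass i hi => ?_, fun hsplit x hx hmk => ?_⟩ ?_
  · rcases (weightClass R (k + t) i \ marked R (t + 1)).eq_empty_or_nonempty with hempty | ⟨y, hy⟩
    · rw [hempty]
      exact splits_empty _ _
    · obtain ⟨x, hx, rfl⟩ := exists_toWord y
      obtain ⟨rfl, hmk⟩ := (h'.mem_sdiff_marked hR (by lia) (mem_Icc.mp hi).1 hx).mp hy
      exact (h.splits_iff_balanced hR hk hx h' hmk).mpr (hpass x hx hmk)
  · have hpos := (h.weight_pos_iff hR (by lia) hx).mpr ((h'.mark x hx).mp hmk).1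
    exact (h.splits_iff_balanced hR hk hx h' hmk).mp
      (hsplit (wt x) (mem_Icc.mpr ⟨hpos, h.weight_le hx⟩))
  · rw [← h.card_weightClass, ← h.card_elevated_weightClass, ← elevates_eighth_iff]
    have hleast := h.isLeast_of_isMinWeight hR (by lia) hk hd
    exact ⟨fun helev d' hd' => hd'.unique hleast ▸ helev, fun helev => helev d hleast⟩

end Represents

end Represents

/-! ### Setting up the machine -/

section Setup

variable {k n w a b : ℕ} {s : MachineState}

/-- Compute the inner product of the words with numerals in registers `12` and `13`. -/
def dotProgram : Program :=
  .block [.const 15 0, .forLoop 14 0 <| .block [.arith .div 16 12 4, .arith .add 17 16 16,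
    .arith .sub 17 12 17, .arith .div 18 13 4, .arith .add 19 18 18, .arith .sub 19 13 19,
    .arith .mul 17 17 19, .arith .add 15 15 17, .arith .add 12 16 6, .arith .add 13 18 6]]

theorem wp_dotProgram (h0 : s.reg 0 = k) (h2 : s.reg 2 = 1) (h4 : s.reg 4 = 2) (h6 : s.reg 6 = 0)
    (hw : 64 * 2 ^ k ≤ 2 ^ w) (ha : s.reg 12 = a) (hb : s.reg 13 = b) (hak : a < 2 ^ k)
    (hbk : b < 2 ^ k) :
    WP w dotProgram s fun s' t => t ≤ k * 32 + 4 ∧ s'.reg 15 = bitDot k a b := by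
  have hk : k < 2 ^ k := Nat.lt_two_pow_self
  simp only [dotProgram, Program.block, wp_seq, wp_const]
  refine ⟨by lia, ?_⟩
  refine (wp_for (N := k) (T := 30)
    (fun m s' => s'.reg 12 = a / 2 ^ m ∧ s'.reg 13 = b / 2 ^ m ∧ s'.reg 15 = bitDot m a b)
    (by decide) (by simpa using h2) (by simpa using h0) (by lia)
    (fun _ _ _ h => by simpa using h) (by simp [ha, hb, bitDot]) ?_).mono
    fun s' t h => ⟨by lia, h.2.1.2.2⟩
  intro m hm s₁ hf _ ⟨h12, h13, h15⟩
  have h4' : s₁.reg 4 = 2 := (hf.reg 4 (by decide)).trans (by simpa using h4)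
  have h6' : s₁.reg 6 = 0 := (hf.reg 6 (by decide)).trans (by simpa using h6)
  have hle := bitDot_le m a b
  have ha' : a / 2 ^ m ≤ a := Nat.div_le_self _ _
  have hb' : b / 2 ^ m ≤ b := Nat.div_le_self _ _
  simp only [wp_seq, wp_arith, MachineState.setReg_reg, ArithOp.eval, ↓reduceIte,
    Nat.reduceEqDiff, h12, h13, h15, h4', h6', bitDot_succ, pow_succ, ← Nat.div_div_eq_div_mul,
    Nat.add_zero]
  generalize a / 2 ^ m = a' at *
  generalize b / 2 ^ m = b' at *
  rw [show a' - (a' / 2 + a' / 2) = a' % 2 by lia, show b' - (b' / 2 + b' / 2) = b' % 2 by lia]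
  have hbit : a' % 2 * (b' % 2) ≤ 1 * 1 := Nat.mul_le_mul (by lia) (by lia)
  lia

/-- Fill the table of inner products. -/
def dotTable : Program :=
  .forLoop 10 9 <| .block [.arith .div 12 10 3, .arith .mul 13 12 3, .arith .sub 13 10 13,
    dotProgram, .arith .div 16 15 4, .arith .add 16 16 16, .arith .sub 15 15 16, .store 7 10 15]

theorem wp_dotTable_entries (h0 : s.reg 0 = k) (h2 : s.reg 2 = 1) (h3 : s.reg 3 = 2 ^ k)
    (h4 : s.reg 4 = 2) (h6 : s.reg 6 = 0) (h9 : s.reg 9 = 2 ^ k * 2 ^ k)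
    (hw : 64 * (2 ^ k * 2 ^ k) ≤ 2 ^ w) :
    WP w dotTable s fun s' t => t ≤ 2 ^ k * 2 ^ k * (k * 32 + 32) + 2 ∧
      ∀ z < 2 ^ k * 2 ^ k, s'.mem 7 z = bitDot k (z / 2 ^ k) (z % 2 ^ k) % 2 := by
  have hK : 1 ≤ 2 ^ k := Nat.one_le_two_pow
  have hKK : 2 ^ k * 1 ≤ 2 ^ k * 2 ^ k := Nat.mul_le_mul_left _ hK
  have hk : k < 2 ^ k := Nat.lt_two_pow_self
  refine (wp_for (N := 2 ^ k * 2 ^ k) (T := k * 32 + 30)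
    (fun m s' => ∀ z < m, s'.mem 7 z = bitDot k (z / 2 ^ k) (z % 2 ^ k) % 2)
    (by decide) h2 h9 (by lia) (fun _ _ _ h => h) (by simp) ?_).mono
    fun s' t h => ⟨h.1, h.2.1⟩
  intro m hm s₁ hf hi hentries
  have f0 : s₁.reg 0 = k := (hf.reg 0 (by decide)).trans h0
  have f2 : s₁.reg 2 = 1 := (hf.reg 2 (by decide)).trans h2
  have f3 : s₁.reg 3 = 2 ^ k := (hf.reg 3 (by decide)).trans h3
  have f4 : s₁.reg 4 = 2 := (hf.reg 4 (by decide)).trans h4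
  have f6 : s₁.reg 6 = 0 := (hf.reg 6 (by decide)).trans h6
  have hdiv : m / 2 ^ k ≤ m := Nat.div_le_self _ _
  have hmul : m / 2 ^ k * 2 ^ k ≤ m := Nat.div_mul_le_self _ _
  have hmod : m - m / 2 ^ k * 2 ^ k = m % 2 ^ k := by rw [mul_comm, ← Nat.mod_eq_sub]
  simp only [Program.block, wp_seq, wp_arith, ArithOp.eval, MachineState.setReg_reg, ↓reduceIte,
    Nat.reduceEqDiff, hi, f3, hmod]
  refine ⟨by lia, by lia, by lia, ?_⟩
  refine (wp_dotProgram (k := k) (a := m / 2 ^ k) (b := m % 2 ^ k) (by simpa using f0)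
    (by simpa using f2) (by simpa using f4) (by simpa using f6) (by lia) (by simp) (by simp)
    (Nat.div_lt_of_lt_mul hm) (Nat.mod_lt _ hK)).frame.mono ?_
  rintro s₂ t ⟨⟨ht, h15⟩, hf₂⟩
  have g4 : s₂.reg 4 = 2 := (hf₂.reg 4 (by decide)).trans (by simpa using f4)
  have g10 : s₂.reg 10 = m := (hf₂.reg 10 (by decide)).trans (by simp [hi])
  have g7 : s₂.mem 7 = s₁.mem 7 := hf₂.mem 7 (by decide)
  have hle := bitDot_le k (m / 2 ^ k) (m % 2 ^ k)
  simp only [wp_store, MachineState.setReg_reg, MachineState.setReg_mem, MachineState.setMem_mem,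
    ↓reduceIte, Nat.reduceEqDiff, h15, g4, g10, g7]
  refine ⟨by lia, by lia, by lia, by lia, fun z hz => ?_⟩
  rw [Function.update_apply]
  split_ifs with hzm
  · rw [hzm]; lia
  · exact hentries z (by lia)

theorem wp_dotTable (h0 : s.reg 0 = k) (h2 : s.reg 2 = 1) (h3 : s.reg 3 = 2 ^ k)
    (h4 : s.reg 4 = 2) (h6 : s.reg 6 = 0) (h9 : s.reg 9 = 2 ^ k * 2 ^ k)
    (hw : 64 * (2 ^ k * 2 ^ k) ≤ 2 ^ w) :
    WP w dotTable s fun s' t => t ≤ 2 ^ k * 2 ^ k * (k * 32 + 32) + 2 ∧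
      ∀ a < 2 ^ k, ∀ b < 2 ^ k, s'.mem 7 (a * 2 ^ k + b) = bitDot k a b % 2 := by
  refine (wp_dotTable_entries h0 h2 h3 h4 h6 h9 hw).mono
    fun s' t ⟨ht, hentries⟩ => ⟨ht, fun a ha b hb => ?_⟩
  have hlt : a * 2 ^ k + b < 2 ^ k * 2 ^ k := by
    have := Nat.mul_le_mul_right (2 ^ k) (Nat.succ_le_of_lt ha)
    lia
  rw [hentries _ hlt, add_comm, Nat.add_mul_div_right _ _ (by positivity),
    Nat.div_eq_of_lt hb, zero_add, Nat.add_mul_mod_self_right, Nat.mod_eq_of_lt hb]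

/-- Compute the constants in registers `2` to `6`, and the size of the table of inner products. -/
def setConstants : Program :=
  .block [.const 2 1, .const 4 2, .const 5 8, .const 6 0, .const 3 1,
    .forLoop 10 0 (.arith .add 3 3 3), .arith .mul 9 3 3]

theorem wp_setConstants (h0 : s.reg 0 = k) (hw : 64 * (2 ^ k * 2 ^ k) ≤ 2 ^ w) :
    WP w setConstants s fun s' t => t ≤ k * 3 + 8 ∧ s'.reg 2 = 1 ∧ s'.reg 3 = 2 ^ k ∧
      s'.reg 4 = 2 ∧ s'.reg 5 = 8 ∧ s'.reg 6 = 0 ∧ s'.reg 9 = 2 ^ k * 2 ^ k := by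
  have hK : 1 ≤ 2 ^ k := Nat.one_le_two_pow
  have hKK : 2 ^ k * 1 ≤ 2 ^ k * 2 ^ k := Nat.mul_le_mul_left _ hK
  have hk : k < 2 ^ k := Nat.lt_two_pow_self
  simp only [setConstants, Program.block, wp_seq, wp_const]
  refine ⟨by lia, by lia, by lia, by lia, by lia, ?_⟩
  refine (wp_for (N := k) (T := 1) (fun m s' => s'.reg 3 = 2 ^ m)
    (by decide) (by simp) (by simpa using h0) (by lia) (fun _ _ _ h => by simpa using h)
    (by simp) ?_).mono ?_
  · intro m hm s₁ _ _ hpow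
    have : 2 ^ m < 2 ^ k := Nat.pow_lt_pow_right (by norm_num) hm
    simp only [wp_arith, ArithOp.eval, MachineState.setReg_reg, ↓reduceIte, hpow, pow_succ]
    lia
  · rintro s₁ t ⟨ht, h3, hf⟩
    have f2 : s₁.reg 2 = 1 := (hf.reg 2 (by decide)).trans (by simp)
    have f4 : s₁.reg 4 = 2 := (hf.reg 4 (by decide)).trans (by simp)
    have f5 : s₁.reg 5 = 8 := (hf.reg 5 (by decide)).trans (by simp)
    have f6 : s₁.reg 6 = 0 := (hf.reg 6 (by decide)).trans (by simp)
    simp only [wp_arith, ArithOp.eval, MachineState.setReg_reg, ↓reduceIte, Nat.reduceEqDiff,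
      h3, f2, f4, f5, f6]
    lia

/-- Compute the constants and the table of inner products. -/
def setup : Program := .block [setConstants, dotTable]

theorem wp_setup (h0 : s.reg 0 = k) (h1 : s.reg 1 = n)
    (hw : 64 * ((2 ^ k * 2 ^ k) * ((n + 1) * (n + 1))) ≤ 2 ^ w) :
    WP w setup s fun s' t => t ≤ 2 ^ k * 2 ^ k * (k * 32 + 32) + k * 32 + 16 ∧
      Context k n w s' := by
  have hpairs : 64 * (2 ^ k * 2 ^ k) ≤ 2 ^ w :=
    (Nat.mul_le_mul_left 64 (Nat.le_mul_of_pos_right _ (by lia))).trans hw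
  refine wp_seq.mpr ((wp_setConstants h0 hpairs).frame.mono ?_)
  rintro s₁ t₁ ⟨⟨ht₁, h2, h3, h4, h5, h6, h9⟩, hf₁⟩
  have f0 : s₁.reg 0 = k := (hf₁.reg 0 (by decide)).trans h0
  refine (wp_dotTable f0 h2 h3 h4 h6 h9 hpairs).frame.mono ?_
  rintro s₂ t₂ ⟨⟨ht₂, htable⟩, hf₂⟩
  exact ⟨by lia, {
    reg0 := (hf₂.reg 0 (by decide)).trans f0
    reg1 := (hf₂.reg 1 (by decide)).trans ((hf₁.reg 1 (by decide)).trans h1)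
    reg2 := (hf₂.reg 2 (by decide)).trans h2
    reg3 := (hf₂.reg 3 (by decide)).trans h3
    reg4 := (hf₂.reg 4 (by decide)).trans h4
    reg5 := (hf₂.reg 5 (by decide)).trans h5
    reg6 := (hf₂.reg 6 (by decide)).trans h6
    table := htable
    fits := hw }⟩

end Setup

/-! ### The greedy matrix as a program -/

section GreedyProgram

variable {k n w N t j r : ℕ} {R : ℕ → Word k} {wt wt' mk cnt elev : ℕ → ℕ} {s : MachineState}

/-- Append the row with numeral in register `21`, and update the weights. -/
def addRow : Program :=
  .block [.store 5 20 21, .arith .mul 30 21 3, .forLoop 10 3 <| .block [.arith .add 13 30 10,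
    .load 13 7 13, .load 11 2 10, .arith .add 11 11 13, .store 2 10 11]]

theorem wp_addRow (h : Tables k n w N wt mk cnt elev s) (hr : s.reg 21 = r) (hrk : r < 2 ^ k)
    (hwt : ∀ x < 2 ^ k, wt x ≤ n) :
    WP w addRow s fun s' t => t ≤ 2 ^ k * 32 + 4 ∧ s'.mem 5 = Function.update (s.mem 5) N r ∧
      ∀ x < 2 ^ k, s'.mem 2 x = wt x + dotBit k r x := by
  have hrK : r * 2 ^ k ≤ 2 ^ k * 2 ^ k := Nat.mul_le_mul_right _ hrk.le
  have hK : 1 ≤ 2 ^ k := Nat.one_le_two_pow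
  have hKK : 2 ^ k * 1 ≤ 2 ^ k * 2 ^ k := Nat.mul_le_mul_left _ hK
  have hpairs := h.pairs_fit
  have hn : 64 * (1 * (n + 1)) ≤ 2 ^ w := h.fits_of_le (by lia) (by nlinarith)
  simp only [addRow, Program.block, wp_seq, wp_store, wp_arith, MachineState.setMem_reg,
    ArithOp.eval, h.rows, hr, h.reg3]
  refine ⟨by lia, ?_⟩
  have h' : Context k n w ((s.setMem 5 N r).setReg 30 (r * 2 ^ k)) :=
    (h.toContext.of_frame (P := .store 5 20 21) (.setMem s (List.mem_singleton_self 5) N r)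
      (by decide)).setReg (by norm_num) _
  refine (h'.wp_forWords (T := 30) (fun m s' => s'.mem 2 = fun x =>
    if x < m then wt x + dotBit k r x else wt x)
    (by decide) (fun _ _ _ h => h) (by simp [h.weights]) ?_).frame.mono
    fun s' t ⟨⟨_, hwts⟩, hf⟩ => ⟨by lia, ?_, fun x hx => (congrFun hwts x).trans (if_pos hx)⟩
  · intro m hm s₁ hf hc hi hwts
    have hoffset : s₁.reg 30 = r * 2 ^ k := (hf.reg 30 (by decide)).trans (by simp)
    have hdot : s₁.mem 7 (r * 2 ^ k + m) = dotBit k r m := hc.table r hrk m hm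
    have hbit := dotBit_le k r m
    have hwtm := hwt m hm
    simp only [wp_seq, wp_load, wp_arith, wp_store, MachineState.setReg_reg,
      MachineState.setReg_mem, MachineState.setMem_mem, ArithOp.eval, ↓reduceIte,
      Nat.reduceEqDiff, hi, hoffset, hdot, hwts, lt_self_iff_false]
    refine ⟨by lia, by lia, by lia, funext fun x => ?_⟩
    grind [Function.update_apply]
  · rw [hf.mem 5 (by decide)]
    simp

theorem Represents.succ (h : Represents R N t wt mk) (hr : toWord k r = R N)
    (hwt : ∀ x < 2 ^ k, wt' x = wt x + dotBit k r x) : Represents R (N + 1) t wt' mk := by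
  refine ⟨fun x hx => ?_, h.mark⟩
  rw [hammingNorm_codeword_succ, hwt x hx, h.weight x hx, ← hr, dotBit,
    if_congr toWord_dotProduct_eq_one rfl rfl]
  congr 1
  split_ifs with hbit <;> lia

/-- The state of the machine when `j` rows of the greedy matrix are in array `5`. Register `26`
contains the numeral of the last unit vector used as a row. -/
structure HasRows (k j : ℕ) (s : MachineState) : Prop where
  counts : s.mem 4 = 0
  elevs : s.mem 6 = 0
  represents : Represents (greedyMatrix k) j (j - k) (s.mem 2) (s.mem 3)
  rows : ∀ i < j, s.mem 5 i < 2 ^ k ∧ toWord k (s.mem 5 i) = greedyMatrix k i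
  unitVector : j ≤ k → s.reg 26 = 2 ^ (k - j)

/-- Leave the numeral of the next row of the greedy matrix in register `21`. -/
def nextRow : Program :=
  .branch 20 0 (.block [.arith .div 26 26 4, .arith .add 21 26 6]) greedyStep

theorem wp_nextRow_of_lt (hc : Context k n w s) (h : HasRows k j s) (hj : s.reg 20 = j)
    (hjk : j < k) :
    WP w nextRow s fun s' t => t ≤ 3 ∧ s'.mem = s.mem ∧ s'.reg 26 = 2 ^ (k - (j + 1)) ∧
      s'.reg 21 = 2 ^ (k - (j + 1)) := by
  have hpow : 2 ^ (k - j) / 2 = 2 ^ (k - (j + 1)) := by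
    rw [show k - j = k - (j + 1) + 1 by lia, pow_succ, Nat.mul_div_cancel _ two_pos]
  have hlt : 2 ^ (k - (j + 1)) < 2 ^ k := Nat.pow_lt_pow_right (by norm_num) (by lia)
  have hfit := hc.words_fit
  simp only [nextRow, Program.block, wp_branch, wp_seq, wp_arith, MachineState.setReg_reg,
    MachineState.setReg_mem, ArithOp.eval, ↓reduceIte, Nat.reduceEqDiff, hj, hc.reg0, hc.reg4,
    hc.reg6, h.unitVector hjk.le, hpow, if_pos hjk, Nat.add_zero, and_true]
  lia

theorem wp_nextRow_of_ge (hk : 0 < k) (hc : Context k n w s) (h : HasRows k (k + t) s)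
    (ht : s.reg 20 = k + t) (htn : k + t < n) :
    WP w nextRow s fun s' T => T ≤ 2 ^ k * 2 ^ k * 400 + 1 ∧ s'.mem 4 = 0 ∧ s'.mem 6 = 0 ∧
      Represents (greedyMatrix k) (k + t) (t + 1) (s'.mem 2) (s'.mem 3) ∧
      s'.reg 21 = nextIndex (greedyMatrix k) t := by
  have hR := isGreedyMatrix_greedyMatrix k
  have hrep : Represents (greedyMatrix k) (k + t) t (s.mem 2) (s.mem 3) := by
    simpa using h.represents
  have htab : Tables k n w (k + t) (s.mem 2) (s.mem 3) 0 0 s :=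
    ⟨hc, ht, htn.le, rfl, rfl, h.counts, h.elevs⟩
  rw [nextRow, wp_branch, ht, hc.reg0, if_neg (by lia)]
  refine (wp_greedyStep htab rfl).mono ?_
  rintro s' T ⟨hT, htab', d, hd, hleast⟩
  simp only [hrep.passes_iff hR hk rfl hd] at hleast
  have hleast := hleast ⟨_, nextIndex_lt _ t, suitable_nextIndex _ t⟩
  refine ⟨by lia, htab'.counts, htab'.elevs, ?_, le_antisymm
    (hleast.2 ⟨nextIndex_lt _ t, suitable_nextIndex _ t⟩) (nextIndex_le hleast.1.1 hleast.1.2)⟩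
  rw [htab'.weights, htab'.marks]
  exact hrep.mark_succ hR

theorem wp_nextRow (hk : 0 < k) (hc : Context k n w s) (h : HasRows k j s) (hj : s.reg 20 = j)
    (hjn : j < n) :
    WP w nextRow s fun s' t => t ≤ 2 ^ k * 2 ^ k * 400 + 3 ∧ s'.mem 4 = 0 ∧ s'.mem 6 = 0 ∧
      Represents (greedyMatrix k) j (j + 1 - k) (s'.mem 2) (s'.mem 3) ∧
      (s'.reg 21 < 2 ^ k ∧ toWord k (s'.reg 21) = greedyMatrix k j) ∧
      (j + 1 ≤ k → s'.reg 26 = 2 ^ (k - (j + 1))) := by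
  rcases lt_or_ge j k with hjk | hjk
  · refine (wp_nextRow_of_lt hc h hj hjk).mono fun s' t ⟨_, hmem, h26, h21⟩ => ?_
    rw [hmem, h21, h26, show k - (j + 1) = k - 1 - j by lia, toWord_two_pow hjk,
      greedyMatrix_of_lt hjk, show j + 1 - k = j - k by lia]
    exact ⟨by lia, h.counts, h.elevs, h.represents,
      ⟨Nat.pow_lt_pow_right (by norm_num) (by lia), rfl⟩, fun _ => rfl⟩
  · obtain ⟨t, rfl⟩ := Nat.exists_eq_add_of_le hjk
    refine (wp_nextRow_of_ge hk hc h hj hjn).mono fun s' T ⟨_, h4, h6, hrep, h21⟩ => ?_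
    rw [h21, greedyMatrix_add, show k + t + 1 - k = t + 1 by lia]
    exact ⟨by lia, h4, h6, hrep, ⟨nextIndex_lt _ t, rfl⟩, by lia⟩

/-- Compute the first `n` rows of the greedy matrix. -/
def greedyProgram : Program :=
  .block [.arith .add 26 3 6, .store 3 6 2, .forLoop 20 1 (.seq nextRow addRow)]

theorem wp_nextRow_addRow (hk : 0 < k) (hc : Context k n w s) (h : HasRows k j s)
    (hj : s.reg 20 = j) (hjn : j < n) :
    WP w (.seq nextRow addRow) s fun s' t => t ≤ 2 ^ k * 2 ^ k * 400 + 2 ^ k * 32 + 30 ∧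
      HasRows k (j + 1) s' := by
  refine wp_seq.mpr ((wp_nextRow hk hc h hj hjn).frame.mono ?_)
  rintro s₁ t₁ ⟨⟨ht₁, h4, h6, hrep, hrow, hunit⟩, hf₁⟩
  have htab : Tables k n w j (s₁.mem 2) (s₁.mem 3) 0 0 s₁ :=
    ⟨hc.of_frame hf₁ (by decide), (hf₁.reg 20 (by decide)).trans hj, hjn.le, rfl, rfl, h4, h6⟩
  refine (wp_addRow htab rfl hrow.1 fun x hx => (hrep.weight_le hx).trans hjn.le).frame.mono ?_
  rintro s₂ t₂ ⟨⟨ht₂, h5, hwt⟩, hf₂⟩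
  refine ⟨by lia, {
    counts := (hf₂.mem 4 (by decide)).trans h4
    elevs := (hf₂.mem 6 (by decide)).trans h6
    represents := by rw [hf₂.mem 3 (by decide)]; exact hrep.succ hrow.2 hwt
    rows := fun i hi => ?_
    unitVector := by rw [hf₂.reg 26 (by decide)]; exact hunit }⟩
  rw [h5, hf₁.mem 5 (by decide), Function.update_apply]
  split_ifs with hij
  · rwa [hij]
  · exact h.rows i (by lia)

theorem hasRows_zero (h26 : s.reg 26 = 2 ^ k) (h2 : s.mem 2 = 0) (h3 : s.mem 3 = Pi.single 0 1)
    (h4 : s.mem 4 = 0) (h6 : s.mem 6 = 0) : HasRows k 0 s where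
  counts := h4
  elevs := h6
  represents := by
    refine ⟨fun x _ => ?_, fun x _ => ?_⟩
    · rw [h2, Subsingleton.elim (codeword (greedyMatrix k) 0 (toWord k x)) 0, hammingNorm_zero,
        Pi.zero_apply]
    · simp [h3, Pi.single_apply, marked]
  rows := by simp
  unitVector _ := h26

theorem wp_greedyProgram (hk : 0 < k) (hc : Context k n w s) (h2 : s.mem 2 = 0)
    (h3 : s.mem 3 = 0) (h4 : s.mem 4 = 0) (h6 : s.mem 6 = 0) :
    WP w greedyProgram s fun s' t => t ≤ n * (2 ^ k * 2 ^ k * 400 + 2 ^ k * 32 + 32) + 8 ∧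
      ∀ i < n, s'.mem 5 i < 2 ^ k ∧ toWord k (s'.mem 5 i) = greedyMatrix k i := by
  have hfit := hc.words_fit
  have hn : 64 * (1 * (n + 1)) ≤ 2 ^ w :=
    hc.fits_of_le (Nat.one_le_iff_ne_zero.mpr (by positivity)) (by nlinarith)
  simp only [greedyProgram, Program.block, wp_seq, wp_store, wp_arith, MachineState.setReg_reg,
    ArithOp.eval, Nat.reduceEqDiff, ↓reduceIte, hc.reg2, hc.reg3, hc.reg6, Nat.add_zero]
  refine ⟨by lia, ?_⟩
  have hc' : Context k n w ((s.setReg 26 (2 ^ k)).setMem 3 0 1) :=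
    (hc.setReg (r := 26) (by norm_num) _).of_frame (P := .store 3 6 2)
      (.setMem _ (List.mem_singleton_self 3) 0 1) (by decide)
  refine (wp_for (HasRows k) (by decide) hc'.reg2 hc'.reg1 (by lia)
    (fun m s v h => ⟨h.counts, h.elevs, h.represents, h.rows, by simpa using h.unitVector⟩)
    (hasRows_zero (by simp) (by simp [h2]) (by simp [h3, Pi.single]) (by simp [h4])
      (by simp [h6]))
    fun j hj s₁ hf hreg hrows => wp_nextRow_addRow hk (hc'.of_frame hf (by decide)) hrows hreg
      hj).mono fun s' t h => ⟨?_, h.2.1.rows⟩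
  exact (Nat.add_le_add_left (Nat.add_le_add_left h.1 1) 1).trans (by lia)

end GreedyProgram

/-! ### Encoding and maximum-likelihood decoding -/

section FirstMin

variable {f : ℕ → ℕ} {m x x' : ℕ}

/-- `x` is the first of the numbers below `m` at which `f` is minimal. -/
def IsFirstMin (f : ℕ → ℕ) (m x : ℕ) : Prop :=
  x < m ∧ (∀ z < m, f x ≤ f z) ∧ ∀ z < x, f x < f z

theorem isFirstMin_one (f : ℕ → ℕ) : IsFirstMin f 1 0 := by
  simp [IsFirstMin]

theorem IsFirstMin.succ_of_lt (h : IsFirstMin f m x) (hm : f m < f x) :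
    IsFirstMin f (m + 1) m := by
  grind [IsFirstMin]

theorem IsFirstMin.succ_of_le (h : IsFirstMin f m x) (hm : f x ≤ f m) :
    IsFirstMin f (m + 1) x := by
  grind [IsFirstMin]

theorem IsFirstMin.unique (h : IsFirstMin f m x) (h' : IsFirstMin f m x') : x = x' := by
  grind [IsFirstMin]

theorem exists_isFirstMin (f : ℕ → ℕ) (hm : 0 < m) : ∃ x, IsFirstMin f m x := by
  induction m, hm using Nat.le_induction with
  | base => exact ⟨0, isFirstMin_one f⟩
  | succ m _ ih =>
    obtain ⟨x, hx⟩ := ih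
    rcases lt_or_ge (f m) (f x) with hlt | hle
    exacts [⟨m, hx.succ_of_lt hlt⟩, ⟨x, hx.succ_of_le hle⟩]

end FirstMin

section Code

variable {k n : ℕ}

/-- The distance of `y` from the codeword of the word with numeral `x`. -/
def codewordDist (R : ℕ → Word k) (y : Word n) (x : ℕ) : ℕ :=
  hammingDist y (codeword R n (toWord k x))

theorem codewordDist_le (R : ℕ → Word k) (y : Word n) (x : ℕ) : codewordDist R y x ≤ n :=
  hammingDist_le_card_fintype.trans_eq (Fintype.card_fin n)

/-- The numeral of the first word whose codeword is closest to `y`. -/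
def closest (R : ℕ → Word k) (y : Word n) : ℕ :=
  (exists_isFirstMin (codewordDist R y) (Nat.two_pow_pos k)).choose

theorem isFirstMin_closest (R : ℕ → Word k) (y : Word n) :
    IsFirstMin (codewordDist R y) (2 ^ k) (closest R y) :=
  (exists_isFirstMin (codewordDist R y) (Nat.two_pow_pos k)).choose_spec

/-- The code generated by the greedy matrix, with maximum-likelihood decoding. -/
def greedyCode : RatelessCode where
  enc k m i := greedyMatrix k i ⬝ᵥ m
  dec _ k y := toWord k (closest (greedyMatrix k) y)

theorem greedyCode_isGeneratedBy : greedyCode.IsGeneratedBy greedyMatrix := fun _ _ _ => rfl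

theorem greedyCode_isSystematic : greedyCode.IsSystematic := fun k =>
  codeword_self (isGreedyMatrix_greedyMatrix k)

theorem greedyCode_isMaximumLikelihood : greedyCode.IsMaximumLikelihood := by
  intro n k y m
  obtain ⟨x, hx, rfl⟩ := exists_toWord m
  exact (isFirstMin_closest (greedyMatrix k) y).2.1 x hx

end Code

section Programs

variable {k n w l x : ℕ} {R : ℕ → Word k} {s s' : MachineState} {P : Program}

/-- The state of the machine after the first `n` rows of `R` have been computed: their numerals are
in array `5`, and the input `y` is still in array `0`. -/
structure Prepared (R : ℕ → Word k) (n w : ℕ) (y : Word l) (s : MachineState) : Prop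
    extends Context k n w s where
  input : ∀ i : Fin l, s.mem 0 i = (y i).val
  row_lt : ∀ i < n, s.mem 5 i < 2 ^ k
  toWord_row : ∀ i < n, toWord k (s.mem 5 i) = R i

namespace Prepared

variable {y : Word l}

theorem of_frame (h : Prepared R n w y s) (hf : Frame P s s')
    (hP : P.KeepsContext ∧ 0 ∉ P.arrays ∧ 5 ∉ P.arrays) : Prepared R n w y s' where
  toContext := h.toContext.of_frame hf hP.1
  input := by rw [hf.mem 0 hP.2.1]; exact h.input
  row_lt := by rw [hf.mem 5 hP.2.2]; exact h.row_lt
  toWord_row := by rw [hf.mem 5 hP.2.2]; exact h.toWord_row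

theorem setReg (h : Prepared R n w y s) {r : ℕ} (hr : 7 ≤ r) (v : ℕ) :
    Prepared R n w y (s.setReg r v) :=
  ⟨h.toContext.setReg hr v, h.input, h.row_lt, h.toWord_row⟩

theorem table_row (h : Prepared R n w y s) (hx : x < 2 ^ k) {i : ℕ} (hi : i < n) :
    s.mem 7 (s.mem 5 i * 2 ^ k + x) = (R i ⬝ᵥ toWord k x).val := by
  rw [h.table _ (h.row_lt i hi) x hx, ← h.toWord_row i hi, toWord_dotProduct_val]

theorem address_lt (h : Prepared R n w y s) (hx : x < 2 ^ k) {i : ℕ} (hi : i < n) :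
    s.mem 5 i * 2 ^ k + x < 2 ^ k * 2 ^ k := by
  have := Nat.mul_le_mul_right (2 ^ k) (Nat.succ_le_of_lt (h.row_lt i hi))
  lia

end Prepared

theorem fits_of_word_size {c : ℕ} (hc : 10 ≤ c) :
    64 * ((2 ^ k * 2 ^ k) * ((n + 1) * (n + 1))) ≤ 2 ^ (c * (k + Nat.log 2 n + 1)) := by
  have hn : n + 1 ≤ 2 ^ (Nat.log 2 n + 1) := Nat.lt_pow_succ_log_self (by norm_num) n
  calc 64 * ((2 ^ k * 2 ^ k) * ((n + 1) * (n + 1)))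
      ≤ 2 ^ 6 * ((2 ^ k * 2 ^ k) * (2 ^ (Nat.log 2 n + 1) * 2 ^ (Nat.log 2 n + 1))) := by
        gcongr
        norm_num
    _ = 2 ^ (6 + (k + k + (Nat.log 2 n + 1 + (Nat.log 2 n + 1)))) := by simp only [pow_add]
    _ ≤ 2 ^ (10 * (k + Nat.log 2 n + 1)) := Nat.pow_le_pow_right (by norm_num) (by lia)
    _ ≤ 2 ^ (c * (k + Nat.log 2 n + 1)) := Nat.pow_le_pow_right (by norm_num) (by gcongr)

theorem self_le_two_pow_mul (k a : ℕ) : a ≤ a * 2 ^ (2 * k) :=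
  Nat.le_mul_of_pos_right a (by positivity)

theorem add_le_mul_two_pow (hk : 1 ≤ k) (hn : 1 ≤ n) : n + k ≤ 2 * (n * k * 2 ^ (2 * k)) := by
  have := Nat.le_mul_of_pos_right n hk
  have := Nat.le_mul_of_pos_left k hn
  have := self_le_two_pow_mul k (n * k)
  lia

/-- Set up the tables and compute the first `n` rows of the greedy matrix. -/
def prepare : Program := .seq setup greedyProgram

theorem prepare_time_le (hk : 1 ≤ k) (hn : 1 ≤ n) :
    2 ^ k * 2 ^ k * (k * 32 + 32) + k * 32 + 16 +
      (n * (2 ^ k * 2 ^ k * 400 + 2 ^ k * 32 + 32) + 8) ≤ 600 * (n * k * 2 ^ (2 * k)) := by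
  obtain ⟨a, rfl⟩ := Nat.exists_eq_add_of_le hk
  obtain ⟨b, rfl⟩ := Nat.exists_eq_add_of_le hn
  obtain ⟨K, hK⟩ := Nat.exists_eq_add_of_le (Nat.one_le_two_pow (n := 1 + a))
  rw [two_mul (1 + a), pow_add 2 (1 + a) (1 + a), hK]
  ring_nf
  lia

theorem wp_prepare {c : ℕ} (hk : 1 ≤ k) (hn : 1 ≤ n) (hc : 10 ≤ c) (y : Word l) :
    WP (c * (k + Nat.log 2 n + 1)) prepare (initialState k n y) fun s t =>
      t ≤ 600 * (n * k * 2 ^ (2 * k)) ∧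
      Prepared (greedyMatrix k) n (c * (k + Nat.log 2 n + 1)) y s := by
  have hmem : ∀ A ≠ 0, (initialState k n y).mem A = 0 := fun A hA => by
    ext i
    simp [initialState, hA]
  refine wp_seq.mpr ((wp_setup (by simp [initialState]) (by simp [initialState])
    (fits_of_word_size hc)).frame.mono ?_)
  rintro s₁ t₁ ⟨⟨ht₁, hc₁⟩, hf₁⟩
  have hzero : ∀ A, A ∉ setup.arrays ∧ A ≠ 0 → s₁.mem A = 0 := fun A hA =>
    (hf₁.mem A hA.1).trans (hmem A hA.2)
  refine (wp_greedyProgram hk hc₁ (hzero 2 (by decide)) (hzero 3 (by decide))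
    (hzero 4 (by decide)) (hzero 6 (by decide))).frame.mono ?_
  rintro s₂ t₂ ⟨⟨ht₂, hrows⟩, hf₂⟩
  refine ⟨(Nat.add_le_add ht₁ ht₂).trans (prepare_time_le hk hn), {
    toContext := hc₁.of_frame hf₂ (by decide)
    input := fun i => ?_
    row_lt := fun i hi => (hrows i hi).1
    toWord_row := fun i hi => (hrows i hi).2 }⟩
  rw [hf₂.mem 0 (by decide), hf₁.mem 0 (by decide)]
  simp [initialState]

/-- Read the numeral of the input word into register `27`. -/
def readWord : Program :=
  .block [.const 27 0, .forLoop 10 0 <| .block [.load 11 0 10, .arith .add 27 27 27,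
    .arith .add 27 27 11]]

theorem wp_readWord (h : Prepared R n w (toWord k x) s) (hx : x < 2 ^ k) :
    WP w readWord s fun s' t => t ≤ k * 32 + 4 ∧ s'.reg 27 = x := by
  have hfit := h.words_fit
  have hk : k < 2 ^ k := Nat.lt_two_pow_self
  simp only [readWord, Program.block, wp_seq, wp_const]
  refine ⟨by lia, ?_⟩
  have h' := h.setReg (r := 27) (by lia) 0
  refine (wp_for (N := k) (T := 30) (fun m s' => s'.reg 27 = x / 2 ^ (k - m))
    (by decide) h'.reg2 h'.reg0 (by lia) (fun _ _ _ h => by simpa using h)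
    (by simp [Nat.div_eq_of_lt hx]) ?_).mono
    fun s' t hs' => ⟨by lia, by simpa using hs'.2.1⟩
  intro m hm s₁ hf hi hprefix
  have hbit : s₁.mem 0 m = x / 2 ^ (k - (m + 1)) % 2 := by
    rw [(h'.of_frame hf (by decide)).input ⟨m, hm⟩, toWord_apply_val, Nat.sub_sub, add_comm 1]
  have hpow : x / 2 ^ (k - m) = x / 2 ^ (k - (m + 1)) / 2 := by
    rw [show k - m = k - (m + 1) + 1 by lia, pow_succ, Nat.div_div_eq_div_mul]
  have hle : x / 2 ^ (k - (m + 1)) ≤ x := Nat.div_le_self _ _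
  simp only [wp_seq, wp_load, wp_arith, MachineState.setReg_reg, ArithOp.eval, ↓reduceIte,
    Nat.reduceEqDiff, hi, hprefix, hbit, hpow]
  lia

/-- Write the codeword of the word with numeral in register `27`. -/
def writeCodeword : Program :=
  .forLoop 10 1 <| .block [.load 11 5 10, .arith .mul 11 11 3, .arith .add 11 11 27,
    .load 11 7 11, .store 1 10 11]

theorem wp_writeCodeword {y : Word l} (h : Prepared R n w y s) (hx : x < 2 ^ k)
    (h27 : s.reg 27 = x) :
    WP w writeCodeword s fun s' t => t ≤ n * 32 + 2 ∧
      ∀ i : Fin n, s'.mem 1 i = (codeword R n (toWord k x) i).val := by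
  have hpairs := h.pairs_fit
  have hn : 64 * (1 * (n + 1)) ≤ 2 ^ w :=
    h.fits_of_le (Nat.one_le_iff_ne_zero.mpr (by positivity)) (by nlinarith)
  refine (wp_for (N := n) (T := 30)
    (fun m s' => ∀ i < m, s'.mem 1 i = (R i ⬝ᵥ toWord k x).val)
    (by decide) h.reg2 h.reg1 (by lia) (fun _ _ _ h => h) (by simp) ?_).mono
    fun s' t hs' => ⟨hs'.1, fun i => hs'.2.1 i i.2⟩
  intro m hm s₁ hf hi hprefix
  have h₁ := h.of_frame hf (by decide)
  have hword : s₁.reg 27 = x := (hf.reg 27 (by decide)).trans h27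
  have haddr := h₁.address_lt hx hm
  simp only [Program.block, wp_seq, wp_load, wp_arith, wp_store, MachineState.setReg_reg,
    MachineState.setReg_mem, MachineState.setMem_mem, ArithOp.eval, ↓reduceIte,
    Nat.reduceEqDiff, hi, hword, h₁.reg3, h₁.table_row hx hm]
  refine ⟨by lia, by lia, by lia, fun i _ => ?_⟩
  grind [Function.update_apply]

/-- The encoder. -/
def encoder : Program := .block [prepare, readWord, writeCodeword]

theorem greedyCode_encodesInTime :
    greedyCode.EncodesInTime fun k n => n * k * 2 ^ (2 * k) := by
  refine ⟨encoder, 1000, fun k n hk hn m => ?_⟩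
  obtain ⟨x, hx, rfl⟩ := exists_toWord m
  refine wp_seq.mpr ((wp_prepare hk hn (by norm_num) _).mono fun s₁ t₁ ⟨_, h₁⟩ => ?_)
  refine wp_seq.mpr ((wp_readWord h₁ hx).frame.mono fun s₂ t₂ ⟨⟨_, h27⟩, hf₂⟩ => ?_)
  refine (wp_writeCodeword (h₁.of_frame hf₂ (by decide)) hx h27).mono
    fun s₃ t₃ ⟨_, hout⟩ => ⟨?_, hout⟩
  have := add_le_mul_two_pow hk hn
  lia

/-- Compute in register `24` the distance of the input from the codeword of the word with numeral in
register `22`. -/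
def distProgram : Program :=
  .block [.const 24 0, .forLoop 10 1 <| .block [.load 11 5 10, .arith .mul 11 11 3,
    .arith .add 11 11 22, .load 11 7 11, .load 12 0 10,
    .branch 11 12 (.arith .add 24 24 2) (.branch 12 11 (.arith .add 24 24 2) .skip)]]

theorem wp_distProgram {y : Word n} (h : Prepared R n w y s) (hx : x < 2 ^ k)
    (h22 : s.reg 22 = x) :
    WP w distProgram s fun s' t => t ≤ n * 32 + 4 ∧ s'.reg 24 = codewordDist R y x := by
  have hpairs := h.pairs_fit
  have hn : 64 * (1 * (n + 1)) ≤ 2 ^ w :=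
    h.fits_of_le (Nat.one_le_iff_ne_zero.mpr (by positivity)) (by nlinarith)
  simp only [distProgram, Program.block, wp_seq, wp_const]
  refine ⟨by lia, ?_⟩
  have h' := h.setReg (r := 24) (by lia) 0
  refine (wp_for (N := n) (T := 30) (fun m s' => s'.reg 24 =
    ∑ i ∈ range m, if s.mem 0 i ≠ (R i ⬝ᵥ toWord k x).val then 1 else 0)
    (by decide) h'.reg2 h'.reg1 (by lia) (fun _ _ _ h => by simpa using h) (by simp) ?_).mono
    fun s' t hs' => ⟨by lia, ?_⟩
  · intro m hm s₁ hf hi hsum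
    have h₁ := h'.of_frame hf (by decide)
    have hinput : s₁.mem 0 = s.mem 0 := hf.mem 0 (by decide)
    have hword : s₁.reg 22 = x := (hf.reg 22 (by decide)).trans (by simpa using h22)
    have haddr := h₁.address_lt hx hm
    have hle : s₁.reg 24 ≤ m := by
      rw [hsum, ← card_filter]
      exact (card_filter_le _ _).trans_eq (card_range m)
    rw [sum_range_succ, ← hsum]
    simp only [wp_seq, wp_load, wp_arith, wp_branch, wp_skip, MachineState.setReg_reg,
      MachineState.setReg_mem, ArithOp.eval, ↓reduceIte, Nat.reduceEqDiff, hi, hinput, hword,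
      h₁.reg2, h₁.reg3, h₁.table_row hx hm]
    refine ⟨by lia, by lia, ?_⟩
    split_ifs <;> lia
  · rw [hs'.2.1, codewordDist, hammingDist, card_filter, sum_range]
    refine sum_congr rfl fun i _ => if_congr ?_ rfl rfl
    rw [h.input i]
    exact (ZMod.val_injective 2).ne_iff

/-- Find the numeral of the first word whose codeword is closest to the input. The minimum distance
so far is in register `28`, and the word that attains it in register `29`. -/
def findClosest : Program :=
  .block [.arith .add 28 1 2, .forLoop 22 3 <| .block [distProgram,
    .branch 24 28 (.block [.arith .add 28 24 6, .arith .add 29 22 6]) .skip]]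

/-- The state of the search after the words with numerals below `m` have been tried. -/
def Searched (R : ℕ → Word k) (y : Word n) (m : ℕ) (s : MachineState) : Prop :=
  m = 0 ∧ s.reg 28 = n + 1 ∨
    s.reg 28 = codewordDist R y (s.reg 29) ∧ IsFirstMin (codewordDist R y) m (s.reg 29)

theorem wp_findClosest_step {y : Word n} {m : ℕ} (h : Prepared R n w y s) (hm : m < 2 ^ k)
    (hreg : s.reg 22 = m) (hsearch : Searched R y m s) :
    WP w (.seq distProgram <|
      .branch 24 28 (.block [.arith .add 28 24 6, .arith .add 29 22 6]) .skip) s fun s' t =>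
        t ≤ n * 32 + 30 ∧ Searched R y (m + 1) s' := by
  have hfit := h.words_fit
  have hn : 64 * (1 * (n + 1)) ≤ 2 ^ w :=
    h.fits_of_le (Nat.one_le_iff_ne_zero.mpr (by positivity)) (by nlinarith)
  have hdist := codewordDist_le R y m
  refine wp_seq.mpr ((wp_distProgram h hm hreg).frame.mono fun s₁ t ⟨⟨ht, h24⟩, hf⟩ => ?_)
  have h22 : s₁.reg 22 = m := (hf.reg 22 (by decide)).trans hreg
  have h6 : s₁.reg 6 = 0 := (hf.reg 6 (by decide)).trans h.reg6
  simp only [Searched, Program.block, wp_branch, wp_seq, wp_arith, wp_skip,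
    MachineState.setReg_reg, ArithOp.eval, ↓reduceIte, Nat.reduceEqDiff, h24, h22, h6,
    hf.reg 28 (by decide), hf.reg 29 (by decide), Nat.add_zero]
  obtain ⟨rfl, h28⟩ | ⟨h28, hmin⟩ := hsearch
  · rw [if_pos (by lia)]
    exact ⟨by lia, by lia, by lia, .inr ⟨trivial, isFirstMin_one _⟩⟩
  · split_ifs with hlt
    · exact ⟨by lia, by lia, by lia, .inr ⟨trivial, hmin.succ_of_lt (h28 ▸ hlt)⟩⟩
    · exact ⟨by lia, .inr ⟨h28, hmin.succ_of_le (h28 ▸ not_lt.mp hlt)⟩⟩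

theorem wp_findClosest {y : Word n} (h : Prepared R n w y s) :
    WP w findClosest s fun s' t => t ≤ 2 ^ k * (n * 32 + 32) + 4 ∧ s'.reg 29 = closest R y := by
  have hn : 64 * (1 * (n + 1)) ≤ 2 ^ w :=
    h.fits_of_le (Nat.one_le_iff_ne_zero.mpr (by positivity)) (by nlinarith)
  simp only [findClosest, Program.block, wp_seq, wp_arith, ArithOp.eval, h.reg1, h.reg2]
  refine ⟨by lia, ?_⟩
  have h' := h.setReg (r := 28) (by lia) (n + 1)
  refine (h'.toContext.wp_forWords (T := n * 32 + 30) (Searched R y) (by decide)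
    (fun _ _ _ h => by simpa [Searched] using h) (.inl (by simp))
    fun m hm s₁ hf _ hreg => wp_findClosest_step (h'.of_frame hf (by decide)) hm hreg).mono
    fun s' t ⟨_, hsearch⟩ => ⟨by lia, ?_⟩
  obtain ⟨hzero, -⟩ | ⟨-, hmin⟩ := hsearch
  · exact absurd hzero (by positivity)
  · exact hmin.unique (isFirstMin_closest R y)

/-- Write the word with numeral in register `29`. -/
def writeWord : Program :=
  .forLoop 10 0 <| .block [.arith .sub 11 0 2, .arith .sub 11 11 10, .arith .div 12 29 4,
    .arith .add 13 12 12, .arith .sub 13 29 13, .store 1 11 13, .arith .add 29 12 6]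

theorem wp_writeWord (h : Context k n w s) (hx : x < 2 ^ k) (h29 : s.reg 29 = x) :
    WP w writeWord s fun s' t => t ≤ k * 32 + 2 ∧
      ∀ i : Fin k, s'.mem 1 i = (toWord k x i).val := by
  have hfit := h.words_fit
  have hk : k < 2 ^ k := Nat.lt_two_pow_self
  refine (wp_for (N := k) (T := 30) (fun m s' => s'.reg 29 = x / 2 ^ m ∧
      ∀ i < m, s'.mem 1 (k - 1 - i) = x / 2 ^ i % 2)
    (by decide) h.reg2 h.reg0 (by lia) (fun _ _ _ h => by simpa using h) (by simp [h29]) ?_).mono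
    fun s' t hs' => ⟨hs'.1, fun i => ?_⟩
  · intro m hm s₁ hf hi ⟨hrest, hbits⟩
    have h₁ := h.of_frame hf (by decide)
    have hle : x / 2 ^ m ≤ x := Nat.div_le_self _ _
    simp only [Program.block, wp_seq, wp_arith, wp_store, MachineState.setReg_reg,
      MachineState.setReg_mem, MachineState.setMem_mem, MachineState.setMem_reg, ArithOp.eval,
      ↓reduceIte, Nat.reduceEqDiff, hi, hrest, h₁.reg0, h₁.reg2, h₁.reg4, h₁.reg6, pow_succ,
      ← Nat.div_div_eq_div_mul, Nat.add_zero]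
    refine ⟨by lia, by lia, by lia, by lia, by lia, by lia, by lia, trivial, fun i hi' => ?_⟩
    rcases Nat.lt_succ_iff_lt_or_eq.mp hi' with hlt | rfl
    · rw [Function.update_of_ne (by lia), hbits i hlt]
    · rw [Function.update_self]
      lia
  · rw [toWord_apply_val, ← hs'.2.1.2 (k - 1 - i) (by lia)]
    congr 1
    lia

/-- The decoder. -/
def decoder : Program := .block [prepare, findClosest, writeWord]

theorem findClosest_time_le (hk : 1 ≤ k) (hn : 1 ≤ n) :
    2 ^ k * (n * 32 + 32) ≤ 64 * (n * k * 2 ^ (2 * k)) :=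
  calc 2 ^ k * (n * 32 + 32)
      ≤ 2 ^ (2 * k) * (n * k * 32 + n * k * 32) := by
        gcongr
        · norm_num
        · lia
        · exact Nat.le_mul_of_pos_right n hk
        · exact Nat.le_mul_of_pos_left 32 (Nat.mul_pos hn hk)
    _ = 64 * (n * k * 2 ^ (2 * k)) := by ring

theorem greedyCode_decodesInTime :
    greedyCode.DecodesInTime fun k n => n * k * 2 ^ (2 * k) := by
  refine ⟨decoder, 1000, fun k n hk hn y => ?_⟩
  refine wp_seq.mpr ((wp_prepare hk hn (by norm_num) _).mono fun s₁ t₁ ⟨_, h₁⟩ => ?_)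
  refine wp_seq.mpr ((wp_findClosest h₁).frame.mono fun s₂ t₂ ⟨⟨_, h29⟩, hf₂⟩ => ?_)
  refine (wp_writeWord (h₁.toContext.of_frame hf₂ (by decide)) (isFirstMin_closest _ y).1
    h29).mono fun s₃ t₃ ⟨_, hout⟩ => ⟨?_, hout⟩
  have := add_le_mul_two_pow hk hn
  have := findClosest_time_le hk hn
  lia

end Programs

end Rateless

end

theorem theorem3 :
    ∃ (C : Rateless.RatelessCode) (G : (k : ℕ) → ℕ → Rateless.Word k),
      -- the code is linear, with a generator matrix built by the greedy algorithm, systematic,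
      -- and decoded by maximum likelihood
      C.IsGeneratedBy G ∧ (∀ k, Rateless.IsGreedyMatrix (G k)) ∧
      C.IsSystematic ∧ C.IsMaximumLikelihood ∧
      -- error probability
      (∀ p : ℝ, 0 < p → p < 1 / 2 → ∀ δ : ℝ, 0 < δ → δ < 1 - Rateless.entropy p →
        ∃ c : ℝ, 0 < c ∧ ∀ k n : ℕ, 2 ≤ n →
          (k : ℝ) / (1 - Rateless.entropy p - δ) ≤ (n : ℝ) →
          C.errorProb p k n ≤ Real.exp (-(c * ((n : ℝ) / Real.log n)))) ∧
      -- complexity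
      C.EncodesInTime (fun k n => n * k * 2 ^ (2 * k)) ∧
      C.DecodesInTime (fun k n => n * k * 2 ^ (2 * k)) :=
  ⟨Rateless.greedyCode, Rateless.greedyMatrix, Rateless.greedyCode_isGeneratedBy,
    Rateless.isGreedyMatrix_greedyMatrix, Rateless.greedyCode_isSystematic,
    Rateless.greedyCode_isMaximumLikelihood,
    fun _ hp hp' _ hδ hδ' => Rateless.errorProb_exponent Rateless.greedyCode_isGeneratedBy
      Rateless.isGreedyMatrix_greedyMatrix Rateless.greedyCode_isMaximumLikelihood hp hp' hδ hδ',
    Rateless.greedyCode_encodesInTime, Rateless.greedyCode_decodesInTime⟩
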